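/- All manifolds are smooth and Hausdorff, and closed means compact without boundary. Let $M_0$ and $M_1$ be closed manifolds, not necessarily connected, of dimensions $n_0$ and $n_1$, each of which admits a Riemannian metric of (everywhere) positive scalar curvature. Suppose $M_0=\partial W_0$ and $M_1=\partial W_1$ for some compact manifolds with boundary $W_0$ and $W_1$, of dimensions $n_0+1$ and $n_1+1$. Let \[ M=(W_0\times M_1)\cup_{M_0\times M_1}(M_0\times W_1) \] be the closed manifold of dimension $n_0+n_1+1$ obtained by gluing $W_0\times M_1$ and $M_0\times W_1$ along their common boundary $M_0\times M_1$; as usual, its smooth structure is the one determined by a choice of collars of $M_0$ in $W_0$ and of $M_1$ in $W_1$ (it does not depend on this choice up to diffeomorphism). Then $M$ admits a Riemannian metric of positive scalar curvature. -/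

import Mathlib

open scoped Manifold ContDiff

noncomputable section

/-! ### Scalar curvature of a metric given in coordinates on (an open subset of) `ℝⁿ` -/

/-- The `i`-th partial derivative of a real function on `ℝⁿ`. -/
def coordDeriv {n : ℕ} (i : Fin n) (f : EuclideanSpace ℝ (Fin n) → ℝ)
    (u : EuclideanSpace ℝ (Fin n)) : ℝ :=
  fderiv ℝ f u (EuclideanSpace.single i 1)

/-- The Christoffel symbol `Γ^k_{ij}` of the metric with coefficient matrix `G = (g_{ij})`:
`Γ^k_{ij} = ½ ∑ₗ g^{kl} (∂ᵢ g_{jl} + ∂ⱼ g_{il} - ∂ₗ g_{ij})`. -/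
def christoffelSymbol {n : ℕ} (G : EuclideanSpace ℝ (Fin n) → Matrix (Fin n) (Fin n) ℝ)
    (k i j : Fin n) (u : EuclideanSpace ℝ (Fin n)) : ℝ :=
  1 / 2 * ∑ l, (G u)⁻¹ k l *
    (coordDeriv i (fun v => G v j l) u + coordDeriv j (fun v => G v i l) u
      - coordDeriv l (fun v => G v i j) u)

/-- The Ricci tensor in coordinates:
`R_{jk} = ∑ᵢ (∂ᵢ Γ^i_{jk} - ∂ₖ Γ^i_{ij}) + ∑_{i,p} (Γ^i_{ip} Γ^p_{jk} - Γ^i_{kp} Γ^p_{ij})`. -/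
def ricciCoord {n : ℕ} (G : EuclideanSpace ℝ (Fin n) → Matrix (Fin n) (Fin n) ℝ)
    (j k : Fin n) (u : EuclideanSpace ℝ (Fin n)) : ℝ :=
  (∑ i, (coordDeriv i (christoffelSymbol G i j k) u - coordDeriv k (christoffelSymbol G i i j) u))
    + ∑ i, ∑ p, (christoffelSymbol G i i p u * christoffelSymbol G p j k u
        - christoffelSymbol G i k p u * christoffelSymbol G p i j u)

/-- The scalar curvature in coordinates, `∑_{j,k} g^{jk} R_{jk}`. -/
def scalarCurvatureCoord {n : ℕ} (G : EuclideanSpace ℝ (Fin n) → Matrix (Fin n) (Fin n) ℝ)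
    (u : EuclideanSpace ℝ (Fin n)) : ℝ :=
  ∑ j, ∑ k, (G u)⁻¹ j k * ricciCoord G j k u

/-! ### Scalar curvature of a Riemannian manifold without boundary -/

/-- A smooth Riemannian metric on the `n`-dimensional manifold without boundary `M`. -/
abbrev SmoothMetric (n : ℕ) (M : Type*) [TopologicalSpace M]
    [ChartedSpace (EuclideanSpace ℝ (Fin n)) M] [IsManifold (𝓡 n) ∞ M] :=
  Bundle.ContMDiffRiemannianMetric (𝓡 n) ∞ (EuclideanSpace ℝ (Fin n))
    (fun x : M => TangentSpace (𝓡 n) x)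

/-- The coefficients `g_{ij} = g(∂ᵢ, ∂ⱼ)` of a Riemannian metric in the preferred chart `φ` at `x`,
as functions on the coordinate domain `φ.target ⊆ ℝⁿ`; the coordinate vector field `∂ᵢ` at
`φ⁻¹ u` is `d(φ⁻¹)_u (eᵢ)`. -/
def metricCoeff {n : ℕ} {M : Type*} [TopologicalSpace M]
    [ChartedSpace (EuclideanSpace ℝ (Fin n)) M] [IsManifold (𝓡 n) ∞ M]
    (g : SmoothMetric n M) (x : M) (u : EuclideanSpace ℝ (Fin n)) : Matrix (Fin n) (Fin n) ℝ :=
  Matrix.of fun i j =>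
    g.inner ((extChartAt (𝓡 n) x).symm u)
      (mfderiv 𝓘(ℝ, EuclideanSpace ℝ (Fin n)) (𝓡 n) (extChartAt (𝓡 n) x).symm u
        (EuclideanSpace.single i (1 : ℝ)))
      (mfderiv 𝓘(ℝ, EuclideanSpace ℝ (Fin n)) (𝓡 n) (extChartAt (𝓡 n) x).symm u
        (EuclideanSpace.single j (1 : ℝ)))

/-- The scalar curvature of a Riemannian metric at the point `x`. It does not depend on the
coordinates; it is computed here in the preferred chart at `x`. -/
def scalarCurvature {n : ℕ} {M : Type*} [TopologicalSpace M]
    [ChartedSpace (EuclideanSpace ℝ (Fin n)) M] [IsManifold (𝓡 n) ∞ M]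
    (g : SmoothMetric n M) (x : M) : ℝ :=
  scalarCurvatureCoord (metricCoeff g x) (extChartAt (𝓡 n) x x)

/-- `M` admits a smooth Riemannian metric whose scalar curvature is everywhere positive. -/
def AdmitsPSC (n : ℕ) (M : Type*) [TopologicalSpace M]
    [ChartedSpace (EuclideanSpace ℝ (Fin n)) M] [IsManifold (𝓡 n) ∞ M] : Prop :=
  ∃ g : SmoothMetric n M, ∀ x : M, 0 < scalarCurvature g x

/-! ### Boundaries, collars, and gluing -/

/-- `ι : M → W` identifies the `n`-manifold `M` with the boundary of the `(n+1)`-dimensional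
manifold with boundary `W`: `M = ∂W`. -/
structure IsBoundaryInclusion (n : ℕ) {M W : Type*}
    [TopologicalSpace M] [ChartedSpace (EuclideanSpace ℝ (Fin n)) M]
    [TopologicalSpace W] [ChartedSpace (EuclideanHalfSpace (n + 1)) W]
    (ι : M → W) : Prop where
  isSmoothEmbedding : Manifold.IsSmoothEmbedding (𝓡 n) (𝓡∂ (n + 1)) ∞ ι
  range_eq : Set.range ι = (𝓡∂ (n + 1)).boundary W

/-- The point `max t 0` of the half-line `[0, ∞)`, with its structure of manifold with boundary. -/
def halfLinePoint (t : ℝ) : EuclideanHalfSpace 1 :=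
  ⟨EuclideanSpace.single 0 (max t 0), by simp⟩

/-- A collar of the boundary `ι : M → W`: a diffeomorphism `c` of `M × [0, ∞)` onto an open
neighbourhood of the boundary of `W`, which is `ι` on `M × {0}`. -/
structure IsCollar (n : ℕ) {M W : Type*}
    [TopologicalSpace M] [ChartedSpace (EuclideanSpace ℝ (Fin n)) M]
    [TopologicalSpace W] [ChartedSpace (EuclideanHalfSpace (n + 1)) W]
    (ι : M → W) (c : M × EuclideanHalfSpace 1 → W) : Prop where
  injective : Function.Injective c
  isLocalDiffeomorph :
    IsLocalDiffeomorph ((𝓡 n).prod (𝓡∂ 1)) (𝓡∂ (n + 1)) ∞ c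
  apply_zero : ∀ x, c (x, halfLinePoint 0) = ι x

/-- The bicollar of `M₀ × M₁` in a space `M` that is glued from the two pieces `j₀ : W₀ × M₁ → M`
and `j₁ : M₀ × W₁ → M`: for `t ≤ 0` it runs through the collar `c₀` of `M₀` in `W₀` (times the
identity of `M₁`), for `t ≥ 0` through the collar `c₁` of `M₁` in `W₁` (times the identity of
`M₀`). -/
def bicollar {M₀ W₀ M₁ W₁ M : Type*}
    (c₀ : M₀ × EuclideanHalfSpace 1 → W₀) (c₁ : M₁ × EuclideanHalfSpace 1 → W₁)
    (j₀ : W₀ × M₁ → M) (j₁ : M₀ × W₁ → M) (p : (M₀ × M₁) × ℝ) : M :=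
  if p.2 ≤ 0 then j₀ (c₀ (p.1.1, halfLinePoint (-p.2)), p.1.2)
  else j₁ (p.1.1, c₁ (p.1.2, halfLinePoint p.2))

/-- The smooth manifold `M` is the union `(W₀ × M₁) ∪_{M₀ × M₁} (M₀ × W₁)` of `W₀ × M₁` and
`M₀ × W₁` along their common boundary `M₀ × M₁`, with inclusions `j₀` and `j₁` of the two pieces.

As a space, `M` is the pushout of `W₀ × M₁ ← M₀ × M₁ → M₀ × W₁` (all spaces in question are compact
Hausdorff). Its smooth structure is the one obtained, as usual, from collars `c₀` of `M₀ = ∂W₀` and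
`c₁` of `M₁ = ∂W₁`: the interiors of the two pieces and the bicollar
`M₀ × M₁ × ℝ ⊆ M` are open submanifolds of `M`. -/
structure IsSmoothGluing (n₀ n₁ : ℕ) {M₀ W₀ M₁ W₁ M : Type*}
    [TopologicalSpace M₀] [ChartedSpace (EuclideanSpace ℝ (Fin n₀)) M₀]
    [TopologicalSpace W₀] [ChartedSpace (EuclideanHalfSpace (n₀ + 1)) W₀]
    [TopologicalSpace M₁] [ChartedSpace (EuclideanSpace ℝ (Fin n₁)) M₁]
    [TopologicalSpace W₁] [ChartedSpace (EuclideanHalfSpace (n₁ + 1)) W₁]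
    [TopologicalSpace M] [ChartedSpace (EuclideanSpace ℝ (Fin (n₀ + n₁ + 1))) M]
    (ι₀ : M₀ → W₀) (ι₁ : M₁ → W₁) (j₀ : W₀ × M₁ → M) (j₁ : M₀ × W₁ → M) : Prop where
  continuous_left : Continuous j₀
  continuous_right : Continuous j₁
  injective_left : Function.Injective j₀
  injective_right : Function.Injective j₁
  /-- The two pieces cover `M`. -/
  cover : Set.range j₀ ∪ Set.range j₁ = Set.univ
  /-- The two pieces meet exactly in `M₀ × M₁`. -/
  eq_iff : ∀ (w : W₀) (y : M₁) (x : M₀) (v : W₁),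
    j₀ (w, y) = j₁ (x, v) ↔ w = ι₀ x ∧ v = ι₁ y
  /-- The interior of `W₀ × M₁` is an open submanifold. -/
  smooth_left : ∀ (w : W₀) (y : M₁), (𝓡∂ (n₀ + 1)).IsInteriorPoint w →
    IsLocalDiffeomorphAt ((𝓡∂ (n₀ + 1)).prod (𝓡 n₁)) (𝓡 (n₀ + n₁ + 1)) ∞ j₀ (w, y)
  /-- The interior of `M₀ × W₁` is an open submanifold. -/
  smooth_right : ∀ (x : M₀) (v : W₁), (𝓡∂ (n₁ + 1)).IsInteriorPoint v →
    IsLocalDiffeomorphAt ((𝓡 n₀).prod (𝓡∂ (n₁ + 1))) (𝓡 (n₀ + n₁ + 1)) ∞ j₁ (x, v)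
  /-- For suitable collars of the boundaries, the bicollar is an open submanifold. -/
  smooth_bicollar : ∃ (c₀ : M₀ × EuclideanHalfSpace 1 → W₀) (c₁ : M₁ × EuclideanHalfSpace 1 → W₁),
    IsCollar n₀ ι₀ c₀ ∧ IsCollar n₁ ι₁ c₁ ∧
    IsLocalDiffeomorph (((𝓡 n₀).prod (𝓡 n₁)).prod 𝓘(ℝ, ℝ)) (𝓡 (n₀ + n₁ + 1)) ∞
      (bicollar c₀ c₁ j₀ j₁)

end

/-!
Let `g₀` and `g₁` be metrics of positive scalar curvature on `M₀` and `M₁`, and let `t` be the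
parameter of the bicollar `M₀ × M₁ × ℝ ⊆ M`, with `W₀ × M₁` on the side `t ≤ 0`. On the bicollar,
consider metrics `A(t) g₀ + γ(t) dt² + B(t) g₁`. Here `A` is `1` for `t ≥ -1` and a constant `l`
for `-5 ≤ t ≤ -2`, `B` is `1` for `t ≤ 1` and a constant `m` for `2 ≤ t ≤ 5`, and `γ` is a
constant `N` for `|t| ≤ 3` and equal to `l` or `m` for `7/2 ≤ |t| ≤ 5`. On `W₀ × M₁`, beyond depth
`4` of the collar, the metric continues as the product `l H₀ + g₁` with a metric `H₀` on `W₀` that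
is fixed before `l`, `m` and `N` are chosen, and symmetrically on `M₀ × W₁`. The scalar curvature
is positive for suitable parameters:

* Beyond depth `4` it is `l⁻¹ scal(H₀) + scal(g₁)` (`CollaredGluing.scalarCurvature_left`). By
  compactness `scal(H₀)` is bounded below (`CollaredGluing.exists_scalAt_deepForm_bound`) and
  `scal(g₁)` has a positive lower bound, so `l` only has to be large.
* For `-4 < t ≤ 0` it is `A⁻¹ scal(g₀) + scal(g₁)` plus a term that comes from the derivatives of
  `A` (`CollaredGluing.scalarCurvature_neck`). That term vanishes where `A` is constant; elsewhere
  `γ = N`, so the term is `O(1 / N)` for fixed `l` (`exists_warpTerm_bound`), and `N` only has to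
  be large in terms of `l` and `m`.
* The other half of `M` is treated by exchanging the roles of the pieces (`CollaredGluing.swap`).

The scalar curvature of a field of inner products on a vector space is treated without
coordinates, as the trace of the Ricci operator (`scalAt`). It is shown to be natural
(`scalAt_pullback`), to agree with the classical formula (`scalarCurvatureCoord_gramMatrix`), and
is computed for products (`scalAt_prodForm`) and warped products (`scalAt_warpForm`). By
naturality, the scalar curvature of a metric on a manifold can be computed in any parametrization
(`scalarCurvature_eq_scalAt`), so that the local product structures of `M` can be used.

The metric on `M` is not glued from local pieces, but is a finite sum `∑ₖ uₖ dvₖ ⊗ dwₖ` with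
smooth functions defined on all of `M` (`CollaredGluing.totalForm`): every metric on a closed
manifold is such a sum (`SmoothMetric.exists_eq_sumForm`), and functions on `M₀`, on the line and
on `W₀` extend to `M` once they are cut off suitably (`CollaredGluing.baseFun`,
`CollaredGluing.neckFun`, `CollaredGluing.pieceFun`). In the interior of `W₀`, where the collar
ends, the squares of the differentials of finitely many auxiliary functions make the form positive
definite.
-/

open scoped Topology
open Set Filter Function

set_option maxSynthPendingDepth 3

noncomputable section

/-! ### Scalar curvature of a metric on an open subset of a vector space -/

section VectorSpace

variable {E : Type*} [NormedAddCommGroup E] [NormedSpace ℝ E]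
variable {E' : Type*} [NormedAddCommGroup E'] [NormedSpace ℝ E']

/-- Continuous bilinear forms on `E`. -/
abbrev BilForm (E : Type*) [NormedAddCommGroup E] [NormedSpace ℝ E] := E →L[ℝ] E →L[ℝ] ℝ

/-- A bilinear form which is symmetric and positive definite. -/
structure IsInnerForm (B : BilForm E) : Prop where
  symm : ∀ X Y, B X Y = B Y X
  pos : ∀ X, X ≠ 0 → 0 < B X X

theorem IsInnerForm.eq_of_forall {B : BilForm E} (hB : IsInnerForm B) {V W : E}
    (h : ∀ Z, B V Z = B W Z) : V = W := by
  by_contra hne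
  have h1 := hB.pos (V - W) (sub_ne_zero.mpr hne)
  rw [map_sub, map_sub, sub_apply, sub_apply, h, h, sub_self, sub_self, sub_self] at h1
  exact lt_irrefl _ h1

theorem IsInnerForm.isInvertible [FiniteDimensional ℝ E] {B : BilForm E} (hB : IsInnerForm B) :
    B.IsInvertible := by
  have hinj : Injective B := fun V W h => hB.eq_of_forall (fun Z => by rw [h])
  have hrank : Module.finrank ℝ E = Module.finrank ℝ (E →L[ℝ] ℝ) := by
    rw [← (LinearMap.toContinuousLinearMap (𝕜 := ℝ) (E := E) (F' := ℝ)).finrank_eq]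
    exact (Subspace.dual_finrank_eq (K := ℝ) (V := E)).symm
  let e : E ≃ₗ[ℝ] (E →L[ℝ] ℝ) :=
    LinearEquiv.ofInjectiveOfFinrankEq (B : E →ₗ[ℝ] (E →L[ℝ] ℝ)) hinj hrank
  refine ⟨e.toContinuousLinearEquiv, ?_⟩
  ext X Y
  rfl

theorem IsInnerForm.inverse_eq_iff [FiniteDimensional ℝ E] {B : BilForm E} (hB : IsInnerForm B)
    {φ : E →L[ℝ] ℝ} {V : E} : B.inverse φ = V ↔ ∀ Z, B V Z = φ Z := by
  constructor
  · rintro rfl Z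
    rw [hB.isInvertible.self_apply_inverse]
  · intro h
    refine hB.eq_of_forall fun Z => ?_
    rw [hB.isInvertible.self_apply_inverse, h]

theorem IsInnerForm.apply_inverse [FiniteDimensional ℝ E] {B : BilForm E} (hB : IsInnerForm B)
    (φ : E →L[ℝ] ℝ) (Z : E) : B (B.inverse φ) Z = φ Z :=
  hB.inverse_eq_iff.mp rfl Z

/-- The Christoffel symbols of the first kind of a field `G` of bilinear forms:
`2 ⟨Γ(X, Y), Z⟩ = (∂_X G)(Y, Z) + (∂_Y G)(X, Z) - (∂_Z G)(X, Y)`. -/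
def koszul (G : E → BilForm E) (u : E) : E →L[ℝ] E →L[ℝ] E →L[ℝ] ℝ :=
  (1 / 2 : ℝ) • (fderiv ℝ G u + (fderiv ℝ G u).flip
    - ((ContinuousLinearMap.flipₗᵢ ℝ E E ℝ).toContinuousLinearEquiv :
        BilForm E →L[ℝ] BilForm E).comp (fderiv ℝ G u).flip)

theorem koszul_apply (G : E → BilForm E) (u X Y Z : E) :
    koszul G u X Y Z = 1 / 2 * (fderiv ℝ G u X Y Z + fderiv ℝ G u Y X Z - fderiv ℝ G u Z X Y) := by
  simp [koszul]

/-- The Christoffel symbols of a field `G` of bilinear forms, as a field of bilinear maps: the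
coordinate expression of the Levi-Civita connection. -/
def connection (G : E → BilForm E) (u : E) : E →L[ℝ] E →L[ℝ] E :=
  (ContinuousLinearMap.compL ℝ E (E →L[ℝ] ℝ) E (G u).inverse).comp (koszul G u)

theorem connection_apply (G : E → BilForm E) (u X Y : E) :
    connection G u X Y = (G u).inverse (koszul G u X Y) := rfl

theorem connection_eq_iff [FiniteDimensional ℝ E] {G : E → BilForm E} {u : E}
    (hG : IsInnerForm (G u)) {X Y V : E} :
    connection G u X Y = V ↔ ∀ Z, G u V Z = koszul G u X Y Z := by
  rw [connection_apply, hG.inverse_eq_iff]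

theorem apply_connection [FiniteDimensional ℝ E] {G : E → BilForm E} {u : E}
    (hG : IsInnerForm (G u)) (X Y Z : E) :
    G u (connection G u X Y) Z = koszul G u X Y Z :=
  (connection_eq_iff hG).mp rfl Z

/-- The curvature endomorphism `X ↦ R(X, Y) Z` of a connection with Christoffel symbols `Γ`. -/
def curvEnd (Γ : E → E →L[ℝ] E →L[ℝ] E) (u Y Z : E) : E →L[ℝ] E :=
  ((fderiv ℝ Γ u).flip Y).flip Z - (fderiv ℝ Γ u Y).flip Z
    + (Γ u).flip (Γ u Y Z) - (Γ u Y).comp ((Γ u).flip Z)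

theorem curvEnd_apply (Γ : E → E →L[ℝ] E →L[ℝ] E) (u X Y Z : E) :
    curvEnd Γ u Y Z X = fderiv ℝ Γ u X Y Z - fderiv ℝ Γ u Y X Z
      + Γ u X (Γ u Y Z) - Γ u Y (Γ u X Z) := rfl

/-- The Ricci form `Ric(Y, Z) = tr (X ↦ R(X, Y) Z)` of a connection. -/
def ricciForm (Γ : E → E →L[ℝ] E →L[ℝ] E) (u : E) : E →ₗ[ℝ] E →ₗ[ℝ] ℝ :=
  LinearMap.mk₂ ℝ (fun Y Z => LinearMap.trace ℝ E (curvEnd Γ u Y Z : E →ₗ[ℝ] E))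
    (fun Y Y' Z => by
      rw [← map_add]; congr 1; ext X
      simp only [ContinuousLinearMap.coe_coe, LinearMap.add_apply, curvEnd_apply, map_add,
        add_apply]
      abel)
    (fun c Y Z => by
      rw [← map_smul]; congr 1; ext X
      simp only [ContinuousLinearMap.coe_coe, LinearMap.smul_apply, curvEnd_apply, map_smul,
        smul_apply, smul_sub, smul_add])
    (fun Y Z Z' => by
      rw [← map_add]; congr 1; ext X
      simp only [ContinuousLinearMap.coe_coe, LinearMap.add_apply, curvEnd_apply, map_add]
      abel)
    (fun c Y Z => by
      rw [← map_smul]; congr 1; ext X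
      simp only [ContinuousLinearMap.coe_coe, LinearMap.smul_apply, curvEnd_apply, map_smul,
        smul_sub, smul_add])

theorem ricciForm_apply (Γ : E → E →L[ℝ] E →L[ℝ] E) (u Y Z : E) :
    ricciForm Γ u Y Z = LinearMap.trace ℝ E (curvEnd Γ u Y Z : E →ₗ[ℝ] E) := rfl

/-- The Ricci operator: the Ricci form with one index raised. -/
def ricciOp [FiniteDimensional ℝ E] (G : E → BilForm E) (u : E) : E →ₗ[ℝ] E :=
  ((G u).inverse : (E →L[ℝ] ℝ) →ₗ[ℝ] E) ∘ₗ
    (LinearMap.toContinuousLinearMap (𝕜 := ℝ) (E := E) (F' := ℝ)).toLinearMap ∘ₗ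
      ricciForm (connection G) u

theorem ricciOp_eq_iff [FiniteDimensional ℝ E] {G : E → BilForm E} {u : E}
    (hG : IsInnerForm (G u)) {Y V : E} :
    ricciOp G u Y = V ↔ ∀ Z, G u V Z = ricciForm (connection G) u Y Z := by
  simp only [ricciOp, LinearMap.comp_apply, ContinuousLinearMap.coe_coe]
  rw [hG.inverse_eq_iff]
  rfl

theorem apply_ricciOp [FiniteDimensional ℝ E] {G : E → BilForm E} {u : E}
    (hG : IsInnerForm (G u)) (Y Z : E) :
    G u (ricciOp G u Y) Z = ricciForm (connection G) u Y Z :=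
  (ricciOp_eq_iff hG).mp rfl Z

/-- The scalar curvature of a field `G` of inner products, at the point `u`: the trace of the Ricci
operator. No basis is involved, so that changes of coordinates and product decompositions of `E`
only require the corresponding properties of the trace. -/
def scalAt [FiniteDimensional ℝ E] (G : E → BilForm E) (u : E) : ℝ :=
  LinearMap.trace ℝ E (ricciOp G u)

/-! #### Dependence on the germ, and smoothness -/

theorem connection_congr {G G' : E → BilForm E} {u : E} (h : G =ᶠ[𝓝 u] G') :
    connection G =ᶠ[𝓝 u] connection G' := by
  filter_upwards [h.eventuallyEq_nhds] with v hv
  simp only [connection, koszul, hv.fderiv_eq, hv.eq_of_nhds]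

theorem ricciForm_congr {Γ Γ' : E → E →L[ℝ] E →L[ℝ] E} {u : E} (h : Γ =ᶠ[𝓝 u] Γ') :
    ricciForm Γ u = ricciForm Γ' u := by
  ext Y Z
  simp only [ricciForm_apply, curvEnd, h.fderiv_eq, h.eq_of_nhds]

theorem scalAt_congr [FiniteDimensional ℝ E] {G G' : E → BilForm E} {u : E} (h : G =ᶠ[𝓝 u] G') :
    scalAt G u = scalAt G' u := by
  simp only [scalAt, ricciOp, ricciForm_congr (connection_congr h), h.eq_of_nhds]

theorem ContDiffAt.koszul {G : E → BilForm E} {u : E} (hG : ContDiffAt ℝ ∞ G u) :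
    ContDiffAt ℝ ∞ (_root_.koszul G) u := by
  have h1 : ContDiffAt ℝ ∞ (fderiv ℝ G) u := hG.fderiv_right (by simp)
  have h2 : ContDiffAt ℝ ∞ (fun v => (fderiv ℝ G v).flip) u :=
    (ContinuousLinearMap.flipₗᵢ ℝ E E (E →L[ℝ] ℝ)).toContinuousLinearEquiv.contDiff.contDiffAt.comp
      u h1
  have h3 : ContDiffAt ℝ ∞ (fun v => ((ContinuousLinearMap.flipₗᵢ ℝ E E ℝ).toContinuousLinearEquiv :
        BilForm E →L[ℝ] BilForm E).comp (fderiv ℝ G v).flip) u := contDiffAt_const.clm_comp h2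
  exact contDiffAt_const.smul (f := fun _ => (1 / 2 : ℝ)) ((h1.add h2).sub h3)

theorem ContDiffAt.connection [FiniteDimensional ℝ E] {G : E → BilForm E} {u : E}
    (hG : ContDiffAt ℝ ∞ G u) (hu : IsInnerForm (G u)) :
    ContDiffAt ℝ ∞ (_root_.connection G) u := by
  have : CompleteSpace E := FiniteDimensional.complete ℝ E
  obtain ⟨e, he⟩ := hu.isInvertible
  have h1 : ContDiffAt ℝ ∞ (fun v => (G v).inverse) u := by
    have := contDiffAt_map_inverse (n := ∞) e
    rw [he] at this
    exact this.comp u hG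
  exact ((ContinuousLinearMap.compL ℝ E (E →L[ℝ] ℝ) E).contDiff.contDiffAt.comp u h1).clm_comp
    hG.koszul

/-- Positive definiteness is an open condition, by compactness of the unit sphere. -/
theorem isInnerForm_eventually [FiniteDimensional ℝ E] {G : E → BilForm E} {u : E}
    (hG : ContinuousAt G u) (hs : ∀ᶠ v in 𝓝 u, ∀ X Y, G v X Y = G v Y X)
    (hu : IsInnerForm (G u)) : ∀ᶠ v in 𝓝 u, IsInnerForm (G v) := by
  have hK : IsCompact (Metric.sphere (0 : E) 1) := isCompact_sphere 0 1
  have h1 : ∀ᶠ v in 𝓝 u, ∀ X ∈ Metric.sphere (0 : E) 1, 0 < G v X X := by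
    refine hK.eventually_forall_of_forall_eventually fun X hX => ?_
    have hX0 : X ≠ 0 := by
      rintro rfl; simp at hX
    have h2 : ContinuousAt (fun p : E × E => G p.1 p.2 p.2) (u, X) := by
      have h3 : ContinuousAt (fun p : E × E => G p.1) (u, X) :=
        ContinuousAt.comp (f := Prod.fst) hG continuousAt_fst
      exact (h3.clm_apply continuousAt_snd).clm_apply continuousAt_snd
    exact h2.eventually (lt_mem_nhds (hu.pos X hX0))
  filter_upwards [h1, hs] with v hv hsv
  refine ⟨hsv, fun X hX => ?_⟩
  have h4 := hv (‖X‖⁻¹ • X) (by simp [norm_smul, hX])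
  simp only [map_smul, smul_apply, smul_eq_mul] at h4
  have h5 : 0 < ‖X‖⁻¹ := inv_pos.mpr (norm_pos_iff.mpr hX)
  exact pos_of_mul_pos_right (pos_of_mul_pos_right h4 h5.le) h5.le

theorem continuousAt_scalAt [FiniteDimensional ℝ E] {G : E → BilForm E} {u : E}
    (hG : ContDiffAt ℝ ∞ G u) (hu : IsInnerForm (G u)) : ContinuousAt (scalAt G) u := by
  have : CompleteSpace E := FiniteDimensional.complete ℝ E
  have hΓ := hG.connection hu
  have hΓc := hΓ.continuousAt
  have hD : ContinuousAt (fderiv ℝ (connection G)) u :=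
    (hΓ.fderiv_right (m := ∞) (by simp)).continuousAt
  obtain ⟨e, he⟩ := hu.isInvertible
  have hinv : ContinuousAt (fun v => (G v).inverse) u := by
    have := contDiffAt_map_inverse (n := ∞) e
    rw [he] at this
    exact (this.comp u hG).continuousAt
  let b := Module.finBasis ℝ E
  have hpair : ∀ {φ : E → E} (i : _), ContinuousAt φ u →
      ContinuousAt (fun v => b.coord i (φ v)) u :=
    fun i h => (LinearMap.continuous_of_finiteDimensional (b.coord i)).continuousAt.comp h
  have hric : ∀ Y Z, ContinuousAt (fun v => ricciForm (connection G) v Y Z) u := by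
    intro Y Z
    simp only [ricciForm_apply, LinearMap.trace_eq_matrix_trace ℝ b, Matrix.trace, Matrix.diag,
      LinearMap.toMatrix_apply, ContinuousLinearMap.coe_coe, curvEnd_apply]
    refine tendsto_finsetSum _ fun i _ => ?_
    refine hpair i ?_
    have c1 : ∀ X Y Z : E, ContinuousAt (fun v => fderiv ℝ (connection G) v X Y Z) u := fun X Y Z =>
      ((hD.clm_apply continuousAt_const).clm_apply continuousAt_const).clm_apply continuousAt_const
    have c2 : ∀ (X : E) {φ : E → E}, ContinuousAt φ u →
        ContinuousAt (fun v => connection G v X (φ v)) u := fun X φ hφ =>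
      (hΓc.clm_apply continuousAt_const).clm_apply hφ
    exact (((c1 _ _ _).sub (c1 _ _ _)).add (c2 _ (c2 _ continuousAt_const))).sub
      (c2 _ (c2 _ continuousAt_const))
  unfold scalAt
  simp only [LinearMap.trace_eq_matrix_trace ℝ b, Matrix.trace, Matrix.diag,
      LinearMap.toMatrix_apply]
  refine tendsto_finsetSum _ fun i _ => hpair i ?_
  simp only [ricciOp, LinearMap.comp_apply, ContinuousLinearMap.coe_coe]
  refine hinv.clm_apply ?_
  refine continuousAt_clm_apply.mpr fun Z => ?_
  exact hric (b i) Z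

end VectorSpace

/-! ### Naturality of the scalar curvature -/

section VectorSpace

variable {E : Type*} [NormedAddCommGroup E] [NormedSpace ℝ E]
variable {E' : Type*} [NormedAddCommGroup E'] [NormedSpace ℝ E']

theorem one_le_infty : (1 : ℕ∞ω) ≤ ∞ := mod_cast le_top

theorem two_le_infty : (2 : ℕ∞ω) ≤ ∞ := by
  have : ((2 : ℕ∞) : ℕ∞ω) ≤ ∞ := WithTop.coe_le_coe.mpr le_top
  exact this

theorem ContDiffAt.bilinearComp {V : Type*} [NormedAddCommGroup V] [NormedSpace ℝ V] {n : ℕ∞ω}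
    {B : V → BilForm E} {L M : V → E' →L[ℝ] E} {v : V} (hB : ContDiffAt ℝ n B v)
    (hL : ContDiffAt ℝ n L v) (hM : ContDiffAt ℝ n M v) :
    ContDiffAt ℝ n (fun w => (B w).bilinearComp (L w) (M w)) v := by
  have h1 : ContDiffAt ℝ n (fun w => ((B w).comp (L w)).flip) v :=
    (ContinuousLinearMap.flipₗᵢ ℝ E' E ℝ).toContinuousLinearEquiv.contDiff.contDiffAt.comp v
      (hB.clm_comp hL)
  exact (ContinuousLinearMap.flipₗᵢ ℝ E' E' ℝ).toContinuousLinearEquiv.contDiff.contDiffAt.comp v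
      (h1.clm_comp hM)

theorem IsInnerForm.bilinearComp {B : BilForm E} (hB : IsInnerForm B) {L : E' →L[ℝ] E}
    (hL : Injective L) : IsInnerForm (B.bilinearComp L L) where
  symm _ _ := hB.symm _ _
  pos _ hX := hB.pos _ fun h => hX (hL (h.trans (map_zero L).symm))

theorem fderiv_clm_apply₂ {V F : Type*} [NormedAddCommGroup V] [NormedSpace ℝ V]
    [NormedAddCommGroup F] [NormedSpace ℝ F]
    {B : V → E →L[ℝ] E' →L[ℝ] F} {a : V → E} {b : V → E'} {v : V} (hB : DifferentiableAt ℝ B v)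
    (ha : DifferentiableAt ℝ a v) (hb : DifferentiableAt ℝ b v) (X : V) :
    fderiv ℝ (fun w => B w (a w) (b w)) v X
      = fderiv ℝ B v X (a v) (b v) + B v (fderiv ℝ a v X) (b v) + B v (a v) (fderiv ℝ b v X) := by
  have := ((hB.hasFDerivAt.clm_apply ha.hasFDerivAt).clm_apply hb.hasFDerivAt).fderiv
  rw [this]
  simp
  abel

theorem fderiv_apply_apply {V F : Type*} [NormedAddCommGroup V] [NormedSpace ℝ V]
    [NormedAddCommGroup F] [NormedSpace ℝ F]
    {B : V → E →L[ℝ] E' →L[ℝ] F} {v : V} (hB : DifferentiableAt ℝ B v) (X : V) (a : E) (b : E') :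
    fderiv ℝ B v X a b = fderiv ℝ (fun w => B w a b) v X := by
  rw [fderiv_clm_apply₂ hB (differentiableAt_const a) (differentiableAt_const b)]
  simp

/-- The transformation rule of Christoffel symbols under a change of coordinates `τ`. -/
theorem fderiv_apply_connection [FiniteDimensional ℝ E] [FiniteDimensional ℝ E']
    {G : E → BilForm E} {G' : E' → BilForm E'} {τ : E' → E} {v : E'}
    (hτ : ContDiffAt ℝ 2 τ v) (hinv : (fderiv ℝ τ v).IsInvertible)
    (hG : DifferentiableAt ℝ G (τ v)) (hpos : IsInnerForm (G (τ v)))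
    (hG' : G' =ᶠ[𝓝 v] fun w => (G (τ w)).bilinearComp (fderiv ℝ τ w) (fderiv ℝ τ w)) (X Y : E') :
    fderiv ℝ τ v (connection G' v X Y)
      = connection G (τ v) (fderiv ℝ τ v X) (fderiv ℝ τ v Y) + fderiv ℝ (fderiv ℝ τ) v X Y := by
  have hL : ContDiffAt ℝ 1 (fderiv ℝ τ) v := hτ.fderiv_right (by norm_num)
  have hLd : DifferentiableAt ℝ (fderiv ℝ τ) v := hL.differentiableAt (by simp)
  have hτd : DifferentiableAt ℝ τ v := hτ.differentiableAt (by simp)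
  have hsymm : ∀ X Y, fderiv ℝ (fderiv ℝ τ) v X Y = fderiv ℝ (fderiv ℝ τ) v Y X :=
    (hτ.isSymmSndFDerivAt (by simp)).eq
  have hGτ : DifferentiableAt ℝ (fun w => G (τ w)) v := hG.comp v hτd
  have hpos' : IsInnerForm (G' v) := by
    rw [hG'.eq_of_nhds]; exact hpos.bilinearComp hinv.injective
  have hd : ∀ X Y Z, fderiv ℝ G' v X Y Z =
      fderiv ℝ G (τ v) (fderiv ℝ τ v X) (fderiv ℝ τ v Y) (fderiv ℝ τ v Z)
      + G (τ v) (fderiv ℝ (fderiv ℝ τ) v X Y) (fderiv ℝ τ v Z)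
      + G (τ v) (fderiv ℝ τ v Y) (fderiv ℝ (fderiv ℝ τ) v X Z) := by
    intro X Y Z
    have hdiff : DifferentiableAt ℝ
        (fun w => (G (τ w)).bilinearComp (fderiv ℝ τ w) (fderiv ℝ τ w)) v := by
      have h1 : DifferentiableAt ℝ (fun w => ((G (τ w)).comp (fderiv ℝ τ w)).flip) v :=
        (ContinuousLinearMap.flipₗᵢ ℝ E' E ℝ).toContinuousLinearEquiv.differentiableAt.comp v
          (hGτ.clm_comp hLd)
      exact (ContinuousLinearMap.flipₗᵢ ℝ E' E' ℝ).toContinuousLinearEquiv.differentiableAt.comp v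
        (h1.clm_comp hLd)
    rw [hG'.fderiv_eq, fderiv_apply_apply hdiff]
    simp only [ContinuousLinearMap.bilinearComp_apply]
    rw [fderiv_clm_apply₂ hGτ (hLd.clm_apply (differentiableAt_const Y))
      (hLd.clm_apply (differentiableAt_const Z))]
    have h2 : ∀ W, fderiv ℝ (fun w => fderiv ℝ τ w W) v X = fderiv ℝ (fderiv ℝ τ) v X W := by
      intro W
      rw [fderiv_clm_apply hLd (differentiableAt_const W)]
      simp
    have h3 : fderiv ℝ (fun w => G (τ w)) v X = fderiv ℝ G (τ v) (fderiv ℝ τ v X) := by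
      have := (hG.hasFDerivAt.comp v hτd.hasFDerivAt).fderiv
      rw [show (fun w => G (τ w)) = G ∘ τ from rfl, this]
      rfl
    rw [h2, h2, h3]
  obtain ⟨e, he⟩ := hinv
  refine hpos.eq_of_forall fun W => ?_
  obtain ⟨Z, rfl⟩ : ∃ Z, fderiv ℝ τ v Z = W := ⟨e.symm W, by rw [← he]; simp⟩
  have h4 := apply_connection hpos' X Y Z
  have h5 : G' v (connection G' v X Y) Z
      = G (τ v) (fderiv ℝ τ v (connection G' v X Y)) (fderiv ℝ τ v Z) := by
    conv_lhs => rw [hG'.eq_of_nhds]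
    rfl
  rw [← h5, h4, koszul_apply, map_add, add_apply, apply_connection hpos, koszul_apply, hd, hd, hd,
    hsymm Y X, hsymm Z X, hsymm Z Y, hpos.symm (fderiv ℝ τ v Y), hpos.symm (fderiv ℝ τ v X)]
  ring_nf

/-- The curvature is a tensor: it transforms without derivatives under a change of coordinates. -/
theorem fderiv_apply_curvEnd {Γ : E → E →L[ℝ] E →L[ℝ] E}
    {Γ' : E' → E' →L[ℝ] E' →L[ℝ] E'} {τ : E' → E} {u : E'} (hτ : ContDiffAt ℝ ∞ τ u)
    (hΓ : DifferentiableAt ℝ Γ (τ u)) (hΓ' : DifferentiableAt ℝ Γ' u)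
    (h : ∀ᶠ v in 𝓝 u, ∀ X Y, fderiv ℝ τ v (Γ' v X Y)
      = Γ (τ v) (fderiv ℝ τ v X) (fderiv ℝ τ v Y) + fderiv ℝ (fderiv ℝ τ) v X Y) (X Y Z : E') :
    fderiv ℝ τ u (curvEnd Γ' u Y Z X)
      = curvEnd Γ (τ u) (fderiv ℝ τ u Y) (fderiv ℝ τ u Z) (fderiv ℝ τ u X) := by
  have hL : ContDiffAt ℝ ∞ (fderiv ℝ τ) u := hτ.fderiv_right (by simp)
  have hLd : DifferentiableAt ℝ (fderiv ℝ τ) u := hL.differentiableAt (by simp)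
  have hL2 : ContDiffAt ℝ ∞ (fderiv ℝ (fderiv ℝ τ)) u := hL.fderiv_right (by simp)
  have hLd2 : DifferentiableAt ℝ (fderiv ℝ (fderiv ℝ τ)) u := hL2.differentiableAt (by simp)
  have hτd : DifferentiableAt ℝ τ u := hτ.differentiableAt (by simp)
  have hsymm : ∀ X Y, fderiv ℝ (fderiv ℝ τ) u X Y = fderiv ℝ (fderiv ℝ τ) u Y X :=
    (hτ.isSymmSndFDerivAt (by simp [two_le_infty])).eq
  have hsymm3 : ∀ X Y, fderiv ℝ (fderiv ℝ (fderiv ℝ τ)) u X Y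
      = fderiv ℝ (fderiv ℝ (fderiv ℝ τ)) u Y X := (hL.isSymmSndFDerivAt (by simp [two_le_infty])).eq
  have hu := h.self_of_nhds
  have hΓτ : DifferentiableAt ℝ (fun w => Γ (τ w)) u := hΓ.comp u hτd
  -- the derivative in the direction `W` of the transformation rule of `Γ(X, Y)`
  have key : ∀ W X Y, fderiv ℝ (fderiv ℝ τ) u W (Γ' u X Y) + fderiv ℝ τ u (fderiv ℝ Γ' u W X Y)
      = fderiv ℝ Γ (τ u) (fderiv ℝ τ u W) (fderiv ℝ τ u X) (fderiv ℝ τ u Y)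
        + Γ (τ u) (fderiv ℝ (fderiv ℝ τ) u W X) (fderiv ℝ τ u Y)
        + Γ (τ u) (fderiv ℝ τ u X) (fderiv ℝ (fderiv ℝ τ) u W Y)
        + fderiv ℝ (fderiv ℝ (fderiv ℝ τ)) u W X Y := by
    intro W X Y
    have h1 : (fun v => fderiv ℝ τ v (Γ' v X Y)) =ᶠ[𝓝 u] fun v =>
        Γ (τ v) (fderiv ℝ τ v X) (fderiv ℝ τ v Y) + fderiv ℝ (fderiv ℝ τ) v X Y :=
      h.mono fun v hv => hv X Y
    have h2 := DFunLike.congr_fun (h1.fderiv_eq (𝕜 := ℝ)) W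
    have hXY : DifferentiableAt ℝ (fun v => Γ' v X Y) u :=
      (hΓ'.clm_apply (differentiableAt_const X)).clm_apply (differentiableAt_const Y)
    have hap : ∀ X : E', DifferentiableAt ℝ (fun v : E' => fderiv ℝ τ v X) u := fun X =>
      hLd.clm_apply (differentiableAt_const X)
    have h3 : ∀ V : E', fderiv ℝ (fun w : E' => fderiv ℝ τ w V) u W
        = fderiv ℝ (fderiv ℝ τ) u W V := by
      intro V
      rw [fderiv_clm_apply hLd (differentiableAt_const V)]
      simp
    have h4 : fderiv ℝ (fun w => Γ (τ w)) u W = fderiv ℝ Γ (τ u) (fderiv ℝ τ u W) := by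
      have := (hΓ.hasFDerivAt.comp u hτd.hasFDerivAt).fderiv
      rw [show (fun w => Γ (τ w)) = Γ ∘ τ from rfl, this]
      rfl
    rw [fderiv_clm_apply hLd hXY, fderiv_fun_add
      ((hΓτ.clm_apply (hap X)).clm_apply (hap Y))
      ((hLd2.clm_apply (differentiableAt_const X)).clm_apply (differentiableAt_const Y)),
      add_apply, add_apply, fderiv_clm_apply₂ hΓτ (hap X) (hap Y), ← fderiv_apply_apply hLd2,
      h3, h3, h4] at h2
    simp only [ContinuousLinearMap.comp_apply, ContinuousLinearMap.flip_apply] at h2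
    rw [← fderiv_apply_apply hΓ'] at h2
    rw [← h2]
    abel
  -- after adding `Γ(W, Γ(X, Y))`, the terms with derivatives of `fderiv ℝ τ` are symmetric in `W`
  -- and `X`, so that they cancel in the curvature
  have key2 : ∀ W X Y, fderiv ℝ τ u (fderiv ℝ Γ' u W X Y + Γ' u W (Γ' u X Y))
      = fderiv ℝ Γ (τ u) (fderiv ℝ τ u W) (fderiv ℝ τ u X) (fderiv ℝ τ u Y)
        + Γ (τ u) (fderiv ℝ τ u W) (Γ (τ u) (fderiv ℝ τ u X) (fderiv ℝ τ u Y))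
        + (Γ (τ u) (fderiv ℝ τ u W) (fderiv ℝ (fderiv ℝ τ) u X Y)
          + Γ (τ u) (fderiv ℝ τ u X) (fderiv ℝ (fderiv ℝ τ) u W Y)
          + Γ (τ u) (fderiv ℝ (fderiv ℝ τ) u W X) (fderiv ℝ τ u Y)
          + fderiv ℝ (fderiv ℝ (fderiv ℝ τ)) u W X Y) := by
    intro W X Y
    rw [map_add, hu W, hu X, map_add]
    have := key W X Y
    rw [← eq_sub_iff_add_eq'] at this
    rw [this]
    abel
  have e1 := key2 X Y Z
  have e2 := key2 Y X Z
  rw [hsymm Y X, hsymm3 Y X] at e2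
  have e3 : curvEnd Γ' u Y Z X = (fderiv ℝ Γ' u X Y Z + Γ' u X (Γ' u Y Z))
      - (fderiv ℝ Γ' u Y X Z + Γ' u Y (Γ' u X Z)) := by
    rw [curvEnd_apply]; abel
  rw [e3, map_sub, e1, e2, curvEnd_apply]
  abel

/-- Naturality of the scalar curvature under a change of coordinates. -/
theorem scalAt_pullback [FiniteDimensional ℝ E] [FiniteDimensional ℝ E']
    {G : E → BilForm E} {G' : E' → BilForm E'} {τ : E' → E} {u : E'}
    (hτ : ContDiffAt ℝ ∞ τ u) (hinv : (fderiv ℝ τ u).IsInvertible)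
    (hG : ContDiffAt ℝ ∞ G (τ u)) (hs : ∀ᶠ w in 𝓝 (τ u), ∀ X Y, G w X Y = G w Y X)
    (hpos : IsInnerForm (G (τ u)))
    (hG' : G' =ᶠ[𝓝 u] fun w => (G (τ w)).bilinearComp (fderiv ℝ τ w) (fderiv ℝ τ w)) :
    scalAt G' u = scalAt G (τ u) := by
  have : CompleteSpace E := FiniteDimensional.complete ℝ E
  have : CompleteSpace E' := FiniteDimensional.complete ℝ E'
  have hL : ContDiffAt ℝ ∞ (fderiv ℝ τ) u := hτ.fderiv_right (by simp)
  have hpos' : IsInnerForm (G' u) := by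
    rw [hG'.eq_of_nhds]; exact hpos.bilinearComp hinv.injective
  have hG's : ContDiffAt ℝ ∞ G' u :=
    ((hG.comp u hτ).bilinearComp hL hL).congr_of_eventuallyEq hG'
  have hconn : ∀ᶠ v in 𝓝 u, ∀ X Y, fderiv ℝ τ v (connection G' v X Y)
      = connection G (τ v) (fderiv ℝ τ v X) (fderiv ℝ τ v Y) + fderiv ℝ (fderiv ℝ τ) v X Y := by
    have h1 := hτ.continuousAt.eventually (isInnerForm_eventually hG.continuousAt hs hpos)
    have h2 := hτ.continuousAt.eventually ((hG.of_le (m := 1) (one_le_infty)).eventually (by simp))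
    have h3 : ∀ᶠ v in 𝓝 u, ContDiffAt ℝ 2 τ v := (hτ.of_le two_le_infty).eventually (by simp)
    have h4 : ∀ᶠ v in 𝓝 u, (fderiv ℝ τ v).IsInvertible := by
      obtain ⟨e, he⟩ := hinv
      have := hL.continuousAt.eventually (he ▸ ContinuousLinearEquiv.nhds e)
      exact this
    filter_upwards [h1, h2, h3, h4, hG'.eventuallyEq_nhds] with v a1 a2 a3 a4 a5 X Y
    exact fderiv_apply_connection a3 a4 (a2.differentiableAt (by simp)) a1 a5 X Y
  have hcurv := fderiv_apply_curvEnd hτ ((hG.connection hpos).differentiableAt (by simp))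
    ((hG's.connection hpos').differentiableAt (by simp)) hconn
  obtain ⟨e, he⟩ := hinv
  have hL0 : ∀ X, fderiv ℝ τ u X = e X := fun X => by rw [← he]; rfl
  simp only [hL0] at hcurv
  have htr : ∀ (S' : E' →ₗ[ℝ] E') (S : E →ₗ[ℝ] E), (∀ X, e (S' X) = S (e X)) →
      LinearMap.trace ℝ E' S' = LinearMap.trace ℝ E S := by
    intro S' S h
    rw [← LinearMap.trace_conj' S' e.toLinearEquiv]
    congr 1
    ext X
    rw [LinearEquiv.conj_apply_apply]
    have := h (e.symm X)
    simpa using this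
  have hric : ∀ Y Z, ricciForm (connection G') u Y Z = ricciForm (connection G) (τ u) (e Y) (e Z) :=
    fun Y Z => htr _ _ fun X => hcurv X Y Z
  refine htr _ _ fun Y => ?_
  refine ((ricciOp_eq_iff hpos).mpr fun W => ?_).symm
  have h7 := apply_ricciOp hpos' Y (e.symm W)
  rw [hric] at h7
  have h8 : G' u (ricciOp G' u Y) (e.symm W)
      = G (τ u) (fderiv ℝ τ u (ricciOp G' u Y)) (fderiv ℝ τ u (e.symm W)) := by
    conv_lhs => rw [hG'.eq_of_nhds]
    rfl
  rw [h8, hL0, hL0, e.apply_symm_apply] at h7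
  exact h7

end VectorSpace

/-! ### Scaling, products and warped products -/

section VectorSpace

variable {E : Type*} [NormedAddCommGroup E] [NormedSpace ℝ E]
variable {F : Type*} [NormedAddCommGroup F] [NormedSpace ℝ F]

theorem IsInnerForm.smul {B : BilForm E} (hB : IsInnerForm B) {c : ℝ} (hc : 0 < c) :
    IsInnerForm (c • B) where
  symm X Y := by simp [hB.symm X Y]
  pos X hX := by simpa using mul_pos hc (hB.pos X hX)

theorem scalAt_smul [FiniteDimensional ℝ E] {G : E → BilForm E} {u : E} {c : ℝ} (hc : 0 < c)
    (hG : ∀ᶠ v in 𝓝 u, IsInnerForm (G v)) :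
    scalAt (fun v => c • G v) u = c⁻¹ * scalAt G u := by
  have hΓ : connection (fun v => c • G v) =ᶠ[𝓝 u] connection G := by
    filter_upwards [hG] with v hv
    ext X Y
    refine (connection_eq_iff (hv.smul hc)).mpr fun Z => ?_
    rw [smul_apply, smul_apply, apply_connection hv, koszul_apply, koszul_apply,
      show (fun v => c • G v) = c • G from rfl, fderiv_const_smul_field]
    simp
    ring
  have hu := hG.self_of_nhds
  rw [scalAt, scalAt, ← smul_eq_mul, ← map_smul]
  congr 1
  ext Y
  refine (ricciOp_eq_iff (hu.smul hc)).mpr fun Z => ?_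
  rw [ricciForm_congr hΓ, ← apply_ricciOp hu]
  simp [hc.ne']

theorem LinearMap.trace_prod_eq [FiniteDimensional ℝ E] [FiniteDimensional ℝ F]
    (f : E × F →ₗ[ℝ] E × F) :
    LinearMap.trace ℝ (E × F) f
      = LinearMap.trace ℝ E (LinearMap.fst ℝ E F ∘ₗ f ∘ₗ LinearMap.inl ℝ E F)
        + LinearMap.trace ℝ F (LinearMap.snd ℝ E F ∘ₗ f ∘ₗ LinearMap.inr ℝ E F) := by
  have h : f = (f ∘ₗ LinearMap.inl ℝ E F) ∘ₗ LinearMap.fst ℝ E F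
      + (f ∘ₗ LinearMap.inr ℝ E F) ∘ₗ LinearMap.snd ℝ E F := by
    apply LinearMap.ext
    rintro ⟨a, b⟩
    simp [← map_add]
  conv_lhs => rw [h]
  rw [map_add, LinearMap.trace_comp_comm' (LinearMap.fst ℝ E F),
    LinearMap.trace_comp_comm' (LinearMap.snd ℝ E F)]

theorem fderiv_comp_fst {V : Type*} [NormedAddCommGroup V] [NormedSpace ℝ V] {f : E → V}
    {p : E × F} (hf : DifferentiableAt ℝ f p.1) (X : E × F) :
    fderiv ℝ (fun q : E × F => f q.1) p X = fderiv ℝ f p.1 X.1 := by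
  rw [show (fun q : E × F => f q.1) = f ∘ Prod.fst from rfl,
    fderiv_comp p hf differentiableAt_fst, fderiv_fst]
  rfl

theorem fderiv_comp_snd {V : Type*} [NormedAddCommGroup V] [NormedSpace ℝ V] {f : F → V}
    {p : E × F} (hf : DifferentiableAt ℝ f p.2) (X : E × F) :
    fderiv ℝ (fun q : E × F => f q.2) p X = fderiv ℝ f p.2 X.2 := by
  rw [show (fun q : E × F => f q.2) = f ∘ Prod.snd from rfl,
    fderiv_comp p hf differentiableAt_snd, fderiv_snd]
  rfl

/-- The orthogonal sum of two bilinear forms. -/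
def prodForm (B : BilForm E) (C : BilForm F) : BilForm (E × F) :=
  B.bilinearComp (ContinuousLinearMap.fst ℝ E F) (ContinuousLinearMap.fst ℝ E F)
    + C.bilinearComp (ContinuousLinearMap.snd ℝ E F) (ContinuousLinearMap.snd ℝ E F)

@[simp] theorem prodForm_apply (B : BilForm E) (C : BilForm F) (X Y : E × F) :
    prodForm B C X Y = B X.1 Y.1 + C X.2 Y.2 := rfl

theorem IsInnerForm.prod {B : BilForm E} {C : BilForm F} (hB : IsInnerForm B) (hC : IsInnerForm C) :
    IsInnerForm (prodForm B C) where
  symm X Y := by rw [prodForm_apply, prodForm_apply, hB.symm, hC.symm]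
  pos X hX := by
    rw [prodForm_apply]
    by_cases h1 : X.1 = 0
    · have h2 : X.2 ≠ 0 := fun h2 => hX (Prod.ext h1 h2)
      simpa [h1] using hC.pos _ h2
    · by_cases h2 : X.2 = 0
      · simpa [h2] using hB.pos _ h1
      · exact add_pos (hB.pos _ h1) (hC.pos _ h2)

theorem ContDiffAt.prodForm {H : E → BilForm E} {g : F → BilForm F} {p : E × F}
    (hH : ContDiffAt ℝ ∞ H p.1) (hg : ContDiffAt ℝ ∞ g p.2) :
    ContDiffAt ℝ ∞ (fun q : E × F => _root_.prodForm (H q.1) (g q.2)) p :=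
  ((hH.comp (f := Prod.fst) p contDiffAt_fst).bilinearComp contDiffAt_const contDiffAt_const).add
    ((hg.comp (f := Prod.snd) p contDiffAt_snd).bilinearComp contDiffAt_const contDiffAt_const)

/-- The scalar curvature of a Riemannian product is the sum of the scalar curvatures. -/
theorem scalAt_prodForm [FiniteDimensional ℝ E] [FiniteDimensional ℝ F]
    {H : E → BilForm E} {g : F → BilForm F} {p : E × F}
    (hH : ContDiffAt ℝ ∞ H p.1) (hHs : ∀ᶠ v in 𝓝 p.1, IsInnerForm (H v))
    (hg : ContDiffAt ℝ ∞ g p.2) (hgs : ∀ᶠ v in 𝓝 p.2, IsInnerForm (g v)) :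
    scalAt (fun q : E × F => prodForm (H q.1) (g q.2)) p = scalAt H p.1 + scalAt g p.2 := by
  have hHp := hHs.self_of_nhds
  have hgp := hgs.self_of_nhds
  have hGp := hHp.prod hgp
  have hG : ContDiffAt ℝ ∞ (fun q : E × F => prodForm (H q.1) (g q.2)) p := hH.prodForm hg
  set G : E × F → BilForm (E × F) := fun q => prodForm (H q.1) (g q.2) with hGdef
  have hΓ : ∀ᶠ q in 𝓝 p, ∀ X Y, connection G q X Y
      = (connection H q.1 X.1 Y.1, connection g q.2 X.2 Y.2) := by
    filter_upwards [continuousAt_fst.eventually hHs, continuousAt_snd.eventually hgs,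
      continuousAt_fst.eventually ((hH.of_le one_le_infty).eventually (by simp)),
      continuousAt_snd.eventually ((hg.of_le one_le_infty).eventually (by simp)),
      (hG.of_le one_le_infty).eventually (by simp)] with q a1 a2 a3 a4 a5 X Y
    refine (connection_eq_iff (a1.prod a2)).mpr fun Z => ?_
    have a3' := a3.differentiableAt one_ne_zero
    have a4' := a4.differentiableAt one_ne_zero
    have hd : ∀ X Y Z, fderiv ℝ G q X Y Z
        = fderiv ℝ H q.1 X.1 Y.1 Z.1 + fderiv ℝ g q.2 X.2 Y.2 Z.2 := by
      intro X Y Z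
      rw [fderiv_apply_apply (a5.differentiableAt one_ne_zero)]
      simp only [hGdef, prodForm_apply]
      have d1 : DifferentiableAt ℝ (fun v => H v Y.1 Z.1) q.1 :=
        (a3'.clm_apply (differentiableAt_const _)).clm_apply (differentiableAt_const _)
      have d2 : DifferentiableAt ℝ (fun v => g v Y.2 Z.2) q.2 :=
        (a4'.clm_apply (differentiableAt_const _)).clm_apply (differentiableAt_const _)
      have d1' : DifferentiableAt ℝ (fun q : E × F => H q.1 Y.1 Z.1) q :=
        d1.comp (f := Prod.fst) q differentiableAt_fst
      have d2' : DifferentiableAt ℝ (fun q : E × F => g q.2 Y.2 Z.2) q :=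
        d2.comp (f := Prod.snd) q differentiableAt_snd
      rw [fderiv_fun_add d1' d2', add_apply, fderiv_comp_fst d1, fderiv_comp_snd d2,
        ← fderiv_apply_apply a3', ← fderiv_apply_apply a4']
    rw [koszul_apply, hd, hd, hd]
    simp only [hGdef, prodForm_apply, apply_connection a1, apply_connection a2, koszul_apply]
    ring
  have hΓH := hH.connection hHp
  have hΓg := hg.connection hgp
  have hΓH' : DifferentiableAt ℝ (connection H) p.1 := hΓH.differentiableAt (by simp)
  have hΓg' : DifferentiableAt ℝ (connection g) p.2 := hΓg.differentiableAt (by simp)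
  have hΓG' : DifferentiableAt ℝ (connection G) p := (hG.connection hGp).differentiableAt (by simp)
  have hd : ∀ X Y Z, fderiv ℝ (connection G) p X Y Z = (fderiv ℝ (connection H) p.1 X.1 Y.1 Z.1,
      fderiv ℝ (connection g) p.2 X.2 Y.2 Z.2) := by
    intro X Y Z
    rw [fderiv_apply_apply hΓG']
    have h1 : (fun q => connection G q Y Z) =ᶠ[𝓝 p] fun q =>
      (connection H q.1 Y.1 Z.1, connection g q.2 Y.2 Z.2) := hΓ.mono fun q hq => hq Y Z
    have d1 : DifferentiableAt ℝ (fun v => connection H v Y.1 Z.1) p.1 :=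
      (hΓH'.clm_apply (differentiableAt_const _)).clm_apply (differentiableAt_const _)
    have d2 : DifferentiableAt ℝ (fun v => connection g v Y.2 Z.2) p.2 :=
      (hΓg'.clm_apply (differentiableAt_const _)).clm_apply (differentiableAt_const _)
    have d1' : DifferentiableAt ℝ (fun q : E × F => connection H q.1 Y.1 Z.1) p :=
      d1.comp (f := Prod.fst) p differentiableAt_fst
    have d2' : DifferentiableAt ℝ (fun q : E × F => connection g q.2 Y.2 Z.2) p :=
      d2.comp (f := Prod.snd) p differentiableAt_snd
    rw [h1.fderiv_eq, d1'.fderiv_prodMk d2', ContinuousLinearMap.prod_apply, fderiv_comp_fst d1,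
      fderiv_comp_snd d2, ← fderiv_apply_apply hΓH', ← fderiv_apply_apply hΓg']
  have hp := hΓ.self_of_nhds
  have hcurv : ∀ X Y Z, curvEnd (connection G) p Y Z X
      = (curvEnd (connection H) p.1 Y.1 Z.1 X.1, curvEnd (connection g) p.2 Y.2 Z.2 X.2) := by
    intro X Y Z
    simp only [curvEnd_apply, hd, hp]
    rfl
  have hric : ∀ Y Z, ricciForm (connection G) p Y Z
      = ricciForm (connection H) p.1 Y.1 Z.1 + ricciForm (connection g) p.2 Y.2 Z.2 := by
    intro Y Z
    rw [ricciForm_apply, LinearMap.trace_prod_eq]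
    congr 1
    · rw [ricciForm_apply]; congr 1; ext X; simp [hcurv]
    · rw [ricciForm_apply]; congr 1; ext X; simp [hcurv]
  have hop : ∀ Y, ricciOp G p Y = (ricciOp H p.1 Y.1, ricciOp g p.2 Y.2) := by
    intro Y
    refine (ricciOp_eq_iff hGp).mpr fun Z => ?_
    simp only [hGdef, prodForm_apply, apply_ricciOp hHp, apply_ricciOp hgp]
    rw [← hGdef, hric]
  rw [scalAt, LinearMap.trace_prod_eq]
  congr 1
  · rw [scalAt]; congr 1; ext X; simp [hop]
  · rw [scalAt]; congr 1; ext X; simp [hop]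

/-- The form `a B + c dt²` on `F × ℝ`. -/
def warpForm (B : BilForm F) (a c : ℝ) : BilForm (F × ℝ) :=
  a • B.bilinearComp (ContinuousLinearMap.fst ℝ F ℝ) (ContinuousLinearMap.fst ℝ F ℝ)
    + c • (ContinuousLinearMap.mul ℝ ℝ).bilinearComp (ContinuousLinearMap.snd ℝ F ℝ)
        (ContinuousLinearMap.snd ℝ F ℝ)

@[simp] theorem warpForm_apply (B : BilForm F) (a c : ℝ) (X Y : F × ℝ) :
    warpForm B a c X Y = a * B X.1 Y.1 + c * (X.2 * Y.2) := rfl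

theorem IsInnerForm.warp {B : BilForm F} (hB : IsInnerForm B) {a c : ℝ} (ha : 0 < a) (hc : 0 < c) :
    IsInnerForm (warpForm B a c) where
  symm X Y := by rw [warpForm_apply, warpForm_apply, hB.symm, mul_comm X.2]
  pos X hX := by
    rw [warpForm_apply]
    by_cases h1 : X.1 = 0
    · have h2 : X.2 ≠ 0 := fun h2 => hX (Prod.ext h1 h2)
      have := mul_pos hc (mul_self_pos.mpr h2)
      simpa [h1] using this
    · have := mul_pos ha (hB.pos _ h1)
      have h2 := mul_nonneg hc.le (mul_self_nonneg X.2)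
      linarith

theorem ContDiffAt.warpForm {g : F → BilForm F} {A c : ℝ → ℝ} {p : F × ℝ}
    (hg : ContDiffAt ℝ ∞ g p.1) (hA : ContDiffAt ℝ ∞ A p.2) (hc : ContDiffAt ℝ ∞ c p.2) :
    ContDiffAt ℝ ∞ (fun q : F × ℝ => _root_.warpForm (g q.1) (A q.2) (c q.2)) p :=
  ((hA.comp (f := Prod.snd) p contDiffAt_snd).smul
      ((hg.comp (f := Prod.fst) p contDiffAt_fst).bilinearComp contDiffAt_const
        contDiffAt_const)).add
    ((hc.comp (f := Prod.snd) p contDiffAt_snd).smul contDiffAt_const)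

/-- The contribution of the derivatives of `A` and `c` to the scalar curvature of the warped
product `A(t) g + c(t) dt²`, where `g` is a metric in dimension `n`. -/
def warpTerm (n : ℝ) (A c : ℝ → ℝ) (t : ℝ) : ℝ :=
  n * ((A t)⁻¹ * (-(n - 2) * (deriv A t / (2 * A t)) * (deriv A t / (2 * c t))
      - deriv (fun s => deriv A s / (2 * c s)) t
      - deriv c t / (2 * c t) * (deriv A t / (2 * c t)))
    + (c t)⁻¹ * (-deriv (fun s => deriv A s / (2 * A s)) t
      + deriv A t / (2 * A t) * (deriv c t / (2 * c t)) - (deriv A t / (2 * A t)) ^ 2))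

theorem warpTerm_eq_zero {n : ℝ} {A c : ℝ → ℝ} {t : ℝ} (hA : ∀ᶠ s in 𝓝 t, deriv A s = 0) :
    warpTerm n A c t = 0 := by
  have h1 : (fun s => deriv A s / (2 * c s)) =ᶠ[𝓝 t] fun _ => 0 := hA.mono fun s hs => by simp [hs]
  have h2 : (fun s => deriv A s / (2 * A s)) =ᶠ[𝓝 t] fun _ => 0 := hA.mono fun s hs => by simp [hs]
  simp [warpTerm, h1.deriv_eq, h2.deriv_eq, hA.self_of_nhds]

/-- If `c` is a constant `N`, then the contribution of the warping scales as `1 / N`. -/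
theorem warpTerm_of_eventually_const {n : ℝ} {A c : ℝ → ℝ} {t N : ℝ}
    (hc : c =ᶠ[𝓝 t] fun _ => N) : warpTerm n A c t = N⁻¹ * warpTerm n A (fun _ => 1) t := by
  have h1 : (fun s => deriv A s / (2 * c s)) =ᶠ[𝓝 t] fun s => N⁻¹ * (deriv A s / (2 * 1)) :=
    hc.mono fun s hs => by
      simp only [hs]
      rw [mul_one, div_eq_mul_inv, mul_inv, div_eq_mul_inv]
      ring
  simp only [warpTerm, h1.deriv_eq, hc.deriv_eq, hc.eq_of_nhds, deriv_const_mul_field]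
  simp only [deriv_const, div_eq_mul_inv, mul_inv]
  ring

theorem ContDiffAt.deriv_infty {f : ℝ → F} {t : ℝ} (hf : ContDiffAt ℝ ∞ f t) :
    ContDiffAt ℝ ∞ (deriv f) t := by
  have h : ContDiffAt ℝ ∞ (fderiv ℝ f) t := hf.fderiv_right (by simp)
  exact (h.clm_apply (contDiffAt_const (c := (1 : ℝ)))).congr_of_eventuallyEq
    (Eventually.of_forall fun s => fderiv_apply_one_eq_deriv.symm)

/-- The scalar curvature of the warped product `A(t) g + c(t) dt²` on `F × ℝ`. -/
theorem scalAt_warpForm [FiniteDimensional ℝ F] {g : F → BilForm F} {A c : ℝ → ℝ} {p : F × ℝ}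
    (hg : ContDiffAt ℝ ∞ g p.1) (hgs : ∀ᶠ v in 𝓝 p.1, IsInnerForm (g v))
    (hA : ContDiffAt ℝ ∞ A p.2) (hA0 : 0 < A p.2) (hc : ContDiffAt ℝ ∞ c p.2) (hc0 : 0 < c p.2) :
    scalAt (fun q : F × ℝ => warpForm (g q.1) (A q.2) (c q.2)) p
      = (A p.2)⁻¹ * scalAt g p.1 + warpTerm (Module.finrank ℝ F) A c p.2 := by
  have hgp := hgs.self_of_nhds
  have hGp := hgp.warp hA0 hc0
  have hG : ContDiffAt ℝ ∞ (fun q : F × ℝ => warpForm (g q.1) (A q.2) (c q.2)) p :=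
    hg.warpForm hA hc
  set G : F × ℝ → BilForm (F × ℝ) := fun q => warpForm (g q.1) (A q.2) (c q.2) with hGdef
  -- the Christoffel symbols are those of `g`, together with `P` for the components of type
  -- `(F, t; F)`, `-Q g` for `(F, F; t)` and `R` for `(t, t; t)`
  set P : ℝ → ℝ := fun s => deriv A s / (2 * A s) with hP
  set Q : ℝ → ℝ := fun s => deriv A s / (2 * c s) with hQ
  set R : ℝ → ℝ := fun s => deriv c s / (2 * c s) with hR
  have hdA : ContDiffAt ℝ ∞ (deriv A) p.2 := hA.deriv_infty
  have hdc : ContDiffAt ℝ ∞ (deriv c) p.2 := hc.deriv_infty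
  have hPd : DifferentiableAt ℝ P p.2 :=
    (hdA.div (contDiffAt_const.mul hA) (by positivity)).differentiableAt (by simp)
  have hQd : DifferentiableAt ℝ Q p.2 :=
    (hdA.div (contDiffAt_const.mul hc) (by positivity)).differentiableAt (by simp)
  have hRd : DifferentiableAt ℝ R p.2 :=
    (hdc.div (contDiffAt_const.mul hc) (by positivity)).differentiableAt (by simp)
  have hΓ : ∀ᶠ q in 𝓝 p, ∀ X Y : F × ℝ, connection G q X Y
      = (connection g q.1 X.1 Y.1 + P q.2 • (X.2 • Y.1 + Y.2 • X.1),
          R q.2 * (X.2 * Y.2) - Q q.2 * g q.1 X.1 Y.1) := by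
    filter_upwards [continuousAt_fst.eventually hgs,
      continuousAt_fst.eventually ((hg.of_le one_le_infty).eventually (by simp)),
      continuousAt_snd.eventually ((hA.of_le one_le_infty).eventually (by simp)),
      continuousAt_snd.eventually ((hc.of_le one_le_infty).eventually (by simp)),
      (hG.of_le one_le_infty).eventually (by simp),
      continuousAt_snd.eventually (hA.continuousAt.eventually (lt_mem_nhds hA0)),
      continuousAt_snd.eventually (hc.continuousAt.eventually (lt_mem_nhds hc0))]
      with q a1 a2 a3 a4 a5 a6 a7 X Y
    refine (connection_eq_iff (a1.warp a6 a7)).mpr fun Z => ?_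
    have a2' := a2.differentiableAt one_ne_zero
    have a3' := a3.differentiableAt one_ne_zero
    have a4' := a4.differentiableAt one_ne_zero
    have hd : ∀ X Y Z, fderiv ℝ G q X Y Z
        = X.2 * deriv A q.2 * g q.1 Y.1 Z.1 + A q.2 * fderiv ℝ g q.1 X.1 Y.1 Z.1
          + X.2 * deriv c q.2 * (Y.2 * Z.2) := by
      intro X Y Z
      rw [fderiv_apply_apply (a5.differentiableAt one_ne_zero)]
      simp only [hGdef, warpForm_apply]
      have d1 : DifferentiableAt ℝ (fun v => g v Y.1 Z.1) q.1 :=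
        (a2'.clm_apply (differentiableAt_const _)).clm_apply (differentiableAt_const _)
      have d1' : DifferentiableAt ℝ (fun q : F × ℝ => g q.1 Y.1 Z.1) q :=
        d1.comp (f := Prod.fst) q differentiableAt_fst
      have d2' : DifferentiableAt ℝ (fun q : F × ℝ => A q.2) q :=
        a3'.comp (f := Prod.snd) q differentiableAt_snd
      have d3' : DifferentiableAt ℝ (fun q : F × ℝ => c q.2) q :=
        a4'.comp (f := Prod.snd) q differentiableAt_snd
      rw [fderiv_fun_add (d2'.fun_mul d1') (d3'.fun_mul (differentiableAt_const _)), add_apply,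
        fderiv_fun_mul d2' d1', fderiv_fun_mul d3' (differentiableAt_const _)]
      simp only [add_apply, smul_apply, fderiv_comp_fst d1, fderiv_comp_snd a3',
        fderiv_comp_snd a4', ← fderiv_apply_apply a2', smul_eq_mul, fderiv_eq_smul_deriv]
      simp
      ring
    rw [koszul_apply, hd, hd, hd]
    simp only [hGdef, warpForm_apply, map_add, map_smul, add_apply, smul_apply, smul_eq_mul,
      apply_connection a1, koszul_apply, hP, hQ, hR]
    field_simp
    ring
  have hΓg := hg.connection hgp
  have hΓg' : DifferentiableAt ℝ (connection g) p.1 := hΓg.differentiableAt (by simp)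
  have hg' : DifferentiableAt ℝ g p.1 := hg.differentiableAt (by simp)
  have hΓG' : DifferentiableAt ℝ (connection G) p := (hG.connection hGp).differentiableAt (by simp)
  have hd : ∀ X Y Z : F × ℝ, fderiv ℝ (connection G) p X Y Z
      = (fderiv ℝ (connection g) p.1 X.1 Y.1 Z.1
          + (X.2 * deriv P p.2) • (Y.2 • Z.1 + Z.2 • Y.1),
        X.2 * deriv R p.2 * (Y.2 * Z.2) - (X.2 * deriv Q p.2 * g p.1 Y.1 Z.1
          + Q p.2 * fderiv ℝ g p.1 X.1 Y.1 Z.1)) := by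
    intro X Y Z
    rw [fderiv_apply_apply hΓG']
    have h1 : (fun q => connection G q Y Z) =ᶠ[𝓝 p] fun q =>
      (connection g q.1 Y.1 Z.1 + P q.2 • (Y.2 • Z.1 + Z.2 • Y.1),
          R q.2 * (Y.2 * Z.2) - Q q.2 * g q.1 Y.1 Z.1) := hΓ.mono fun q hq => hq Y Z
    have d1 : DifferentiableAt ℝ (fun v => connection g v Y.1 Z.1) p.1 :=
      (hΓg'.clm_apply (differentiableAt_const _)).clm_apply (differentiableAt_const _)
    have d2 : DifferentiableAt ℝ (fun v => g v Y.1 Z.1) p.1 :=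
      (hg'.clm_apply (differentiableAt_const _)).clm_apply (differentiableAt_const _)
    have d1' : DifferentiableAt ℝ (fun q : F × ℝ => connection g q.1 Y.1 Z.1) p :=
      d1.comp (f := Prod.fst) p differentiableAt_fst
    have d2' : DifferentiableAt ℝ (fun q : F × ℝ => g q.1 Y.1 Z.1) p :=
      d2.comp (f := Prod.fst) p differentiableAt_fst
    have dP : DifferentiableAt ℝ (fun q : F × ℝ => P q.2) p :=
      hPd.comp (f := Prod.snd) p differentiableAt_snd
    have dQ : DifferentiableAt ℝ (fun q : F × ℝ => Q q.2) p :=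
      hQd.comp (f := Prod.snd) p differentiableAt_snd
    have dR : DifferentiableAt ℝ (fun q : F × ℝ => R q.2) p :=
      hRd.comp (f := Prod.snd) p differentiableAt_snd
    have e1 := d1'.fun_add (dP.fun_smul (differentiableAt_const (Y.2 • Z.1 + Z.2 • Y.1)))
    have e2 := (dR.fun_mul (differentiableAt_const (Y.2 * Z.2))).fun_sub (dQ.fun_mul d2')
    rw [h1.fderiv_eq, e1.fderiv_prodMk e2, ContinuousLinearMap.prod_apply,
      fderiv_fun_add d1' (dP.fun_smul (differentiableAt_const _)),
      fderiv_fun_sub (dR.fun_mul (differentiableAt_const _)) (dQ.fun_mul d2'),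
      fderiv_fun_smul dP (differentiableAt_const _), fderiv_fun_mul dR (differentiableAt_const _),
      fderiv_fun_mul dQ d2']
    simp only [add_apply, sub_apply, smul_apply, fderiv_comp_fst d1, fderiv_comp_fst d2,
      fderiv_comp_snd hPd, fderiv_comp_snd hQd, fderiv_comp_snd hRd, ← fderiv_apply_apply hΓg',
      ← fderiv_apply_apply hg', smul_eq_mul, fderiv_eq_smul_deriv,
      ContinuousLinearMap.smulRight_apply]
    refine Prod.ext ?_ ?_
    · simp
    · simp
      ring
  have hp := hΓ.self_of_nhds
  -- the Ricci form is `Ric(g) + κ g` in the directions of `F`, and `ρ dt²` in the direction of `t`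
  set κ : ℝ := -(Module.finrank ℝ F - 2) * P p.2 * Q p.2 - deriv Q p.2 - R p.2 * Q p.2 with hκ
  set ρ : ℝ := Module.finrank ℝ F * (-deriv P p.2 + P p.2 * R p.2 - P p.2 ^ 2) with hρ
  have hric1 : ∀ Y Z : F, ricciForm (connection G) p (Y, 0) (Z, 0)
      = ricciForm (connection g) p.1 Y Z + κ * g p.1 Y Z := by
    intro Y Z
    rw [ricciForm_apply, LinearMap.trace_prod_eq]
    have h1 : LinearMap.fst ℝ F ℝ ∘ₗ (curvEnd (connection G) p (Y, 0) (Z, 0) : F × ℝ →ₗ[ℝ] F × ℝ)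
        ∘ₗ LinearMap.inl ℝ F ℝ = (curvEnd (connection g) p.1 Y Z : F →ₗ[ℝ] F)
          - (P p.2 * Q p.2 * g p.1 Y Z) • LinearMap.id
          + (P p.2 * Q p.2) • ((g p.1).flip Z : F →ₗ[ℝ] ℝ).smulRight Y := by
      ext X
      simp [curvEnd_apply, hd, hp, smul_smul]
      module
    have h2 : LinearMap.trace ℝ ℝ (LinearMap.snd ℝ F ℝ ∘ₗ
        (curvEnd (connection G) p (Y, 0) (Z, 0) : F × ℝ →ₗ[ℝ] F × ℝ) ∘ₗ LinearMap.inr ℝ F ℝ)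
        = -(deriv Q p.2 * g p.1 Y Z) - R p.2 * (Q p.2 * g p.1 Y Z) + P p.2 * Q p.2 * g p.1 Y Z := by
      rw [LinearMap.trace_eq_matrix_trace ℝ (Module.Basis.singleton Unit ℝ)]
      simp [Matrix.trace, LinearMap.toMatrix_apply, curvEnd_apply, hd, hp]
      ring
    rw [h1, h2, map_add, map_sub, map_smul, map_smul, LinearMap.trace_id,
      LinearMap.trace_smulRight]
    simp only [ricciForm_apply, hκ, ContinuousLinearMap.coe_coe, ContinuousLinearMap.flip_apply,
      smul_eq_mul]
    ring
  have hric2 : ricciForm (connection G) p (0, 1) (0, 1) = ρ := by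
    rw [ricciForm_apply, LinearMap.trace_prod_eq]
    have h1 : LinearMap.fst ℝ F ℝ ∘ₗ (curvEnd (connection G) p (0, 1) (0, 1) :
        F × ℝ →ₗ[ℝ] F × ℝ) ∘ₗ LinearMap.inl ℝ F ℝ
        = (-deriv P p.2 + P p.2 * R p.2 - P p.2 ^ 2) • LinearMap.id := by
      ext X
      simp [curvEnd_apply, hd, hp, smul_smul]
      module
    have h2 : LinearMap.trace ℝ ℝ (LinearMap.snd ℝ F ℝ ∘ₗ
        (curvEnd (connection G) p (0, 1) (0, 1) : F × ℝ →ₗ[ℝ] F × ℝ) ∘ₗ LinearMap.inr ℝ F ℝ)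
        = 0 := by
      rw [LinearMap.trace_eq_matrix_trace ℝ (Module.Basis.singleton Unit ℝ)]
      simp [Matrix.trace, LinearMap.toMatrix_apply, curvEnd_apply]
    rw [h1, h2, map_smul, LinearMap.trace_id, smul_eq_mul, add_zero, hρ, mul_comm]
  have hop1 : ∀ Y : F, (ricciOp G p (Y, 0)).1 = (A p.2)⁻¹ • (ricciOp g p.1 Y + κ • Y) := by
    intro Y
    have h : ∀ Z, g p.1 (A p.2 • (ricciOp G p (Y, 0)).1) Z
        = g p.1 (ricciOp g p.1 Y + κ • Y) Z := by
      intro Z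
      have := apply_ricciOp (G := G) (u := p) hGp (Y, 0) (Z, 0)
      rw [hric1] at this
      simpa [hGdef, apply_ricciOp hgp] using this
    rw [← hgp.eq_of_forall h, smul_smul, inv_mul_cancel₀ hA0.ne', one_smul]
  have hop2 : (ricciOp G p (0, 1)).2 = (c p.2)⁻¹ * ρ := by
    have := apply_ricciOp (G := G) (u := p) hGp (0, 1) (0, 1)
    rw [hric2] at this
    have h3 : c p.2 * (ricciOp G p (0, 1)).2 = ρ := by simpa [hGdef] using this
    rw [← h3, inv_mul_cancel_left₀ hc0.ne']
  rw [scalAt, LinearMap.trace_prod_eq]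
  have h1 : LinearMap.fst ℝ F ℝ ∘ₗ ricciOp G p ∘ₗ LinearMap.inl ℝ F ℝ
      = (A p.2)⁻¹ • (ricciOp g p.1 + κ • LinearMap.id) := by
    ext X
    simp [hop1]
  have h2 : LinearMap.trace ℝ ℝ (LinearMap.snd ℝ F ℝ ∘ₗ ricciOp G p ∘ₗ LinearMap.inr ℝ F ℝ)
      = (c p.2)⁻¹ * ρ := by
    rw [LinearMap.trace_eq_matrix_trace ℝ (Module.Basis.singleton Unit ℝ)]
    simp [Matrix.trace, LinearMap.toMatrix_apply, hop2]
  rw [h1, h2, map_smul, map_add, map_smul, LinearMap.trace_id, ← scalAt, hρ, hκ, warpTerm]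
  simp only [smul_eq_mul]
  ring

end VectorSpace

/-! ### Comparison with the formulas in coordinates -/

section Coordinates

variable {n : ℕ}

theorem EuclideanSpace.trace_eq_sum (f : EuclideanSpace ℝ (Fin n) →ₗ[ℝ] EuclideanSpace ℝ (Fin n)) :
    LinearMap.trace ℝ _ f = ∑ i, f (EuclideanSpace.single i 1) i := by
  rw [LinearMap.trace_eq_matrix_trace ℝ (EuclideanSpace.basisFun (Fin n) ℝ).toBasis]
  simp [Matrix.trace, LinearMap.toMatrix_apply]

theorem EuclideanSpace.map_eq_sum {V : Type*} [NormedAddCommGroup V] [NormedSpace ℝ V]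
    (f : EuclideanSpace ℝ (Fin n) →L[ℝ] V) (X : EuclideanSpace ℝ (Fin n)) :
    f X = ∑ i, X i • f (EuclideanSpace.single i 1) := by
  conv_lhs => rw [← (EuclideanSpace.basisFun (Fin n) ℝ).sum_repr X]
  simp

/-- The Gram matrix of a bilinear form in the standard basis. -/
def gramMatrix (B : BilForm (EuclideanSpace ℝ (Fin n))) : Matrix (Fin n) (Fin n) ℝ :=
  Matrix.of fun i j => B (EuclideanSpace.single i 1) (EuclideanSpace.single j 1)

theorem gramMatrix_inv {B : BilForm (EuclideanSpace ℝ (Fin n))} (hB : IsInnerForm B) :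
    (gramMatrix B)⁻¹ = Matrix.of fun k l =>
      B.inverse (EuclideanSpace.proj l : EuclideanSpace ℝ (Fin n) →L[ℝ] ℝ) k := by
  refine Matrix.inv_eq_right_inv ?_
  ext i l
  have h := hB.apply_inverse (EuclideanSpace.proj l) (EuclideanSpace.single i 1)
  rw [hB.symm, EuclideanSpace.map_eq_sum (B (EuclideanSpace.single i 1))] at h
  simp only [Matrix.mul_apply, gramMatrix, Matrix.of_apply, Matrix.one_apply]
  rw [← Finset.sum_congr rfl fun k _ => mul_comm _ _]
  refine h.trans ?_
  simp [eq_comm]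

theorem gramMatrix_inv_symm {B : BilForm (EuclideanSpace ℝ (Fin n))} (hB : IsInnerForm B)
    (k l : Fin n) : (gramMatrix B)⁻¹ k l = (gramMatrix B)⁻¹ l k := by
  have h : (gramMatrix B).IsSymm := by
    ext i j
    exact hB.symm _ _
  have := h.inv
  exact (this.apply l k)

theorem inverse_apply_eq_sum {B : BilForm (EuclideanSpace ℝ (Fin n))} (hB : IsInnerForm B)
    (φ : EuclideanSpace ℝ (Fin n) →L[ℝ] ℝ) (k : Fin n) :
    B.inverse φ k = ∑ l, (gramMatrix B)⁻¹ k l * φ (EuclideanSpace.single l 1) := by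
  have h : φ = ∑ l, φ (EuclideanSpace.single l 1) • (EuclideanSpace.proj l) := by
    ext X
    rw [EuclideanSpace.map_eq_sum φ X]
    simp [mul_comm]
  conv_lhs => rw [h]
  rw [gramMatrix_inv hB, map_sum]
  simp [mul_comm]

theorem EuclideanSpace.fderiv_coord {V : Type*} [NormedAddCommGroup V] [NormedSpace ℝ V]
    {f : V → EuclideanSpace ℝ (Fin n)} {v : V} (hf : DifferentiableAt ℝ f v) (k : Fin n) (X : V) :
    fderiv ℝ (fun w => f w k) v X = fderiv ℝ f v X k := by
  have := ((EuclideanSpace.proj k : EuclideanSpace ℝ (Fin n) →L[ℝ] ℝ).hasFDerivAt.comp v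
    hf.hasFDerivAt).fderiv
  exact DFunLike.congr_fun this X

theorem connection_symm {E : Type*} [NormedAddCommGroup E] [NormedSpace ℝ E]
    [FiniteDimensional ℝ E] {G : E → BilForm E} {u : E} (hG : DifferentiableAt ℝ G u)
    (hs : ∀ᶠ v in 𝓝 u, IsInnerForm (G v)) (X Y : E) :
    connection G u X Y = connection G u Y X := by
  refine (connection_eq_iff hs.self_of_nhds).mpr fun Z => ?_
  rw [apply_connection hs.self_of_nhds, koszul_apply, koszul_apply]
  have : fderiv ℝ G u Z X Y = fderiv ℝ G u Z Y X := by
    rw [fderiv_apply_apply hG, fderiv_apply_apply hG]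
    have h : (fun w => G w X Y) =ᶠ[𝓝 u] fun w => G w Y X := hs.mono fun w hw => hw.symm X Y
    rw [h.fderiv_eq]
  rw [this]
  ring

/-- The scalar curvature agrees with the one given by the coordinate formulas. -/
theorem scalarCurvatureCoord_gramMatrix {G : EuclideanSpace ℝ (Fin n) →
    BilForm (EuclideanSpace ℝ (Fin n))} {u : EuclideanSpace ℝ (Fin n)}
    (hG : ContDiffAt ℝ ∞ G u) (hs : ∀ᶠ v in 𝓝 u, IsInnerForm (G v)) :
    scalarCurvatureCoord (fun v => gramMatrix (G v)) u = scalAt G u := by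
  have hu := hs.self_of_nhds
  have hchr : ∀ k i j, christoffelSymbol (fun v => gramMatrix (G v)) k i j =ᶠ[𝓝 u]
      fun v => connection G v (EuclideanSpace.single i 1) (EuclideanSpace.single j 1) k := by
    intro k i j
    filter_upwards [hs, (hG.of_le one_le_infty).eventually (by simp)] with v hv hGv
    have hd : ∀ i j l, coordDeriv i (fun v => gramMatrix (G v) j l) v
        = fderiv ℝ G v (EuclideanSpace.single i 1) (EuclideanSpace.single j 1)
          (EuclideanSpace.single l 1) := by
      intro i j l
      rw [fderiv_apply_apply (hGv.differentiableAt one_ne_zero)]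
      rfl
    simp only [christoffelSymbol, hd]
    rw [connection_apply, inverse_apply_eq_sum hv, Finset.mul_sum]
    refine Finset.sum_congr rfl fun l _ => ?_
    rw [koszul_apply]
    ring
  have hΓ : DifferentiableAt ℝ (connection G) u := (hG.connection hu).differentiableAt (by simp)
  have hsym := fun X Y => connection_symm (hG.differentiableAt (by simp)) hs X Y
  have hsymd : ∀ X Y Z, fderiv ℝ (connection G) u X Y Z = fderiv ℝ (connection G) u X Z Y := by
    intro X Y Z
    rw [fderiv_apply_apply hΓ, fderiv_apply_apply hΓ]
    have h : (fun w => connection G w Y Z) =ᶠ[𝓝 u] fun w => connection G w Z Y := by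
      filter_upwards [hs.eventually_nhds, (hG.of_le one_le_infty).eventually (by simp)]
        with v hv hGv
      exact connection_symm (hGv.differentiableAt one_ne_zero) hv Y Z
    rw [h.fderiv_eq]
  have hdchr : ∀ m k i j, coordDeriv m (christoffelSymbol (fun v => gramMatrix (G v)) k i j) u
      = fderiv ℝ (connection G) u (EuclideanSpace.single m 1) (EuclideanSpace.single i 1)
          (EuclideanSpace.single j 1) k := by
    intro m k i j
    rw [coordDeriv, (hchr k i j).fderiv_eq, EuclideanSpace.fderiv_coord
      ((hΓ.clm_apply (differentiableAt_const _)).clm_apply (differentiableAt_const _)),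
      ← fderiv_apply_apply hΓ]
  have hric : ∀ j k, ricciCoord (fun v => gramMatrix (G v)) j k u
      = ricciForm (connection G) u (EuclideanSpace.single k 1) (EuclideanSpace.single j 1) := by
    intro j k
    rw [ricciForm_apply, EuclideanSpace.trace_eq_sum, ricciCoord, ← Finset.sum_add_distrib]
    refine Finset.sum_congr rfl fun i _ => ?_
    simp only [hdchr, (hchr _ _ _).eq_of_nhds, ContinuousLinearMap.coe_coe, curvEnd_apply]
    rw [EuclideanSpace.map_eq_sum (connection G u (EuclideanSpace.single i 1))
        (connection G u (EuclideanSpace.single k 1) (EuclideanSpace.single j 1)),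
      EuclideanSpace.map_eq_sum (connection G u (EuclideanSpace.single k 1))
        (connection G u (EuclideanSpace.single i 1) (EuclideanSpace.single j 1)),
      hsymd _ (EuclideanSpace.single j 1), hsym (EuclideanSpace.single j 1)]
    simp only [PiLp.add_apply, PiLp.sub_apply, Finset.sum_sub_distrib]
    simp [mul_comm]
    ring
  rw [scalAt, EuclideanSpace.trace_eq_sum, scalarCurvatureCoord, Finset.sum_comm]
  refine Finset.sum_congr rfl fun k _ => ?_
  simp only [ricciOp, LinearMap.comp_apply, ContinuousLinearMap.coe_coe]
  rw [inverse_apply_eq_sum hu]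
  refine Finset.sum_congr rfl fun l _ => ?_
  rw [hric, gramMatrix_inv_symm hu]
  rfl

end Coordinates

/-! ### Metrics on manifolds in local parametrizations -/

section Manifold

variable {n : ℕ} {M : Type*} [TopologicalSpace M] [ChartedSpace (EuclideanSpace ℝ (Fin n)) M]
  {E : Type*} [NormedAddCommGroup E] [NormedSpace ℝ E]

/-- A field of bilinear forms on the tangent spaces of `M`. -/
abbrev FormField (n : ℕ) (M : Type*) [TopologicalSpace M]
    [ChartedSpace (EuclideanSpace ℝ (Fin n)) M] :=
  ∀ p : M, TangentSpace (𝓡 n) p →L[ℝ] TangentSpace (𝓡 n) p →L[ℝ] ℝ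

/-- The pull-back of a field of bilinear forms under a map `ψ` from a vector space. -/
def pullForm (b : FormField n M) (ψ : E → M) (v : E) : BilForm E :=
  ContinuousLinearMap.bilinearComp (E := EuclideanSpace ℝ (Fin n)) (F := EuclideanSpace ℝ (Fin n))
    (b (ψ v)) (mfderiv 𝓘(ℝ, E) (𝓡 n) ψ v) (mfderiv 𝓘(ℝ, E) (𝓡 n) ψ v)

theorem pullForm_apply (b : FormField n M) (ψ : E → M) (v X Y : E) :
    pullForm b ψ v X Y
      = b (ψ v) (mfderiv 𝓘(ℝ, E) (𝓡 n) ψ v X) (mfderiv 𝓘(ℝ, E) (𝓡 n) ψ v Y) := rfl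

variable [IsManifold (𝓡 n) ∞ M]

/-- A field of bilinear forms is smooth as a section of the bundle of bilinear forms if and only if
its expression in the preferred chart is smooth. -/
theorem contMDiffAt_formField_iff (b : FormField n M) (x : M) :
    ContMDiffAt (𝓡 n) ((𝓡 n).prod 𝓘(ℝ, BilForm (EuclideanSpace ℝ (Fin n)))) ∞
      (fun p => Bundle.TotalSpace.mk' (BilForm (EuclideanSpace ℝ (Fin n))) p (b p)) x
    ↔ ContDiffAt ℝ ∞ (pullForm b (extChartAt (𝓡 n) x).symm) (extChartAt (𝓡 n) x x) := by
  -- the trivialization of the bundle is given by the derivative of the chart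
  have hev : ∀ᶠ p in 𝓝 x, ContinuousLinearMap.inCoordinates (EuclideanSpace ℝ (Fin n))
      (TangentSpace (𝓡 n)) (EuclideanSpace ℝ (Fin n) →L[ℝ] ℝ)
      (fun p : M => TangentSpace (𝓡 n) p →L[ℝ] ℝ) x p x p (b p)
      = pullForm b (extChartAt (𝓡 n) x).symm (extChartAt (𝓡 n) x p) := by
    filter_upwards [extChartAt_source_mem_nhds (I := 𝓡 n) x] with p hp
    have hp' : p ∈ (chartAt (EuclideanSpace ℝ (Fin n)) x).source := by
      rwa [extChartAt_source] at hp
    ext X Y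
    rw [inCoordinates_apply_eq₂ (F₁ := EuclideanSpace ℝ (Fin n)) (F₂ := EuclideanSpace ℝ (Fin n))
      (F₃ := ℝ) (E₁ := TangentSpace (𝓡 n)) (E₂ := TangentSpace (𝓡 n))
      (E₃ := Bundle.Trivial M ℝ) hp' hp' (Set.mem_univ _)]
    have key : ∀ q, q = p → ∀ v w : EuclideanSpace ℝ (Fin n),
        (b p : BilForm (EuclideanSpace ℝ (Fin n))) v w
          = (b q : BilForm (EuclideanSpace ℝ (Fin n))) v w := by
      rintro _ rfl _ _; rfl
    have hL : ∀ Z : EuclideanSpace ℝ (Fin n),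
        ((trivializationAt (EuclideanSpace ℝ (Fin n)) (TangentSpace (𝓡 n)) x).symm p Z)
          = mfderiv 𝓘(ℝ, EuclideanSpace ℝ (Fin n)) (𝓡 n) (extChartAt (𝓡 n) x).symm
            (extChartAt (𝓡 n) x p) Z := by
      intro Z
      have := DFunLike.congr_fun (TangentBundle.symmL_trivializationAt (I := 𝓡 n) hp') Z
      rw [ModelWithCorners.range_eq_univ, mfderivWithin_univ,
        Bundle.Trivialization.symmL_apply _ hp'] at this
      exact this
    have hone : ∀ r : ℝ, (trivializationAt ℝ (Bundle.Trivial M ℝ) x).linearMapAt ℝ p r = r := by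
      intro r
      simp
    refine (hone _).trans ?_
    rw [hL, hL, pullForm_apply]
    exact key _ ((extChartAt (𝓡 n) x).left_inv hp) _ _
  rw [contMDiffAt_hom_bundle]
  have hx : (extChartAt (𝓡 n) x).symm (extChartAt (𝓡 n) x x) = x := extChartAt_to_inv x
  constructor
  · rintro ⟨-, h⟩
    have h2 := h.congr_of_eventuallyEq (hev.mono fun p hp => hp.symm)
    have h3 : ContMDiffAt 𝓘(ℝ, EuclideanSpace ℝ (Fin n)) (𝓡 n) ∞ (extChartAt (𝓡 n) x).symm
        (extChartAt (𝓡 n) x x) :=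
      (contMDiffOn_extChartAt_symm x).contMDiffAt (extChartAt_target_mem_nhds x)
    rw [← hx] at h2
    have h4 := (h2.comp (extChartAt (𝓡 n) x x) h3).contDiffAt
    rw [hx] at h4
    refine h4.congr_of_eventuallyEq ?_
    filter_upwards [extChartAt_target_mem_nhds (I := 𝓡 n) x] with v hv
    simp only [comp_apply, (extChartAt (𝓡 n) x).right_inv hv]
  · intro h
    refine ⟨contMDiffAt_id, ?_⟩
    have h2 : ContMDiffAt (𝓡 n) 𝓘(ℝ, BilForm (EuclideanSpace ℝ (Fin n))) ∞
        (fun p => pullForm b (extChartAt (𝓡 n) x).symm (extChartAt (𝓡 n) x p)) x :=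
      ContMDiffAt.comp (g := pullForm b (extChartAt (𝓡 n) x).symm) x h.contMDiffAt
        (contMDiffAt_extChartAt (I := 𝓡 n))
    exact h2.congr_of_eventuallyEq hev

end Manifold

/-- The unit ball of an inner product is bounded: the boundedness condition in Mathlib's definition
of a Riemannian metric is automatic in finite dimension. -/
theorem IsInnerForm.isVonNBounded {E : Type*} [NormedAddCommGroup E] [NormedSpace ℝ E]
    [FiniteDimensional ℝ E] {B : BilForm E} (hB : IsInnerForm B) :
    Bornology.IsVonNBounded ℝ {v : E | B v v < 1} := by
  rw [NormedSpace.isVonNBounded_iff]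
  rcases subsingleton_or_nontrivial E with h | h
  · exact (Set.toFinite _).isBounded
  have : ProperSpace E := FiniteDimensional.proper ℝ E
  have hcont : Continuous fun v : E => B v v := B.continuous.clm_apply continuous_id
  obtain ⟨x, hx, hmin⟩ := (isCompact_sphere (0 : E) 1).exists_isMinOn
    (NormedSpace.sphere_nonempty.mpr zero_le_one) hcont.continuousOn
  have hx0 : x ≠ 0 := by rintro rfl; simp at hx
  have hc := hB.pos x hx0
  refine isBounded_iff_forall_norm_le.mpr ⟨Real.sqrt (B x x)⁻¹, fun v hv => ?_⟩
  refine Real.le_sqrt_of_sq_le ?_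
  rcases eq_or_ne v 0 with rfl | hv0
  · simpa using hc.le
  have h1 : B x x ≤ B (‖v‖⁻¹ • v) (‖v‖⁻¹ • v) := hmin (by simp [norm_smul, hv0])
  have h2 : 0 < ‖v‖ := norm_pos_iff.mpr hv0
  simp only [map_smul, smul_apply, smul_eq_mul] at h1
  have h3 : B x x * ‖v‖ ^ 2 ≤ B v v := by
    calc B x x * ‖v‖ ^ 2 ≤ (‖v‖⁻¹ * (‖v‖⁻¹ * B v v)) * ‖v‖ ^ 2 := by gcongr
      _ = B v v := by field_simp
  have h4 : B v v < 1 := hv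
  rw [← one_div, le_div_iff₀ hc]
  linarith

section Manifold

variable {n : ℕ} {M : Type*} [TopologicalSpace M] [ChartedSpace (EuclideanSpace ℝ (Fin n)) M]
  {E : Type*} [NormedAddCommGroup E] [NormedSpace ℝ E]
  {E' : Type*} [NormedAddCommGroup E'] [NormedSpace ℝ E']

theorem pullForm_congr (b : FormField n M) {ψ ψ' : E → M} {v : E} (h : ψ =ᶠ[𝓝 v] ψ') :
    pullForm b ψ =ᶠ[𝓝 v] pullForm b ψ' := by
  filter_upwards [h.eventuallyEq_nhds] with w hw
  ext X Y
  rw [pullForm_apply, pullForm_apply, hw.mfderiv_eq]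
  have key : ∀ q, q = ψ w → ∀ v w : EuclideanSpace ℝ (Fin n),
      (b q : BilForm (EuclideanSpace ℝ (Fin n))) v w
        = (b q : BilForm (EuclideanSpace ℝ (Fin n))) v w := by
    rintro _ rfl _ _; rfl
  have h0 : (b (ψ w) : BilForm (EuclideanSpace ℝ (Fin n))) = b (ψ' w) := by
    rw [hw.eq_of_nhds]
  exact DFunLike.congr_fun (DFunLike.congr_fun h0 _) _

theorem pullForm_comp (b : FormField n M) {ψ : E → M} {τ : E' → E} {v : E'}
    (hψ : MDifferentiableAt 𝓘(ℝ, E) (𝓡 n) ψ (τ v)) (hτ : DifferentiableAt ℝ τ v) :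
    pullForm b (ψ ∘ τ) v = (pullForm b ψ (τ v)).bilinearComp (fderiv ℝ τ v) (fderiv ℝ τ v) := by
  have h := mfderiv_comp v hψ hτ.mdifferentiableAt
  ext X Y
  rw [pullForm_apply, h, mfderiv_eq_fderiv]
  rfl

/-- The derivative at `u` of a map from a vector space to a manifold, as a linear map between vector
spaces. -/
def paramDeriv (n : ℕ) {M : Type*} [TopologicalSpace M]
    [ChartedSpace (EuclideanSpace ℝ (Fin n)) M]
    {E : Type*} [NormedAddCommGroup E] [NormedSpace ℝ E] (ψ : E → M) (u : E) :
    E →L[ℝ] EuclideanSpace ℝ (Fin n) :=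
  mfderiv 𝓘(ℝ, E) (𝓡 n) ψ u

/-- `ψ` is smooth at `u`, with invertible derivative: a parametrization of `M` near `ψ u`. -/
structure IsParam (n : ℕ) {M : Type*} [TopologicalSpace M]
    [ChartedSpace (EuclideanSpace ℝ (Fin n)) M]
    {E : Type*} [NormedAddCommGroup E] [NormedSpace ℝ E] (ψ : E → M) (u : E) : Prop where
  contMDiffAt : ContMDiffAt 𝓘(ℝ, E) (𝓡 n) ∞ ψ u
  invertible : (paramDeriv n ψ u).IsInvertible

theorem IsParam.contDiffAt_chart {ψ : E → M} {u : E} (hψ : IsParam n ψ u) :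
    ContDiffAt ℝ ∞ (fun w => extChartAt (𝓡 n) (ψ u) (ψ w)) u := by
  have h4 : ContMDiffAt (𝓡 n) 𝓘(ℝ, EuclideanSpace ℝ (Fin n)) ∞ (extChartAt (𝓡 n) (ψ u)) (ψ u) :=
      contMDiffAt_extChartAt
  exact (h4.comp u hψ.contMDiffAt).contDiffAt

variable [IsManifold (𝓡 n) ∞ M]

theorem isParam_extChartAt_symm (x : M) {u : EuclideanSpace ℝ (Fin n)}
    (hu : u ∈ (extChartAt (𝓡 n) x).target) : IsParam n (extChartAt (𝓡 n) x).symm u where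
  contMDiffAt := (contMDiffOn_extChartAt_symm x).contMDiffAt
    ((isOpen_extChartAt_target x).mem_nhds hu)
  invertible := by
    have h : IsManifold (𝓡 n) 1 M := .of_le one_le_infty
    have := isInvertible_mfderivWithin_extChartAt_symm (I := 𝓡 n) hu
    rwa [ModelWithCorners.range_eq_univ, mfderivWithin_univ] at this

/-- A field of bilinear forms is smooth if, around every point, its expression in the preferred
chart is. -/
def IsSmoothForm (b : FormField n M) : Prop :=
  ∀ x, ContDiffAt ℝ ∞ (pullForm b (extChartAt (𝓡 n) x).symm) (extChartAt (𝓡 n) x x)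

theorem SmoothMetric.isSmoothForm (g : SmoothMetric n M) : IsSmoothForm g.inner := fun x =>
  (contMDiffAt_formField_iff g.inner x).mp (g.contMDiff x)

/-- The expressions of a field of forms in a parametrization and in the preferred chart are related
by the coordinate change. -/
theorem pullForm_eventuallyEq (b : FormField n M) {ψ : E → M} {u : E} (hψ : IsParam n ψ u) :
    pullForm b ψ =ᶠ[𝓝 u] fun v =>
      (pullForm b (extChartAt (𝓡 n) (ψ u)).symm (extChartAt (𝓡 n) (ψ u) (ψ v))).bilinearComp
        (fderiv ℝ (fun w => extChartAt (𝓡 n) (ψ u) (ψ w)) v)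
        (fderiv ℝ (fun w => extChartAt (𝓡 n) (ψ u) (ψ w)) v) := by
  have hc := hψ.contMDiffAt.continuousAt
  have h1 : ∀ᶠ v in 𝓝 u, ψ v ∈ (extChartAt (𝓡 n) (ψ u)).source :=
    hc.eventually (extChartAt_source_mem_nhds (I := 𝓡 n) (ψ u))
  have h2 : ∀ᶠ v in 𝓝 u, ContMDiffAt 𝓘(ℝ, E) (𝓡 n) 1 ψ v := by
    have : IsManifold (𝓡 n) 1 M := .of_le one_le_infty
    exact (contMDiffAt_iff_contMDiffAt_nhds (by simp)).mp (hψ.contMDiffAt.of_le one_le_infty)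
  filter_upwards [h1.eventually_nhds, h2] with v hv hv2
  have hv1 := hv.self_of_nhds
  have h3 : ψ =ᶠ[𝓝 v] (extChartAt (𝓡 n) (ψ u)).symm ∘ fun w => extChartAt (𝓡 n) (ψ u) (ψ w) :=
    hv.mono fun w hw => ((extChartAt (𝓡 n) (ψ u)).left_inv hw).symm
  rw [(pullForm_congr b h3).eq_of_nhds]
  have : IsManifold (𝓡 n) 1 M := .of_le one_le_infty
  refine pullForm_comp b ?_ ?_
  · exact ((isParam_extChartAt_symm (ψ u)
      ((extChartAt (𝓡 n) (ψ u)).map_source hv1)).contMDiffAt).mdifferentiableAt (by simp)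
  · have h4 : ContMDiffAt (𝓡 n) 𝓘(ℝ, EuclideanSpace ℝ (Fin n)) 1 (extChartAt (𝓡 n) (ψ u)) (ψ v) :=
      contMDiffAt_extChartAt' (by rwa [extChartAt_source] at hv1)
    exact ((h4.comp v hv2).contDiffAt).differentiableAt one_ne_zero

theorem IsParam.isInvertible_chart {ψ : E → M} {u : E} (hψ : IsParam n ψ u) :
    (fderiv ℝ (fun w => extChartAt (𝓡 n) (ψ u) (ψ w)) u).IsInvertible := by
  have h : IsManifold (𝓡 n) 1 M := .of_le one_le_infty
  have h1 : MDifferentiableAt (𝓡 n) 𝓘(ℝ, EuclideanSpace ℝ (Fin n)) (extChartAt (𝓡 n) (ψ u)) (ψ u) :=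
    mdifferentiableAt_extChartAt (mem_chart_source _ _)
  have h2 := mfderiv_comp u h1 (hψ.contMDiffAt.mdifferentiableAt (by simp))
  have h3 := isInvertible_mfderiv_extChartAt (I := 𝓡 n) (mem_extChartAt_source (I := 𝓡 n) (ψ u))
  rw [← mfderiv_eq_fderiv]
  exact h2 ▸ (ContinuousLinearMap.IsInvertible.comp h3 hψ.invertible)

theorem IsSmoothForm.contDiffAt_pullForm {b : FormField n M} (hb : IsSmoothForm b) {ψ : E → M}
    {u : E} (hψ : IsParam n ψ u) : ContDiffAt ℝ ∞ (pullForm b ψ) u := by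
  have hL : ContDiffAt ℝ ∞ (fderiv ℝ (fun w => extChartAt (𝓡 n) (ψ u) (ψ w))) u :=
    hψ.contDiffAt_chart.fderiv_right (by simp)
  exact ((ContDiffAt.comp (g := pullForm b (extChartAt (𝓡 n) (ψ u)).symm) u (hb (ψ u))
    hψ.contDiffAt_chart).bilinearComp hL hL).congr_of_eventuallyEq (pullForm_eventuallyEq b hψ)

/-- The forms induced by a metric in a parametrization are inner products. -/
theorem SmoothMetric.isInnerForm_pullForm (g : SmoothMetric n M) {ψ : E → M} {u : E}
    (hψ : IsParam n ψ u) : IsInnerForm (pullForm g.inner ψ u) where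
  symm _ _ := g.symm _ _ _
  pos X hX := by
    refine g.pos _ _ fun h => hX (hψ.invertible.injective ?_)
    rw [map_zero]
    exact h

theorem SmoothMetric.eventually_isInnerForm (g : SmoothMetric n M) [FiniteDimensional ℝ E]
    {ψ : E → M} {u : E} (hψ : IsParam n ψ u) :
    ∀ᶠ v in 𝓝 u, IsInnerForm (pullForm g.inner ψ v) :=
  isInnerForm_eventually (g.isSmoothForm.contDiffAt_pullForm hψ).continuousAt
    (Eventually.of_forall fun _ _ _ => g.symm _ _ _) (g.isInnerForm_pullForm hψ)

theorem scalarCurvature_eq_scalAt_chart (g : SmoothMetric n M) (x : M) :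
    scalarCurvature g x
      = scalAt (pullForm g.inner (extChartAt (𝓡 n) x).symm) (extChartAt (𝓡 n) x x) := by
  have h : metricCoeff g x
      = fun v => gramMatrix (pullForm g.inner (extChartAt (𝓡 n) x).symm v) := by
    funext v
    ext i j
    rfl
  rw [scalarCurvature, h]
  exact scalarCurvatureCoord_gramMatrix (g.isSmoothForm x)
    (g.eventually_isInnerForm (isParam_extChartAt_symm x (mem_extChartAt_target x)))

/-- The scalar curvature of a metric can be computed in any parametrization. -/
theorem scalarCurvature_eq_scalAt [FiniteDimensional ℝ E] (g : SmoothMetric n M) {ψ : E → M}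
    {u : E} (hψ : IsParam n ψ u) :
    scalarCurvature g (ψ u) = scalAt (pullForm g.inner ψ) u := by
  rw [scalarCurvature_eq_scalAt_chart]
  exact (scalAt_pullback hψ.contDiffAt_chart hψ.isInvertible_chart (g.isSmoothForm (ψ u))
    (Eventually.of_forall fun _ _ _ => g.symm _ _ _)
    (g.isInnerForm_pullForm (isParam_extChartAt_symm (ψ u) (mem_extChartAt_target (ψ u))))
    (pullForm_eventuallyEq g.inner hψ)).symm

theorem exists_pos_le_scalarCurvature [CompactSpace M] (g : SmoothMetric n M)
    (hg : ∀ x, 0 < scalarCurvature g x) : ∃ σ > 0, ∀ x, σ ≤ scalarCurvature g x := by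
  have hc : Continuous (scalarCurvature g) := by
    refine continuous_iff_continuousAt.mpr fun x => ?_
    have h1 : ∀ᶠ y in 𝓝 x, scalAt (pullForm g.inner (extChartAt (𝓡 n) x).symm)
        (extChartAt (𝓡 n) x y) = scalarCurvature g y := by
      filter_upwards [extChartAt_source_mem_nhds (I := 𝓡 n) x] with y hy
      rw [← scalarCurvature_eq_scalAt g
        (isParam_extChartAt_symm x ((extChartAt (𝓡 n) x).map_source hy)),
        (extChartAt (𝓡 n) x).left_inv hy]
    refine ContinuousAt.congr ?_ h1
    have hp := isParam_extChartAt_symm (n := n) x (mem_extChartAt_target x)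
    exact ContinuousAt.comp (f := extChartAt (𝓡 n) x)
      (continuousAt_scalAt (g.isSmoothForm x) (g.isInnerForm_pullForm hp))
      (continuousAt_extChartAt x)
  rcases isEmpty_or_nonempty M with h | h
  · exact ⟨1, one_pos, fun x => isEmptyElim x⟩
  · obtain ⟨x, -, hx⟩ := isCompact_univ.exists_isMinOn univ_nonempty hc.continuousOn
    exact ⟨_, hg x, fun y => hx (mem_univ y)⟩

/-- A smooth field of inner products is a Riemannian metric. -/
def SmoothMetric.ofForm (b : FormField n M) (hb : IsSmoothForm b)
    (hi : ∀ p, IsInnerForm (E := EuclideanSpace ℝ (Fin n)) (b p)) : SmoothMetric n M where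
  inner := b
  symm p := (hi p).symm
  pos p := (hi p).pos
  isVonNBounded p := (hi p).isVonNBounded
  contMDiff p := (contMDiffAt_formField_iff b p).mpr (hb p)

end Manifold

/-! ### Sums of products of differentials -/

section SumForm

variable {n : ℕ} {M : Type*} [TopologicalSpace M] [ChartedSpace (EuclideanSpace ℝ (Fin n)) M]
  {E : Type*} [NormedAddCommGroup E] [NormedSpace ℝ E]

/-- The differential at `p` of a function on a manifold, as a linear form on the model space. -/
def differential (n : ℕ) {M : Type*} [TopologicalSpace M]
    [ChartedSpace (EuclideanSpace ℝ (Fin n)) M] (V : M → ℝ) (p : M) :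
    EuclideanSpace ℝ (Fin n) →L[ℝ] ℝ :=
  mfderiv (𝓡 n) 𝓘(ℝ, ℝ) V p

/-- The bilinear form `dV ⊗ dW` of two functions on a manifold. -/
def gradForm (n : ℕ) {M : Type*} [TopologicalSpace M] [ChartedSpace (EuclideanSpace ℝ (Fin n)) M]
    (V W : M → ℝ) (p : M) : BilForm (EuclideanSpace ℝ (Fin n)) :=
  (differential n V p).smulRight (differential n W p)

/-- The field of bilinear forms `∑ₖ Uₖ dVₖ ⊗ dWₖ`. -/
def sumForm {κ : Type*} [Fintype κ] (U V W : κ → M → ℝ) : FormField n M := fun p =>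
  (∑ k, U k p • gradForm n (V k) (W k) p : BilForm (EuclideanSpace ℝ (Fin n)))

/-- The field of bilinear forms `∑ₖ Uₖ dVₖ ⊗ dWₖ` on a vector space. -/
def sumBil {κ : Type*} [Fintype κ] (U V W : κ → E → ℝ) (v : E) : BilForm E :=
  ∑ k, U k v • (fderiv ℝ (V k) v).smulRight (fderiv ℝ (W k) v)

theorem sumBil_apply {κ : Type*} [Fintype κ] (U V W : κ → E → ℝ) (v X Y : E) :
    sumBil U V W v X Y = ∑ k, U k v * (fderiv ℝ (V k) v X * fderiv ℝ (W k) v Y) := by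
  simp [sumBil, ContinuousLinearMap.smulRight_apply]

theorem contDiffAt_sumBil {κ : Type*} [Fintype κ] {U V W : κ → E → ℝ} {v : E}
    (hU : ∀ k, ContDiffAt ℝ ∞ (U k) v) (hV : ∀ k, ContDiffAt ℝ ∞ (V k) v)
    (hW : ∀ k, ContDiffAt ℝ ∞ (W k) v) : ContDiffAt ℝ ∞ (sumBil U V W) v := by
  refine ContDiffAt.sum fun k _ => (hU k).smul ?_
  have h1 : ContDiffAt ℝ ∞ (fderiv ℝ (V k)) v := (hV k).fderiv_right (by simp)
  have h2 : ContDiffAt ℝ ∞ (fderiv ℝ (W k)) v := (hW k).fderiv_right (by simp)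
  exact ((ContinuousLinearMap.smulRightL ℝ E (E →L[ℝ] ℝ)).contDiff.contDiffAt.comp v h1).clm_apply
    h2

theorem pullForm_sumForm {κ : Type*} [Fintype κ] {U V W : κ → M → ℝ} {ψ : E → M} {v : E}
    (hV : ∀ k, MDifferentiableAt (𝓡 n) 𝓘(ℝ, ℝ) (V k) (ψ v))
    (hW : ∀ k, MDifferentiableAt (𝓡 n) 𝓘(ℝ, ℝ) (W k) (ψ v))
    (hψ : MDifferentiableAt 𝓘(ℝ, E) (𝓡 n) ψ v) :
    pullForm (sumForm (n := n) U V W) ψ v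
      = sumBil (fun k => U k ∘ ψ) (fun k => V k ∘ ψ) (fun k => W k ∘ ψ) v := by
  have h : ∀ {f : M → ℝ}, MDifferentiableAt (𝓡 n) 𝓘(ℝ, ℝ) f (ψ v) → ∀ X : E,
      fderiv ℝ (f ∘ ψ) v X = mfderiv (𝓡 n) 𝓘(ℝ, ℝ) f (ψ v) (mfderiv 𝓘(ℝ, E) (𝓡 n) ψ v X) := by
    intro f hf X
    rw [← mfderiv_eq_fderiv, mfderiv_comp v hf hψ]
    rfl
  ext X Y
  rw [sumBil_apply, pullForm_apply]
  have h2 : ∀ A B : EuclideanSpace ℝ (Fin n),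
      (sumForm (n := n) U V W (ψ v) : BilForm (EuclideanSpace ℝ (Fin n))) A B
        = ∑ k, U k (ψ v) * (gradForm n (V k) (W k) (ψ v) A B) := by
    intro A B
    have h3 : (sumForm (n := n) U V W (ψ v) : BilForm (EuclideanSpace ℝ (Fin n)))
      = ∑ k, U k (ψ v) • gradForm n (V k) (W k) (ψ v) := rfl
    refine (congrArg (fun T : BilForm (EuclideanSpace ℝ (Fin n)) => T A B) h3).trans ?_
    simp only [sum_apply, smul_apply, smul_eq_mul]
  refine (h2 _ _).trans (Finset.sum_congr rfl fun k _ => ?_)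
  rw [h (hV k), h (hW k)]
  rfl

theorem isSmoothForm_sumForm [IsManifold (𝓡 n) ∞ M] {κ : Type*} [Fintype κ] {U V W : κ → M → ℝ}
    (hU : ∀ k, ContMDiff (𝓡 n) 𝓘(ℝ, ℝ) ∞ (U k)) (hV : ∀ k, ContMDiff (𝓡 n) 𝓘(ℝ, ℝ) ∞ (V k))
    (hW : ∀ k, ContMDiff (𝓡 n) 𝓘(ℝ, ℝ) ∞ (W k)) :
    IsSmoothForm (sumForm U V W : FormField n M) := by
  intro x
  have hp := isParam_extChartAt_symm (n := n) x (mem_extChartAt_target x)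
  have hc : ∀ {f : M → ℝ}, ContMDiff (𝓡 n) 𝓘(ℝ, ℝ) ∞ f →
      ContDiffAt ℝ ∞ (f ∘ (extChartAt (𝓡 n) x).symm) (extChartAt (𝓡 n) x x) := fun hf =>
    (hf.contMDiffAt.comp _ hp.contMDiffAt).contDiffAt
  refine (contDiffAt_sumBil (fun k => hc (hU k)) (fun k => hc (hV k))
    (fun k => hc (hW k))).congr_of_eventuallyEq ?_
  filter_upwards [(isOpen_extChartAt_target (I := 𝓡 n) x).mem_nhds (mem_extChartAt_target x)]
    with v hv
  exact pullForm_sumForm (fun k => (hV k).contMDiffAt.mdifferentiableAt (by simp))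
    (fun k => (hW k).contMDiffAt.mdifferentiableAt (by simp))
    ((isParam_extChartAt_symm x hv).contMDiffAt.mdifferentiableAt (by simp))

end SumForm

/-! ### Cut-off coordinate functions -/

section Bump

variable {E H : Type*} [NormedAddCommGroup E] [NormedSpace ℝ E] [FiniteDimensional ℝ E]
  [TopologicalSpace H] {I : ModelWithCorners ℝ E H}
  {M : Type*} [TopologicalSpace M] [ChartedSpace H M]

theorem SmoothBumpFunction.isOpen_eventually_one {c : M} (f : SmoothBumpFunction I c) :
    IsOpen {p | ∀ᶠ q in 𝓝 p, f q = 1} := isOpen_setOfPred_eventually_nhds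

theorem SmoothBumpFunction.mem_source_of_eventually_one {c p : M} (f : SmoothBumpFunction I c)
    (hp : ∀ᶠ q in 𝓝 p, f q = 1) : p ∈ (chartAt H c).source := by
  refine f.support_subset_source ?_
  rw [mem_support, hp.self_of_nhds]
  exact one_ne_zero

end Bump

section Manifold

variable {n : ℕ} {M : Type*} [TopologicalSpace M] [ChartedSpace (EuclideanSpace ℝ (Fin n)) M]
  [IsManifold (𝓡 n) ∞ M]

/-- The derivative of the chart at `x` in the point `p`, as an endomorphism of the model space. -/
def chartDeriv (n : ℕ) {M : Type*} [TopologicalSpace M]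
    [ChartedSpace (EuclideanSpace ℝ (Fin n)) M] (x p : M) :
    EuclideanSpace ℝ (Fin n) →L[ℝ] EuclideanSpace ℝ (Fin n) :=
  mfderiv (𝓡 n) 𝓘(ℝ, EuclideanSpace ℝ (Fin n)) (extChartAt (𝓡 n) x) p

/-- A field of forms is recovered from its expression in a chart. -/
theorem apply_eq_pullForm_extChartAt (b : FormField n M) {x p : M}
    (hp : p ∈ (extChartAt (𝓡 n) x).source) (X Y : EuclideanSpace ℝ (Fin n)) :
    (b p : BilForm (EuclideanSpace ℝ (Fin n))) X Y
      = pullForm b (extChartAt (𝓡 n) x).symm (extChartAt (𝓡 n) x p)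
        (chartDeriv n x p X) (chartDeriv n x p Y) := by
  have h1 : IsManifold (𝓡 n) 1 M := .of_le one_le_infty
  have key : ∀ q, q = p → ∀ v w v' w' : EuclideanSpace ℝ (Fin n), v = v' → w = w' →
      (b p : BilForm (EuclideanSpace ℝ (Fin n))) v w
        = (b q : BilForm (EuclideanSpace ℝ (Fin n))) v' w' := by
    rintro _ rfl _ _ _ _ rfl rfl; rfl
  have hid := mfderivWithin_extChartAt_symm_comp_mfderiv_extChartAt' (I := 𝓡 n) hp
  rw [ModelWithCorners.range_eq_univ, mfderivWithin_univ] at hid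
  exact key _ ((extChartAt (𝓡 n) x).left_inv hp) _ _ _ _
    (DFunLike.congr_fun hid X).symm (DFunLike.congr_fun hid Y).symm

/-- On a closed manifold, every Riemannian metric is a finite sum `∑ₖ uₖ dvₖ ⊗ dwₖ` with globally
defined smooth functions `uₖ, vₖ, wₖ`. -/
theorem SmoothMetric.exists_eq_sumForm [T2Space M] [CompactSpace M] (g : SmoothMetric n M) :
    ∃ (m : ℕ) (U V W : Fin m → M → ℝ),
      (∀ k, ContMDiff (𝓡 n) 𝓘(ℝ, ℝ) ∞ (U k)) ∧ (∀ k, ContMDiff (𝓡 n) 𝓘(ℝ, ℝ) ∞ (V k)) ∧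
      (∀ k, ContMDiff (𝓡 n) 𝓘(ℝ, ℝ) ∞ (W k)) ∧ g.inner = sumForm U V W := by
  classical
  let f : ∀ x : M, SmoothBumpFunction (𝓡 n) x := fun x => Classical.arbitrary _
  let O : M → Set M := fun x => {p | ∀ᶠ q in 𝓝 p, f x q = 1}
  have hO : ∀ x, IsOpen (O x) := fun x => (f x).isOpen_eventually_one
  obtain ⟨t, ht⟩ := isCompact_univ.elim_finite_subcover O hO
    (fun x _ => mem_iUnion.mpr ⟨x, (f x).eventuallyEq_one⟩)
  obtain ⟨ρ, hρ⟩ := SmoothPartitionOfUnity.exists_isSubordinate (𝓡 n) isClosed_univ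
    (fun x : t => O x) (fun x => hO x) (by simpa [iUnion_subtype] using ht)
  -- the coefficients `g_{ij}`, multiplied with a partition of unity, and the coordinate functions
  -- of the chart at `x`, multiplied with a bump function which is `1` where the former are nonzero
  let U : t × Fin n × Fin n → M → ℝ := fun k p =>
    ρ k.1 p • pullForm g.inner (extChartAt (𝓡 n) (k.1 : M)).symm (extChartAt (𝓡 n) (k.1 : M) p)
      (EuclideanSpace.single k.2.1 1) (EuclideanSpace.single k.2.2 1)
  let V : M → Fin n → M → ℝ := fun x i p => f x p • (extChartAt (𝓡 n) x p) i
  have hU : ∀ k, ContMDiff (𝓡 n) 𝓘(ℝ, ℝ) ∞ (U k) := by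
    intro k
    refine ρ.contMDiff_smul fun p hp => ?_
    have hp' : p ∈ (extChartAt (𝓡 n) (k.1 : M)).source := by
      rw [extChartAt_source]
      exact (f k.1).mem_source_of_eventually_one (hρ k.1 hp)
    have h1 := g.isSmoothForm.contDiffAt_pullForm (isParam_extChartAt_symm (n := n) (k.1 : M)
      ((extChartAt (𝓡 n) (k.1 : M)).map_source hp'))
    have h2 : ContDiffAt ℝ ∞ (fun v => pullForm g.inner (extChartAt (𝓡 n) (k.1 : M)).symm v
      (EuclideanSpace.single k.2.1 1) (EuclideanSpace.single k.2.2 1))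
      (extChartAt (𝓡 n) (k.1 : M) p) :=
      (h1.clm_apply contDiffAt_const).clm_apply contDiffAt_const
    rw [extChartAt_source] at hp'
    exact ContMDiffAt.comp p h2.contMDiffAt (contMDiffAt_extChartAt' (I := 𝓡 n) hp')
  have hV : ∀ x i, ContMDiff (𝓡 n) 𝓘(ℝ, ℝ) ∞ (V x i) := by
    intro x i
    refine (f x).contMDiff_smul fun p hp => ?_
    have h1 : ContMDiffAt (𝓡 n) 𝓘(ℝ, EuclideanSpace ℝ (Fin n)) ∞ (extChartAt (𝓡 n) x) p :=
      contMDiffAt_extChartAt' hp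
    exact (ContMDiffAt.comp p ((EuclideanSpace.proj i : EuclideanSpace ℝ (Fin n) →L[ℝ] ℝ).contDiff
      |>.contMDiff.contMDiffAt) h1).contMDiffWithinAt
  have hdV : ∀ x i p, p ∈ O x → ∀ X : EuclideanSpace ℝ (Fin n),
      differential n (V x i) p X = (chartDeriv n x p X) i := by
    intro x i p hp X
    have h0 : IsManifold (𝓡 n) 1 M := .of_le one_le_infty
    have h1 : V x i =ᶠ[𝓝 p] (EuclideanSpace.proj i : EuclideanSpace ℝ (Fin n) →L[ℝ] ℝ)
        ∘ extChartAt (𝓡 n) x := by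
      filter_upwards [hp] with q hq
      simp [V, hq]
    have h2 := mdifferentiableAt_extChartAt (I := 𝓡 n) ((f x).mem_source_of_eventually_one hp)
    rw [differential, h1.mfderiv_eq, mfderiv_comp p
      ((EuclideanSpace.proj i : EuclideanSpace ℝ (Fin n) →L[ℝ] ℝ).mdifferentiableAt) h2,
      ContinuousLinearMap.mfderiv_eq]
    rfl
  let e := (Fintype.equivFin (t × Fin n × Fin n)).symm
  refine ⟨_, fun k => U (e k), fun k => V (e k).1 (e k).2.1, fun k => V (e k).1 (e k).2.2,
    fun k => hU _, fun k => hV _ _, fun k => hV _ _, ?_⟩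
  funext p
  have key : ∀ X Y : EuclideanSpace ℝ (Fin n),
      (g.inner p : BilForm (EuclideanSpace ℝ (Fin n))) X Y = ∑ k : t × Fin n × Fin n, U k p *
      (differential n (V k.1 k.2.1) p X * differential n (V k.1 k.2.2) p Y) := by
    intro X Y
    have h1 : ∀ x : t, ∑ k : Fin n × Fin n, U (x, k) p *
        (differential n (V x k.1) p X * differential n (V x k.2) p Y)
          = ρ x p * (g.inner p : BilForm (EuclideanSpace ℝ (Fin n))) X Y := by
      intro x
      rcases eq_or_ne (ρ x p) 0 with h0 | h0
      · simp [U, h0]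
      have hp : p ∈ O x := hρ x (subset_tsupport _ h0)
      have hp' : p ∈ (extChartAt (𝓡 n) (x : M)).source := by
        rw [extChartAt_source]
        exact (f x).mem_source_of_eventually_one hp
      rw [apply_eq_pullForm_extChartAt g.inner hp', EuclideanSpace.map_eq_sum (pullForm _ _ _),
        Fintype.sum_prod_type]
      simp only [sum_apply, smul_apply, smul_eq_mul, Finset.mul_sum]
      refine Finset.sum_congr rfl fun i _ => ?_
      rw [EuclideanSpace.map_eq_sum (pullForm _ _ _ _), Finset.mul_sum, Finset.mul_sum]
      refine Finset.sum_congr rfl fun j _ => ?_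
      rw [hdV _ _ _ hp, hdV _ _ _ hp]
      simp only [U, smul_eq_mul]
      ring
    rw [Fintype.sum_prod_type]
    simp only [h1]
    rw [← Finset.sum_mul, ← finsum_eq_sum_of_fintype, ρ.sum_eq_one (mem_univ p), one_mul]
  refine ContinuousLinearMap.ext fun X => ContinuousLinearMap.ext fun Y => ?_
  refine (key X Y).trans ?_
  rw [← e.sum_comp]
  have h2 : ∀ A B : EuclideanSpace ℝ (Fin n),
      (∑ k, U (e k) p • gradForm n (V (e k).1 (e k).2.1) (V (e k).1 (e k).2.2) p) A B
        = ∑ k, U (e k) p * (differential n (V (e k).1 (e k).2.1) p A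
          * differential n (V (e k).1 (e k).2.2) p B) := by
    intro A B
    simp [gradForm, ContinuousLinearMap.smulRight_apply]
  exact (h2 X Y).symm

end Manifold

/-! ### Local diffeomorphisms and parametrizations -/

section LocalDiffeomorph

variable {E H : Type*} [NormedAddCommGroup E] [NormedSpace ℝ E] [TopologicalSpace H]
  {I : ModelWithCorners ℝ E H} {X : Type*} [TopologicalSpace X] [ChartedSpace H X]
  {E' H' : Type*} [NormedAddCommGroup E'] [NormedSpace ℝ E'] [TopologicalSpace H']
  {J : ModelWithCorners ℝ E' H'} {Y : Type*} [TopologicalSpace Y] [ChartedSpace H' Y]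
  {V : Type*} [NormedAddCommGroup V] [NormedSpace ℝ V]
  {V' : Type*} [NormedAddCommGroup V'] [NormedSpace ℝ V']

/-- Smoothness of a function can be checked after composition with a local diffeomorphism. -/
theorem IsLocalDiffeomorphAt.contMDiffAt_of_comp {j : X → Y} {p : X}
    (hj : IsLocalDiffeomorphAt I J ∞ j p) {f : Y → V}
    (hf : ContMDiffAt I 𝓘(ℝ, V) ∞ (f ∘ j) p) : ContMDiffAt J 𝓘(ℝ, V) ∞ f (j p) := by
  have h1 : hj.localInverse (j p) = p := hj.localInverse_eventuallyEq_left.eq_of_nhds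
  have h2 : ContMDiffAt J 𝓘(ℝ, V) ∞ ((f ∘ j) ∘ hj.localInverse) (j p) :=
    ContMDiffAt.comp (j p) (by rwa [h1]) hj.localInverse_contMDiffAt
  refine h2.congr_of_eventuallyEq ?_
  filter_upwards [hj.localInverse_eventuallyEq_right] with y hy
  exact (congrArg f hy).symm

/-- Extension by zero of a compactly supported smooth function along an injective local
diffeomorphism. -/
theorem contMDiff_extend_zero [T2Space Y] {j : X → Y} (hj : Injective j)
    (hl : IsLocalDiffeomorph I J ∞ j) {f : X → V} (hf : ContMDiff I 𝓘(ℝ, V) ∞ f) {K : Set X}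
    (hK : IsCompact K) (h0 : ∀ p ∉ K, f p = 0) :
    ContMDiff J 𝓘(ℝ, V) ∞ (extend j f 0) := by
  intro q
  by_cases hq : q ∈ range j
  · obtain ⟨p, rfl⟩ := hq
    refine (hl p).contMDiffAt_of_comp ?_
    rw [extend_comp hj]
    exact hf p
  · have h1 : IsOpen (j '' K)ᶜ := (hK.image hl.contMDiff.continuous).isClosed.isOpen_compl
    have h2 : q ∈ (j '' K)ᶜ := fun ⟨p, _, hp⟩ => hq ⟨p, hp⟩
    refine ContMDiffAt.congr_of_eventuallyEq (f := fun _ => (0 : V)) contMDiffAt_const ?_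
    filter_upwards [h1.mem_nhds h2] with y hy
    by_cases hy' : y ∈ range j
    · obtain ⟨p, rfl⟩ := hy'
      rw [hj.extend_apply]
      exact h0 p fun hp => hy ⟨p, hp, rfl⟩
    · rw [extend_apply' _ _ _ hy']
      rfl

/-- Near `u`, the map `χ` from a vector space to a manifold, possibly with boundary, is a
diffeomorphism onto an open set, with inverse `φ`. -/
structure IsLocalParam (I : ModelWithCorners ℝ E H) (χ : V → X) (φ : X → V) (u : V) : Prop where
  contMDiffAt : ContMDiffAt 𝓘(ℝ, V) I ∞ χ u
  contMDiffAt_inv : ContMDiffAt I 𝓘(ℝ, V) ∞ φ (χ u)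
  left_inv : ∀ᶠ v in 𝓝 u, φ (χ v) = v
  right_inv : ∀ᶠ x in 𝓝 (χ u), χ (φ x) = x

theorem isLocalParam_id (u : V) : IsLocalParam 𝓘(ℝ, V) id id u where
  contMDiffAt := contMDiffAt_id
  contMDiffAt_inv := contMDiffAt_id
  left_inv := .of_forall fun _ => rfl
  right_inv := .of_forall fun _ => rfl

theorem IsLocalParam.prod {χ : V → X} {φ : X → V} {u : V} (h : IsLocalParam I χ φ u)
    {χ' : V' → Y} {φ' : Y → V'} {u' : V'} (h' : IsLocalParam J χ' φ' u') :
    IsLocalParam (I.prod J) (fun v : V × V' => (χ v.1, χ' v.2)) (fun p : X × Y => (φ p.1, φ' p.2))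
      (u, u') where
  contMDiffAt := by
    have h1 : ContMDiffAt 𝓘(ℝ, V × V') 𝓘(ℝ, V) ∞ (Prod.fst : V × V' → V) (u, u') :=
      contDiffAt_fst.contMDiffAt
    have h2 : ContMDiffAt 𝓘(ℝ, V × V') 𝓘(ℝ, V') ∞ (Prod.snd : V × V' → V') (u, u') :=
      contDiffAt_snd.contMDiffAt
    exact (ContMDiffAt.comp (u, u') h.contMDiffAt h1).prodMk
      (ContMDiffAt.comp (u, u') h'.contMDiffAt h2)
  contMDiffAt_inv := ContMDiffAt.prodMk_space
    (ContMDiffAt.comp (χ u, χ' u') h.contMDiffAt_inv contMDiffAt_fst)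
    (ContMDiffAt.comp (χ u, χ' u') h'.contMDiffAt_inv contMDiffAt_snd)
  left_inv := by
    rw [nhds_prod_eq]
    filter_upwards [h.left_inv.prod_mk h'.left_inv] with v hv using Prod.ext hv.1 hv.2
  right_inv := by
    rw [nhds_prod_eq]
    filter_upwards [h.right_inv.prod_mk h'.right_inv] with v hv using Prod.ext hv.1 hv.2

theorem IsLocalParam.comp_localDiffeomorph {χ : V → X} {φ : X → V} {u : V}
    (h : IsLocalParam I χ φ u) {j : X → Y} (hj : IsLocalDiffeomorphAt I J ∞ j (χ u)) :
    IsLocalParam J (j ∘ χ) (φ ∘ hj.localInverse) u where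
  contMDiffAt := hj.contMDiffAt.comp u h.contMDiffAt
  contMDiffAt_inv := by
    have h1 : hj.localInverse (j (χ u)) = χ u := hj.localInverse_eventuallyEq_left.eq_of_nhds
    exact ContMDiffAt.comp (j (χ u)) (by rw [h1]; exact h.contMDiffAt_inv)
      hj.localInverse_contMDiffAt
  left_inv := by
    filter_upwards [h.left_inv,
      h.contMDiffAt.continuousAt.eventually hj.localInverse_eventuallyEq_left] with v h1 h2
    have h3 : hj.localInverse (j (χ v)) = χ v := h2
    simp [h3, h1]
  right_inv := by
    have h1 : hj.localInverse (j (χ u)) = χ u := hj.localInverse_eventuallyEq_left.eq_of_nhds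
    have h2 : ∀ᶠ y in 𝓝 (j (χ u)), χ (φ (hj.localInverse y)) = hj.localInverse y :=
      hj.localInverse_contMDiffAt.continuousAt.eventually (by rw [h1]; exact h.right_inv)
    filter_upwards [h2, hj.localInverse_eventuallyEq_right] with y h3 h4
    have h5 : j (hj.localInverse y) = y := h4
    simp [h3, h5]

/-- Around interior points, inverse charts are parametrizations by the model vector space. -/
theorem isLocalParam_extChartAt_symm [IsManifold I ∞ X] {x₀ x : X}
    (hx : x ∈ (chartAt H x₀).source) (hi : I.IsInteriorPoint x) :
    IsLocalParam I (extChartAt I x₀).symm (extChartAt I x₀) (extChartAt I x₀ x) := by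
  have : IsManifold I 1 X := .of_le one_le_infty
  have hx' : x ∈ (extChartAt I x₀).source := by rwa [extChartAt_source]
  have hli := (extChartAt I x₀).left_inv hx'
  have ht : (extChartAt I x₀).target ∈ 𝓝 (extChartAt I x₀ x) := mem_interior_iff_mem_nhds.mp
    ((I.isInteriorPoint_iff_of_mem_atlas one_ne_zero (chart_mem_atlas H x₀) hx).mp hi)
  constructor
  · exact (contMDiffOn_extChartAt_symm x₀).contMDiffAt ht
  · rw [hli]
    exact contMDiffAt_extChartAt' hx
  · filter_upwards [ht] with v hv using (extChartAt I x₀).right_inv hv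
  · rw [hli]
    filter_upwards [extChartAt_source_mem_nhds' hx'] with y hy using (extChartAt I x₀).left_inv hy

theorem IsLocalParam.isParam {n : ℕ} {M : Type*} [TopologicalSpace M]
    [ChartedSpace (EuclideanSpace ℝ (Fin n)) M] {ψ : V → M} {φ : M → V} {u : V}
    (h : IsLocalParam (𝓡 n) ψ φ u) : IsParam n ψ u where
  contMDiffAt := h.contMDiffAt
  invertible := by
    have h1 := h.contMDiffAt.mdifferentiableAt (by simp)
    have h2 := h.contMDiffAt_inv.mdifferentiableAt (by simp)
    have h3 : φ (ψ u) = u := h.left_inv.self_of_nhds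
    have h4 : (φ ∘ ψ) =ᶠ[𝓝 u] id := h.left_inv
    have h5 : (ψ ∘ φ) =ᶠ[𝓝 (ψ u)] id := h.right_inv
    let B : EuclideanSpace ℝ (Fin n) →L[ℝ] V := mfderiv (𝓡 n) 𝓘(ℝ, V) φ (ψ u)
    have h6 : B ∘L paramDeriv n ψ u = ContinuousLinearMap.id ℝ V := by
      have := mfderiv_comp u h2 h1
      rw [h4.mfderiv_eq, mfderiv_id] at this
      exact this.symm
    have h7 : paramDeriv n ψ u ∘L B = ContinuousLinearMap.id ℝ (EuclideanSpace ℝ (Fin n)) := by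
      have h1' : MDifferentiableAt 𝓘(ℝ, V) (𝓡 n) ψ (φ (ψ u)) := by rwa [h3]
      have := mfderiv_comp (ψ u) h1' h2
      rw [h5.mfderiv_eq, mfderiv_id] at this
      have h8 : ∀ v, v = u → paramDeriv n ψ v ∘L B = paramDeriv n ψ u ∘L B := by
        rintro _ rfl; rfl
      exact (h8 _ h3).symm.trans this.symm
    exact ContinuousLinearMap.IsInvertible.of_inverse h7 h6

end LocalDiffeomorph

/-! ### The half-line -/

/-- The coordinate on the half-line. -/
def halfLineCoord (z : EuclideanHalfSpace 1) : ℝ := z.1 0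

theorem halfLineCoord_nonneg (z : EuclideanHalfSpace 1) : 0 ≤ halfLineCoord z := z.2

theorem halfLineCoord_halfLinePoint {s : ℝ} (hs : 0 ≤ s) : halfLineCoord (halfLinePoint s) = s := by
  simp [halfLineCoord, halfLinePoint, hs]

theorem halfLinePoint_halfLineCoord (z : EuclideanHalfSpace 1) :
    halfLinePoint (halfLineCoord z) = z := by
  apply Subtype.ext
  ext i
  fin_cases i
  have := halfLineCoord_nonneg z
  simp only [halfLineCoord] at this
  simp [halfLineCoord, halfLinePoint, this]

theorem contMDiff_halfLineCoord : ContMDiff (𝓡∂ 1) 𝓘(ℝ, ℝ) ∞ halfLineCoord :=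
  ((EuclideanSpace.proj 0 : EuclideanSpace ℝ (Fin 1) →L[ℝ] ℝ).contDiff.contMDiff).comp
    (ModelWithCorners.contMDiff (𝓡∂ 1))

theorem continuous_halfLinePoint : Continuous halfLinePoint := by
  refine Continuous.subtype_mk ?_ _
  have : Continuous fun t : ℝ => max t 0 • EuclideanSpace.single (0 : Fin 1) (1 : ℝ) := by fun_prop
  refine this.congr fun t => ?_
  ext i
  simp

theorem isCompact_halfLineCoord_le (r : ℝ) : IsCompact {z | halfLineCoord z ≤ r} := by
  have h : {z | halfLineCoord z ≤ r} ⊆ halfLinePoint '' Icc 0 r := fun z hz =>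
    ⟨_, ⟨halfLineCoord_nonneg z, hz⟩, halfLinePoint_halfLineCoord z⟩
  exact (isCompact_Icc.image continuous_halfLinePoint).of_isClosed_subset
    (isClosed_le contMDiff_halfLineCoord.continuous continuous_const) h

/-! ### Collared fillings -/

section Filling

variable {n : ℕ} {M W : Type*}

/-- The part of `W` that lies at depth at least `r` with respect to a collar `c`: the complement of
`c (M × [0, r))`. -/
def collarCore (c : M × EuclideanHalfSpace 1 → W) (r : ℝ) : Set W :=
  (c '' {p | halfLineCoord p.2 < r})ᶜ

theorem apply_mem_collarCore {c : M × EuclideanHalfSpace 1 → W} (hc : Injective c) {r s : ℝ} {x : M}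
    (hs : 0 ≤ s) : c (x, halfLinePoint s) ∈ collarCore c r ↔ r ≤ s := by
  rw [collarCore, mem_compl_iff, hc.mem_set_image, mem_ofPred_eq, halfLineCoord_halfLinePoint hs,
    not_lt]

theorem notMem_collarCore {c : M × EuclideanHalfSpace 1 → W} {r : ℝ} {w : W} :
    w ∉ collarCore c r ↔ ∃ x s, 0 ≤ s ∧ s < r ∧ c (x, halfLinePoint s) = w := by
  rw [collarCore, notMem_compl_iff]
  constructor
  · rintro ⟨⟨x, z⟩, hz, rfl⟩
    exact ⟨x, _, halfLineCoord_nonneg z, hz, by rw [halfLinePoint_halfLineCoord]⟩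
  · rintro ⟨x, s, hs, hr, rfl⟩
    exact ⟨_, by rwa [mem_ofPred_eq, halfLineCoord_halfLinePoint hs], rfl⟩

variable [TopologicalSpace M] [ChartedSpace (EuclideanSpace ℝ (Fin n)) M]
  [TopologicalSpace W] [ChartedSpace (EuclideanHalfSpace (n + 1)) W]

theorem isClosed_collarCore {c : M × EuclideanHalfSpace 1 → W}
    (hc : IsLocalDiffeomorph ((𝓡 n).prod (𝓡∂ 1)) (𝓡∂ (n + 1)) ∞ c) (r : ℝ) :
    IsClosed (collarCore c r) :=
  (hc.isOpenMap _ (isOpen_lt (contMDiff_halfLineCoord.continuous.comp continuous_snd)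
    continuous_const)).isClosed_compl

theorem isCompact_collar_le [CompactSpace M] (r : ℝ) :
    IsCompact {p : M × EuclideanHalfSpace 1 | halfLineCoord p.2 ≤ r} := by
  have := isCompact_univ (X := M) |>.prod (isCompact_halfLineCoord_le r)
  rwa [univ_prod] at this

theorem collarCore_mem_nhds [CompactSpace M] [T2Space W] {c : M × EuclideanHalfSpace 1 → W}
    (hc : IsLocalDiffeomorph ((𝓡 n).prod (𝓡∂ 1)) (𝓡∂ (n + 1)) ∞ c) {r r' : ℝ}
    (h : r < r') {w : W} (hw : w ∈ collarCore c r') :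
    (c '' {p | halfLineCoord p.2 ≤ r})ᶜ ∈ 𝓝 w := by
  refine ((isCompact_collar_le r).image hc.contMDiff.continuous).isClosed.isOpen_compl.mem_nhds ?_
  rintro ⟨p, hp, rfl⟩
  exact hw ⟨p, lt_of_le_of_lt hp h, rfl⟩

/-- A collared null bordism of a manifold with a metric, with auxiliary functions: a manifold `W`
with boundary `M` and a collar, a metric `∑ₖ uₖ dvₖ ⊗ dwₖ` on `M`, and finitely many smooth
functions on `W` that vanish at depth at most `4` and whose differentials span the cotangent
space at every point of depth at least `5`. -/
structure CollaredFilling [IsManifold (𝓡 n) ∞ M] (g : SmoothMetric n M) (W : Type*)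
    [TopologicalSpace W] [ChartedSpace (EuclideanHalfSpace (n + 1)) W] where
  /-- the collar of `M` in `W` -/
  collar : M × EuclideanHalfSpace 1 → W
  injective : Injective collar
  isLocalDiffeomorph : IsLocalDiffeomorph ((𝓡 n).prod (𝓡∂ 1)) (𝓡∂ (n + 1)) ∞ collar
  isInteriorPoint_iff : ∀ w, (𝓡∂ (n + 1)).IsInteriorPoint w ↔
    ∀ x, collar (x, halfLinePoint 0) ≠ w
  /-- the number of terms of the metric on `M` -/
  size : ℕ
  /-- the coefficients `uₖ` of the metric on `M` -/
  coef : Fin size → M → ℝ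
  /-- the functions `vₖ` in the metric on `M` -/
  pot : Fin size → M → ℝ
  /-- the functions `wₖ` in the metric on `M` -/
  pot' : Fin size → M → ℝ
  contMDiff_coef : ∀ k, ContMDiff (𝓡 n) 𝓘(ℝ, ℝ) ∞ (coef k)
  contMDiff_pot : ∀ k, ContMDiff (𝓡 n) 𝓘(ℝ, ℝ) ∞ (pot k)
  contMDiff_pot' : ∀ k, ContMDiff (𝓡 n) 𝓘(ℝ, ℝ) ∞ (pot' k)
  inner_eq : g.inner = sumForm coef pot pot'
  /-- the number of auxiliary functions -/
  count : ℕ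
  /-- the auxiliary functions -/
  aux : Fin count → W → ℝ
  contMDiff_aux : ∀ k, ContMDiff (𝓡∂ (n + 1)) 𝓘(ℝ, ℝ) ∞ (aux k)
  aux_eq_zero : ∀ k x s, 0 ≤ s → s ≤ 4 → aux k (collar (x, halfLinePoint s)) = 0
  immersive : ∀ w ∈ collarCore collar 5, ∃ w₀,
    w ∈ (chartAt (EuclideanHalfSpace (n + 1)) w₀).source ∧
    ∀ X, (∀ k, fderiv ℝ (aux k ∘ (extChartAt (𝓡∂ (n + 1)) w₀).symm)
      (extChartAt (𝓡∂ (n + 1)) w₀ w) X = 0) → X = 0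

/-- There are finitely many functions on `W` that vanish near the boundary and whose differentials
span the cotangent spaces away from it: cut-off coordinate functions of finitely many charts. -/
theorem exists_aux [CompactSpace M] [T2Space W] [CompactSpace W] [IsManifold (𝓡∂ (n + 1)) ∞ W]
    {c : M × EuclideanHalfSpace 1 → W}
    (hc : IsLocalDiffeomorph ((𝓡 n).prod (𝓡∂ 1)) (𝓡∂ (n + 1)) ∞ c)
    (hint : ∀ w ∈ collarCore c 5, (𝓡∂ (n + 1)).IsInteriorPoint w) :
    ∃ (m : ℕ) (f : Fin m → W → ℝ), (∀ k, ContMDiff (𝓡∂ (n + 1)) 𝓘(ℝ, ℝ) ∞ (f k)) ∧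
      (∀ k x s, 0 ≤ s → s ≤ 4 → f k (c (x, halfLinePoint s)) = 0) ∧
      ∀ w ∈ collarCore c 5, ∃ w₀, w ∈ (chartAt (EuclideanHalfSpace (n + 1)) w₀).source ∧
        ∀ X, (∀ k, fderiv ℝ (f k ∘ (extChartAt (𝓡∂ (n + 1)) w₀).symm)
          (extChartAt (𝓡∂ (n + 1)) w₀ w) X = 0) → X = 0 := by
  have hb : ∀ w : W, ∃ f : SmoothBumpFunction (𝓡∂ (n + 1)) w,
      w ∈ collarCore c 5 → tsupport f ⊆ (c '' {p | halfLineCoord p.2 ≤ 4})ᶜ := by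
    intro w
    by_cases hw : w ∈ collarCore c 5
    · obtain ⟨f, -, hf⟩ := (SmoothBumpFunction.nhds_basis_tsupport (I := 𝓡∂ (n + 1)) w).mem_iff.mp
        (collarCore_mem_nhds hc (by norm_num : (4 : ℝ) < 5) hw)
      exact ⟨f, fun _ => hf⟩
    · exact ⟨Classical.arbitrary _, fun h => absurd h hw⟩
  choose f hf using hb
  obtain ⟨t, ht⟩ := (isClosed_collarCore hc 5).isCompact.elim_nhds_subcover'
    (fun w _ => {p | ∀ᶠ q in 𝓝 p, f w q = 1})
    (fun w _ => (f w).isOpen_eventually_one.mem_nhds (f w).eventuallyEq_one)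
  let F : t × Fin (n + 1) → W → ℝ := fun k q =>
    f (k.1 : collarCore c 5) q • (extChartAt (𝓡∂ (n + 1)) ((k.1 : collarCore c 5) : W) q) k.2
  let e := (Fintype.equivFin (t × Fin (n + 1))).symm
  refine ⟨_, fun k => F (e k), fun k => ?_, fun k x s hs hs4 => ?_, fun w hw => ?_⟩
  · refine (f _).contMDiff_smul fun p hp => ?_
    have h1 : ContMDiffAt (𝓡∂ (n + 1)) 𝓘(ℝ, EuclideanSpace ℝ (Fin (n + 1))) ∞
        (extChartAt (𝓡∂ (n + 1)) (((e k).1 : collarCore c 5) : W)) p := contMDiffAt_extChartAt' hp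
    exact (ContMDiffAt.comp p ((EuclideanSpace.proj (e k).2 : EuclideanSpace ℝ (Fin (n + 1)) →L[ℝ] ℝ
      ).contDiff.contMDiff.contMDiffAt) h1).contMDiffWithinAt
  · have h1 : f ((e k).1 : collarCore c 5) (c (x, halfLinePoint s)) = 0 := by
      refine image_eq_zero_of_notMem_tsupport fun h => hf _ (e k).1.1.2 h ⟨_, ?_, rfl⟩
      rwa [mem_ofPred_eq, halfLineCoord_halfLinePoint hs]
    simp [F, h1]
  · obtain ⟨w₀, hw₀, hw1⟩ := mem_iUnion₂.mp (ht hw)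
    have hs := (f w₀).mem_source_of_eventually_one hw1
    refine ⟨w₀, hs, fun X hX => ?_⟩
    have hp := isLocalParam_extChartAt_symm hs (hint w hw)
    ext i
    have h2 := hX (e.symm (⟨w₀, hw₀⟩, i))
    simp only [Equiv.apply_symm_apply] at h2
    have h3 : F (⟨w₀, hw₀⟩, i) ∘ (extChartAt (𝓡∂ (n + 1)) (w₀ : W)).symm
        =ᶠ[𝓝 (extChartAt (𝓡∂ (n + 1)) (w₀ : W) w)]
        (EuclideanSpace.proj i : EuclideanSpace ℝ (Fin (n + 1)) →L[ℝ] ℝ) := by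
      have h4 := hp.contMDiffAt.continuousAt
      rw [ContinuousAt, (extChartAt (𝓡∂ (n + 1)) (w₀ : W)).left_inv
        (by rwa [extChartAt_source])] at h4
      filter_upwards [hp.left_inv, h4.eventually hw1] with v hv hv1
      simp only [F, comp_apply, hv, hv1, one_smul]
      rfl
    rw [h3.fderiv_eq, ContinuousLinearMap.fderiv] at h2
    exact h2

/-- Every collar of a closed manifold with a metric in a compact manifold with boundary belongs to
a collared filling. -/
theorem exists_collaredFilling [T2Space M] [CompactSpace M] [IsManifold (𝓡 n) ∞ M] [T2Space W]
    [CompactSpace W] [IsManifold (𝓡∂ (n + 1)) ∞ W] (g : SmoothMetric n M) {ι : M → W}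
    {c : M × EuclideanHalfSpace 1 → W} (hι : IsBoundaryInclusion n ι) (hc : IsCollar n ι c) :
    ∃ F : CollaredFilling g W, F.collar = c := by
  have hint : ∀ w, (𝓡∂ (n + 1)).IsInteriorPoint w ↔ ∀ x, c (x, halfLinePoint 0) ≠ w := by
    intro w
    rw [ModelWithCorners.isInteriorPoint_iff_not_isBoundaryPoint]
    change w ∉ (𝓡∂ (n + 1)).boundary W ↔ _
    simp [← hι.range_eq, hc.apply_zero]
  obtain ⟨m, U, V, V', hU, hV, hV', hg⟩ := g.exists_eq_sumForm
  obtain ⟨r, f, hf, hf0, hfi⟩ := exists_aux hc.isLocalDiffeomorph fun w hw =>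
    (hint w).mpr fun x hx => hw ⟨_, by
      rw [mem_ofPred_eq, halfLineCoord_halfLinePoint le_rfl]; norm_num, hx⟩
  exact ⟨⟨c, hc.injective, hc.isLocalDiffeomorph, hint, m, U, V, V', hU, hV, hV', hg, r, f, hf, hf0,
    hfi⟩, rfl⟩

end Filling

/-! ### Profile functions -/

open Real (smoothTransition)

theorem contDiff_smoothTransition_comp {f : ℝ → ℝ} (hf : ContDiff ℝ ∞ f) :
    ContDiff ℝ ∞ fun t => smoothTransition (f t) :=
  (Real.smoothTransition.contDiff (n := ⊤)).comp hf

/-- A cut-off that vanishes for `t ≤ -8` and is `1` for `t ≥ -7`. -/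
def cutProfile (t : ℝ) : ℝ := smoothTransition (t + 8)

/-- A cut-off that vanishes for `t ≤ -6` and is `1` for `t ≥ -5`. -/
def deepProfile (t : ℝ) : ℝ := smoothTransition (t + 6)

/-- The factor of the metric of the first boundary along the neck: it is a constant `l` for
`-5 ≤ t ≤ -2`, vanishes for `t ≤ -6`, and is `1` for `t ≥ -1`. -/
def scaleProfile (l t : ℝ) : ℝ :=
  l * (smoothTransition (t + 6) * (1 - smoothTransition (t + 2))) + smoothTransition (t + 2)

/-- The factor of `dt²` along the neck: it is `N` for `|t| ≤ 3`, and for `t ≤ -7/2` and `t ≥ 7/2` it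
agrees with the factors of the metrics of the two boundaries, which are constants `l` and `m` until
they are cut off. -/
def neckProfile (l N m t : ℝ) : ℝ :=
  l * (smoothTransition (t + 6) * (1 - smoothTransition (2 * t + 7)))
    + N * (smoothTransition (2 * t + 7) * smoothTransition (7 - 2 * t))
    + m * (smoothTransition (6 - t) * (1 - smoothTransition (7 - 2 * t)))

/-- The coordinate `t`, cut off outside of the neck. -/
def neckCoord (t : ℝ) : ℝ := t * (cutProfile t * cutProfile (-t))

theorem contDiff_cutProfile : ContDiff ℝ ∞ cutProfile :=
  contDiff_smoothTransition_comp (by fun_prop)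

theorem contDiff_deepProfile : ContDiff ℝ ∞ deepProfile :=
  contDiff_smoothTransition_comp (by fun_prop)

theorem contDiff_scaleProfile (l : ℝ) : ContDiff ℝ ∞ (scaleProfile l) := by
  have h1 : ContDiff ℝ ∞ fun t : ℝ => smoothTransition (t + 6) :=
    contDiff_smoothTransition_comp (by fun_prop)
  have h2 : ContDiff ℝ ∞ fun t : ℝ => smoothTransition (t + 2) :=
    contDiff_smoothTransition_comp (by fun_prop)
  exact (contDiff_const.mul (h1.mul (contDiff_const.sub h2))).add h2

theorem contDiff_neckProfile (l N m : ℝ) : ContDiff ℝ ∞ (neckProfile l N m) := by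
  have h1 : ContDiff ℝ ∞ fun t : ℝ => smoothTransition (t + 6) :=
    contDiff_smoothTransition_comp (by fun_prop)
  have h2 : ContDiff ℝ ∞ fun t : ℝ => smoothTransition (2 * t + 7) :=
    contDiff_smoothTransition_comp (by fun_prop)
  have h3 : ContDiff ℝ ∞ fun t : ℝ => smoothTransition (7 - 2 * t) :=
    contDiff_smoothTransition_comp (by fun_prop)
  have h4 : ContDiff ℝ ∞ fun t : ℝ => smoothTransition (6 - t) :=
    contDiff_smoothTransition_comp (by fun_prop)
  exact ((contDiff_const.mul (h1.mul (contDiff_const.sub h2))).add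
    (contDiff_const.mul (h2.mul h3))).add (contDiff_const.mul (h4.mul (contDiff_const.sub h3)))

theorem contDiff_neckCoord : ContDiff ℝ ∞ neckCoord :=
  contDiff_id.mul (contDiff_cutProfile.mul (contDiff_cutProfile.comp contDiff_neg))

theorem cutProfile_eq_one {t : ℝ} (ht : -7 ≤ t) : cutProfile t = 1 :=
  smoothTransition.one_of_one_le (by linarith)

theorem cutProfile_eq_zero {t : ℝ} (ht : t ≤ -8) : cutProfile t = 0 :=
  smoothTransition.zero_of_nonpos (by linarith)

theorem deepProfile_eq_zero {t : ℝ} (ht : t ≤ -6) : deepProfile t = 0 :=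
  smoothTransition.zero_of_nonpos (by linarith)

theorem scaleProfile_eq_one (l : ℝ) {t : ℝ} (ht : -1 ≤ t) : scaleProfile l t = 1 := by
  simp [scaleProfile, smoothTransition.one_of_one_le (by linarith : 1 ≤ t + 2)]

theorem scaleProfile_eq_mul (l : ℝ) {t : ℝ} (ht : t ≤ -2) :
    scaleProfile l t = l * deepProfile t := by
  simp [scaleProfile, deepProfile, smoothTransition.zero_of_nonpos (by linarith : t + 2 ≤ 0)]

theorem scaleProfile_eq_zero (l : ℝ) {t : ℝ} (ht : t ≤ -6) : scaleProfile l t = 0 := by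
  rw [scaleProfile_eq_mul l (by linarith), deepProfile_eq_zero ht, mul_zero]

theorem scaleProfile_pos {l : ℝ} (hl : 0 < l) {t : ℝ} (ht : -6 < t) : 0 < scaleProfile l t := by
  have h1 : 0 < smoothTransition (t + 6) := smoothTransition.pos_of_pos (by linarith)
  have h2 := smoothTransition.nonneg (t + 2)
  rcases (smoothTransition.le_one (t + 2)).lt_or_eq with h3 | h3
  · have := mul_pos hl (mul_pos h1 (sub_pos.mpr h3))
    rw [scaleProfile]
    linarith
  · simp [scaleProfile, h3]

theorem neckProfile_neg (l N m t : ℝ) : neckProfile l N m (-t) = neckProfile m N l t := by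
  have e1 : -t + 6 = 6 - t := by ring
  have e2 : 2 * -t + 7 = 7 - 2 * t := by ring
  have e3 : 7 - 2 * -t = 2 * t + 7 := by ring
  have e4 : 6 - -t = t + 6 := by ring
  rw [neckProfile, neckProfile, e1, e2, e3, e4]
  ring

theorem neckProfile_eq_mul (l N m : ℝ) {t : ℝ} (ht : t ≤ -(7 / 2)) :
    neckProfile l N m t = l * deepProfile t := by
  simp [neckProfile, deepProfile, smoothTransition.zero_of_nonpos (by linarith : 2 * t + 7 ≤ 0),
    smoothTransition.one_of_one_le (by linarith : 1 ≤ 7 - 2 * t)]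

theorem neckProfile_eq_const (l N m : ℝ) {t : ℝ} (ht : -3 ≤ t) (ht' : t ≤ 3) :
    neckProfile l N m t = N := by
  simp [neckProfile, smoothTransition.one_of_one_le (by linarith : 1 ≤ 2 * t + 7),
    smoothTransition.one_of_one_le (by linarith : 1 ≤ 7 - 2 * t)]

theorem neckProfile_eq_zero (l N m : ℝ) {t : ℝ} (ht : 6 ≤ |t|) : neckProfile l N m t = 0 := by
  rcases le_abs.mp ht with h | h
  · rw [← neg_neg t, neckProfile_neg, neckProfile_eq_mul _ _ _ (by linarith),
      deepProfile_eq_zero (by linarith), mul_zero]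
  · rw [neckProfile_eq_mul _ _ _ (by linarith), deepProfile_eq_zero (by linarith), mul_zero]

theorem neckProfile_pos {l N m : ℝ} (hl : 0 < l) (hN : 0 < N) (hm : 0 < m) {t : ℝ} (ht : |t| < 6) :
    0 < neckProfile l N m t := by
  rw [abs_lt] at ht
  have h1 : 0 < smoothTransition (t + 6) := smoothTransition.pos_of_pos (by linarith)
  have h2 : 0 < smoothTransition (6 - t) := smoothTransition.pos_of_pos (by linarith)
  have h3 := smoothTransition.nonneg (2 * t + 7)
  have h4 := smoothTransition.nonneg (7 - 2 * t)
  have h5 : 0 ≤ 1 - smoothTransition (2 * t + 7) := sub_nonneg.mpr (smoothTransition.le_one _)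
  have h6 : 0 ≤ 1 - smoothTransition (7 - 2 * t) := sub_nonneg.mpr (smoothTransition.le_one _)
  have k1 := mul_nonneg hl.le (mul_nonneg h1.le h5)
  have k2 := mul_nonneg hN.le (mul_nonneg h3 h4)
  have k3 := mul_nonneg hm.le (mul_nonneg h2.le h6)
  rw [neckProfile]
  rcases h5.eq_or_lt with h | h
  · rcases h6.eq_or_lt with h' | h'
    · have e1 : smoothTransition (2 * t + 7) = 1 := by linarith
      have e2 : smoothTransition (7 - 2 * t) = 1 := by linarith
      rw [e1, e2] at k2 ⊢
      linarith
    · have := mul_pos hm (mul_pos h2 h')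
      linarith
  · have := mul_pos hl (mul_pos h1 h)
    linarith

theorem neckCoord_eq {t : ℝ} (ht : |t| ≤ 7) : neckCoord t = t := by
  rw [abs_le] at ht
  rw [neckCoord, cutProfile_eq_one (by linarith), cutProfile_eq_one (by linarith), mul_one, mul_one]

theorem neckCoord_eq_zero {t : ℝ} (ht : 8 ≤ |t|) : neckCoord t = 0 := by
  rcases le_abs.mp ht with h | h
  · rw [neckCoord, cutProfile_eq_zero (t := -t) (by linarith), mul_zero, mul_zero]
  · rw [neckCoord, cutProfile_eq_zero (t := t) (by linarith), zero_mul, mul_zero]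

theorem neckCoord_neg (t : ℝ) : neckCoord (-t) = -neckCoord t := by
  rw [neckCoord, neckCoord, neg_neg]
  ring

theorem eventually_deriv_scaleProfile_eq_zero (l : ℝ) {t : ℝ} (ht : -5 < t) (ht' : t < -2) :
    ∀ᶠ s in 𝓝 t, deriv (scaleProfile l) s = 0 := by
  filter_upwards [Ioo_mem_nhds ht ht'] with s hs
  have h1 : scaleProfile l =ᶠ[𝓝 s] fun _ => l := by
    filter_upwards [Ioo_mem_nhds hs.1 hs.2] with r hr
    rw [scaleProfile_eq_mul l hr.2.le, deepProfile,
      smoothTransition.one_of_one_le (by linarith [hr.1]), mul_one]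
  rw [h1.deriv_eq, deriv_const]

/-- In the left half of the neck, the contribution of the warping to the scalar curvature is of
order `1 / N`: the factor of `dt²` is the constant `N` wherever the factor of the first boundary is
not constant. -/
theorem exists_warpTerm_bound (n : ℝ) {l : ℝ} (hl : 0 < l) : ∃ Q, ∀ N > 0, ∀ m t,
    -4 ≤ t → t ≤ 0 → -(N⁻¹ * Q) ≤ warpTerm n (scaleProfile l) (neckProfile l N m) t := by
  have hA := contDiff_scaleProfile l
  have hA' : ContDiff ℝ ∞ (deriv (scaleProfile l)) :=
    contDiff_iff_contDiffAt.mpr fun t => (hA.contDiffAt (x := t)).deriv_infty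
  have hc : ContinuousOn (warpTerm n (scaleProfile l) fun _ => 1) (Icc (-4) 0) := by
    intro t ht
    have h0 : scaleProfile l t ≠ 0 := (scaleProfile_pos hl (by linarith [ht.1])).ne'
    have h2 : ContDiffAt ℝ ∞ (fun s => deriv (scaleProfile l) s / (2 * (1 : ℝ))) t :=
      hA'.contDiffAt.div_const _
    have h3 : ContDiffAt ℝ ∞ (fun s => deriv (scaleProfile l) s / (2 * scaleProfile l s)) t :=
      hA'.contDiffAt.div (contDiffAt_const.mul hA.contDiffAt) (mul_ne_zero two_ne_zero h0)
    have e1 := hA.continuous.continuousAt (x := t)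
    have e2 := hA'.continuous.continuousAt (x := t)
    have e3 := h2.deriv_infty.continuousAt
    have e4 := h3.deriv_infty.continuousAt
    have e5 := h3.continuousAt
    have e6 := h2.continuousAt
    refine ContinuousAt.continuousWithinAt ?_
    unfold warpTerm
    simp only [deriv_const]
    exact continuousAt_const.mul (((e1.inv₀ h0).mul (((continuousAt_const.mul e5).mul e6).sub e3
      |>.sub (continuousAt_const.mul e6))).add (continuousAt_const.mul
      ((e4.neg.add (e5.mul continuousAt_const)).sub (e5.pow 2))))
  obtain ⟨Q, hQ⟩ := isCompact_Icc.exists_bound_of_continuousOn hc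
  refine ⟨Q, fun N hN m t ht ht' => ?_⟩
  have hQ0 : 0 ≤ Q := (norm_nonneg _).trans (hQ t ⟨ht, ht'⟩)
  rcases lt_or_ge t (-2) with h | h
  -- for `t < -2` the factor of the first boundary is constant
  · rw [warpTerm_eq_zero (eventually_deriv_scaleProfile_eq_zero l (by linarith) h)]
    exact neg_nonpos.mpr (mul_nonneg (inv_nonneg.mpr hN.le) hQ0)
  · have h1 : neckProfile l N m =ᶠ[𝓝 t] fun _ => N := by
      filter_upwards [Ioo_mem_nhds (by linarith : -3 < t) (by linarith : t < 3)] with s hs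
      exact neckProfile_eq_const l N m hs.1.le hs.2.le
    rw [warpTerm_of_eventually_const h1, ← mul_neg]
    exact mul_le_mul_of_nonneg_left (neg_le_of_abs_le (hQ t ⟨ht, ht'⟩)) (inv_nonneg.mpr hN.le)

/-! ### Functions on a glued manifold -/

section CollarFun

variable {n : ℕ} {M W : Type*} [TopologicalSpace M] [ChartedSpace (EuclideanSpace ℝ (Fin n)) M]
  [IsManifold (𝓡 n) ∞ M] [TopologicalSpace W] [ChartedSpace (EuclideanHalfSpace (n + 1)) W]
  {g : SmoothMetric n M}

namespace CollaredFilling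

/-- The function on `W` that is `a(-s) f(x)` in the point `(x, s)` of the collar, and zero outside
of the collar. The sign is that of the bicollar parameter of a gluing with left piece `W × M₁`. -/
def collarFun (F : CollaredFilling g W) (a : ℝ → ℝ) (f : M → ℝ) : W → ℝ :=
  extend F.collar (fun p => a (-halfLineCoord p.2) * f p.1) 0

variable (F : CollaredFilling g W) {a : ℝ → ℝ} {f : M → ℝ}

theorem collarFun_collar (x : M) {s : ℝ} (hs : 0 ≤ s) :
    F.collarFun a f (F.collar (x, halfLinePoint s)) = a (-s) * f x := by
  rw [collarFun, F.injective.extend_apply, halfLineCoord_halfLinePoint hs]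

theorem collarFun_of_notMem {w : W} (hw : w ∉ range F.collar) : F.collarFun a f w = 0 :=
  extend_apply' _ _ _ hw

theorem exists_of_mem_range {w : W} (hw : w ∈ range F.collar) :
    ∃ x s, 0 ≤ s ∧ F.collar (x, halfLinePoint s) = w := by
  obtain ⟨⟨x, z⟩, rfl⟩ := hw
  exact ⟨x, _, halfLineCoord_nonneg z, by rw [halfLinePoint_halfLineCoord]⟩

theorem collarFun_eq_zero {r : ℝ} (ha : ∀ t ≤ -r, a t = 0) {w : W}
    (hw : w ∈ collarCore F.collar r) : F.collarFun a f w = 0 := by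
  by_cases h : w ∈ range F.collar
  · obtain ⟨x, s, hs, rfl⟩ := F.exists_of_mem_range h
    rw [F.collarFun_collar x hs, ha _ (neg_le_neg ((apply_mem_collarCore F.injective hs).mp hw)),
      zero_mul]
  · exact F.collarFun_of_notMem h

theorem contMDiff_collarFun [CompactSpace M] [T2Space W] (ha : ContDiff ℝ ∞ a) {r : ℝ}
    (h0 : ∀ t ≤ -r, a t = 0) (hf : ContMDiff (𝓡 n) 𝓘(ℝ, ℝ) ∞ f) :
    ContMDiff (𝓡∂ (n + 1)) 𝓘(ℝ, ℝ) ∞ (F.collarFun a f) := by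
  refine contMDiff_extend_zero F.injective F.isLocalDiffeomorph (ContMDiff.mul ?_ ?_)
    (isCompact_collar_le r) ?_
  · have h1 : ContMDiff 𝓘(ℝ, ℝ) 𝓘(ℝ, ℝ) ∞ fun s : ℝ => a (-s) := (ha.comp contDiff_neg).contMDiff
    exact h1.comp (contMDiff_halfLineCoord.comp contMDiff_snd)
  · exact hf.comp contMDiff_fst
  · intro p hp
    have hp' : ¬ halfLineCoord p.2 ≤ r := hp
    rw [h0 _ (by linarith), zero_mul]

theorem isInteriorPoint_collar (x : M) {s : ℝ} (hs : 0 < s) :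
    (𝓡∂ (n + 1)).IsInteriorPoint (F.collar (x, halfLinePoint s)) := by
  rw [F.isInteriorPoint_iff]
  intro x' h
  have h1 := congrArg halfLineCoord (congrArg Prod.snd (F.injective h))
  rw [halfLineCoord_halfLinePoint le_rfl, halfLineCoord_halfLinePoint hs.le] at h1
  exact hs.ne h1

theorem isInteriorPoint_of_mem_collarCore {r : ℝ} (hr : 0 < r) {w : W}
    (hw : w ∈ collarCore F.collar r) : (𝓡∂ (n + 1)).IsInteriorPoint w := by
  rw [F.isInteriorPoint_iff]
  rintro x rfl
  exact absurd ((apply_mem_collarCore F.injective le_rfl).mp hw) (not_le.mpr hr)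

end CollaredFilling

end CollarFun

section Gluing

variable {n₀ n₁ n : ℕ} {M₀ W₀ M₁ W₁ M : Type*}
  [TopologicalSpace M₀] [ChartedSpace (EuclideanSpace ℝ (Fin n₀)) M₀] [IsManifold (𝓡 n₀) ∞ M₀]
  [TopologicalSpace M₁] [ChartedSpace (EuclideanSpace ℝ (Fin n₁)) M₁] [IsManifold (𝓡 n₁) ∞ M₁]
  [TopologicalSpace W₀] [ChartedSpace (EuclideanHalfSpace (n₀ + 1)) W₀]
  [TopologicalSpace W₁] [ChartedSpace (EuclideanHalfSpace (n₁ + 1)) W₁]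
  {g₀ : SmoothMetric n₀ M₀} {g₁ : SmoothMetric n₁ M₁}

/-- A gluing of `W₀ × M₁` and `W₁ × M₀` along their common boundary, with its bicollar. In contrast
to `IsSmoothGluing`, this notion is symmetric in the two pieces; in particular the dimension of
the glued manifold is a variable of its own. -/
structure CollaredGluing (F₀ : CollaredFilling g₀ W₀) (F₁ : CollaredFilling g₁ W₁)
    (n : ℕ) (M : Type*) [TopologicalSpace M] [ChartedSpace (EuclideanSpace ℝ (Fin n)) M] where
  /-- the inclusion of the left piece -/
  left : W₀ × M₁ → M
  /-- the inclusion of the right piece -/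
  right : W₁ × M₀ → M
  /-- the bicollar; its left half lies in the left piece -/
  neck : (M₀ × M₁) × ℝ → M
  injective_left : Injective left
  injective_right : Injective right
  cover : ∀ p, p ∈ range left ∨ p ∈ range right
  eq_iff : ∀ w y v x, left (w, y) = right (v, x) ↔
    w = F₀.collar (x, halfLinePoint 0) ∧ v = F₁.collar (y, halfLinePoint 0)
  isLocalDiffeomorphAt_left : ∀ w y, (𝓡∂ (n₀ + 1)).IsInteriorPoint w →
    IsLocalDiffeomorphAt ((𝓡∂ (n₀ + 1)).prod (𝓡 n₁)) (𝓡 n) ∞ left (w, y)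
  isLocalDiffeomorphAt_right : ∀ v x, (𝓡∂ (n₁ + 1)).IsInteriorPoint v →
    IsLocalDiffeomorphAt ((𝓡∂ (n₁ + 1)).prod (𝓡 n₀)) (𝓡 n) ∞ right (v, x)
  isLocalDiffeomorph_neck :
    IsLocalDiffeomorph (((𝓡 n₀).prod (𝓡 n₁)).prod 𝓘(ℝ, ℝ)) (𝓡 n) ∞ neck
  neck_neg : ∀ x y s, 0 ≤ s → neck ((x, y), -s) = left (F₀.collar (x, halfLinePoint s), y)
  neck_pos : ∀ x y s, 0 ≤ s → neck ((x, y), s) = right (F₁.collar (y, halfLinePoint s), x)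

variable {F₀ : CollaredFilling g₀ W₀} {F₁ : CollaredFilling g₁ W₁}
  [TopologicalSpace M] [ChartedSpace (EuclideanSpace ℝ (Fin n)) M]

namespace CollaredGluing

/-- Exchange the two pieces of a gluing. -/
def swap (G : CollaredGluing F₀ F₁ n M) : CollaredGluing F₁ F₀ n M where
  left := G.right
  right := G.left
  neck p := G.neck ((p.1.2, p.1.1), -p.2)
  injective_left := G.injective_right
  injective_right := G.injective_left
  cover p := (G.cover p).symm
  eq_iff w y v x := by rw [eq_comm, G.eq_iff, and_comm]
  isLocalDiffeomorphAt_left := G.isLocalDiffeomorphAt_right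
  isLocalDiffeomorphAt_right := G.isLocalDiffeomorphAt_left
  isLocalDiffeomorph_neck p := by
    let e : ((M₁ × M₀) × ℝ) ≃ₘ^∞⟮((𝓡 n₁).prod (𝓡 n₀)).prod 𝓘(ℝ, ℝ),
        ((𝓡 n₀).prod (𝓡 n₁)).prod 𝓘(ℝ, ℝ)⟯ ((M₀ × M₁) × ℝ) :=
      (Diffeomorph.prodComm (𝓡 n₁) (𝓡 n₀) M₁ M₀ ∞).prodCongr
        (ContinuousLinearEquiv.neg ℝ (M := ℝ)).toDiffeomorph
    exact (e.isLocalDiffeomorph p).comp _ _ (G.isLocalDiffeomorph_neck _)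
  neck_neg x y s hs := by
    rw [← G.neck_pos y x s hs, neg_neg]
  neck_pos x y s hs := G.neck_neg y x s hs

variable (G : CollaredGluing F₀ F₁ n M)

theorem swap_neck (x : M₀) (y : M₁) (t : ℝ) : G.swap.neck ((y, x), t) = G.neck ((x, y), -t) := rfl

theorem neck_of_nonpos (x : M₀) (y : M₁) {t : ℝ} (ht : t ≤ 0) :
    G.neck ((x, y), t) = G.left (F₀.collar (x, halfLinePoint (-t)), y) := by
  rw [← G.neck_neg x y (-t) (neg_nonneg.mpr ht), neg_neg]

theorem injective_neck : Injective G.neck := by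
  have key : ∀ (x x' : M₀) (y y' : M₁) (t t' : ℝ), t ≤ 0 →
      G.neck ((x, y), t) = G.neck ((x', y'), t') → ((x, y), t) = ((x', y'), t') := by
    intro x x' y y' t t' ht h
    rw [G.neck_of_nonpos x y ht] at h
    rcases le_or_gt t' 0 with ht' | ht'
    · rw [G.neck_of_nonpos x' y' ht'] at h
      have h1 := Prod.ext_iff.mp (G.injective_left h)
      have h2 := Prod.ext_iff.mp (F₀.injective h1.1)
      have h3 := congrArg halfLineCoord h2.2
      simp only at h1 h2 h3
      rw [halfLineCoord_halfLinePoint (by linarith),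
        halfLineCoord_halfLinePoint (by linarith)] at h3
      rw [h2.1, h1.2, neg_injective h3]
    · rw [G.neck_pos x' y' t' ht'.le, G.eq_iff] at h
      have h3 := congrArg halfLineCoord (Prod.ext_iff.mp (F₁.injective h.2)).2
      simp only at h3
      rw [halfLineCoord_halfLinePoint ht'.le, halfLineCoord_halfLinePoint le_rfl] at h3
      exact absurd h3 ht'.ne'
  rintro ⟨⟨x, y⟩, t⟩ ⟨⟨x', y'⟩, t'⟩ h
  rcases le_or_gt t 0 with ht | ht
  · exact key x x' y y' t t' ht h
  rcases le_or_gt t' 0 with ht' | ht'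
  · exact (key x' x y' y t' t ht' h.symm).symm
  · rw [G.neck_pos x y t ht.le, G.neck_pos x' y' t' ht'.le] at h
    have h1 := Prod.ext_iff.mp (G.injective_right h)
    have h2 := Prod.ext_iff.mp (F₁.injective h1.1)
    have h3 := congrArg halfLineCoord h2.2
    simp only at h1 h2 h3
    rw [halfLineCoord_halfLinePoint ht.le, halfLineCoord_halfLinePoint ht'.le] at h3
    rw [h2.1, h1.2, h3]

/-- A function on the glued manifold is smooth if it is smooth on the bicollar and in the interior
of each piece. -/
theorem contMDiff_of {h : M → ℝ}
    (hn : ContMDiff (((𝓡 n₀).prod (𝓡 n₁)).prod 𝓘(ℝ, ℝ)) 𝓘(ℝ, ℝ) ∞ (h ∘ G.neck))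
    (hl : ContMDiff ((𝓡∂ (n₀ + 1)).prod (𝓡 n₁)) 𝓘(ℝ, ℝ) ∞ (h ∘ G.left))
    (hr : ContMDiff ((𝓡∂ (n₁ + 1)).prod (𝓡 n₀)) 𝓘(ℝ, ℝ) ∞ (h ∘ G.right)) :
    ContMDiff (𝓡 n) 𝓘(ℝ, ℝ) ∞ h := by
  intro p
  rcases G.cover p with ⟨⟨w, y⟩, rfl⟩ | ⟨⟨v, x⟩, rfl⟩
  · by_cases hw : (𝓡∂ (n₀ + 1)).IsInteriorPoint w
    · exact (G.isLocalDiffeomorphAt_left w y hw).contMDiffAt_of_comp (hl _)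
    · rw [F₀.isInteriorPoint_iff] at hw
      push Not at hw
      obtain ⟨x, rfl⟩ := hw
      rw [← G.neck_neg x y 0 le_rfl]
      exact (G.isLocalDiffeomorph_neck _).contMDiffAt_of_comp (hn _)
  · by_cases hv : (𝓡∂ (n₁ + 1)).IsInteriorPoint v
    · exact (G.isLocalDiffeomorphAt_right v x hv).contMDiffAt_of_comp (hr _)
    · rw [F₁.isInteriorPoint_iff] at hv
      push Not at hv
      obtain ⟨y, rfl⟩ := hv
      rw [← G.neck_pos x y 0 le_rfl]
      exact (G.isLocalDiffeomorph_neck _).contMDiffAt_of_comp (hn _)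

/-! #### Functions that are pulled back from `M₀` -/

/-- The function that is `a(t) f(x)` on the bicollar, `f(x)` on the right piece, and zero elsewhere;
the description is consistent if `a` is `1` on `[0, ∞)`. -/
def baseFun (a : ℝ → ℝ) (f : M₀ → ℝ) : M → ℝ :=
  extend G.left (F₀.collarFun a f ∘ Prod.fst) (extend G.right (f ∘ Prod.snd) 0)

variable {a : ℝ → ℝ} {f : M₀ → ℝ}

theorem baseFun_left (w : W₀) (y : M₁) : G.baseFun a f (G.left (w, y)) = F₀.collarFun a f w :=
  G.injective_left.extend_apply _ _ _

theorem baseFun_right (h1 : a 0 = 1) (v : W₁) (x : M₀) : G.baseFun a f (G.right (v, x)) = f x := by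
  by_cases h : G.right (v, x) ∈ range G.left
  · obtain ⟨⟨w, y⟩, hw⟩ := h
    rw [← hw, baseFun_left, ((G.eq_iff _ _ _ _).mp hw).1, F₀.collarFun_collar x le_rfl,
      neg_zero, h1, one_mul]
  · rw [baseFun, extend_apply' _ _ _ h, G.injective_right.extend_apply]
    rfl

theorem baseFun_neck (h1 : ∀ t ≥ 0, a t = 1) (x : M₀) (y : M₁) (t : ℝ) :
    G.baseFun a f (G.neck ((x, y), t)) = a t * f x := by
  rcases le_total t 0 with ht | ht
  · rw [G.neck_of_nonpos x y ht, baseFun_left, F₀.collarFun_collar x (neg_nonneg.mpr ht), neg_neg]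
  · rw [G.neck_pos x y t ht, G.baseFun_right (h1 0 le_rfl), h1 t ht, one_mul]

theorem contMDiff_baseFun [CompactSpace M₀] [T2Space W₀] (ha : ContDiff ℝ ∞ a) {r : ℝ}
    (h0 : ∀ t ≤ -r, a t = 0) (h1 : ∀ t ≥ 0, a t = 1) (hf : ContMDiff (𝓡 n₀) 𝓘(ℝ, ℝ) ∞ f) :
    ContMDiff (𝓡 n) 𝓘(ℝ, ℝ) ∞ (G.baseFun a f) := by
  refine G.contMDiff_of ?_ ?_ ?_
  · have h2 : G.baseFun a f ∘ G.neck = fun p => a p.2 * f p.1.1 :=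
      funext fun p => G.baseFun_neck h1 p.1.1 p.1.2 p.2
    rw [h2]
    have h3 : ContMDiff 𝓘(ℝ, ℝ) 𝓘(ℝ, ℝ) ∞ a := ha.contMDiff
    exact (h3.comp contMDiff_snd).mul (hf.comp (contMDiff_fst.comp contMDiff_fst))
  · have h2 : G.baseFun a f ∘ G.left = F₀.collarFun a f ∘ Prod.fst :=
      funext fun p => G.baseFun_left p.1 p.2
    rw [h2]
    exact (F₀.contMDiff_collarFun ha h0 hf).comp contMDiff_fst
  · have h2 : G.baseFun a f ∘ G.right = f ∘ Prod.snd :=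
      funext fun p => G.baseFun_right (h1 0 le_rfl) p.1 p.2
    rw [h2]
    exact hf.comp contMDiff_snd

/-! #### Functions that are pulled back from `W₀` -/

/-- The extension by zero of a function on `W₀` that vanishes at depth at most `4`. -/
def pieceFun (h : W₀ → ℝ) : M → ℝ := extend G.left (h ∘ Prod.fst) 0

variable {h : W₀ → ℝ}

theorem pieceFun_left (w : W₀) (y : M₁) : G.pieceFun h (G.left (w, y)) = h w :=
  G.injective_left.extend_apply _ _ _

theorem pieceFun_right (h0 : ∀ x s, 0 ≤ s → s ≤ 4 → h (F₀.collar (x, halfLinePoint s)) = 0)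
    (v : W₁) (x : M₀) : G.pieceFun h (G.right (v, x)) = 0 := by
  by_cases hr : G.right (v, x) ∈ range G.left
  · obtain ⟨⟨w, y⟩, hw⟩ := hr
    rw [← hw, pieceFun_left, ((G.eq_iff _ _ _ _).mp hw).1, h0 x 0 le_rfl (by norm_num)]
  · rw [pieceFun, extend_apply' _ _ _ hr]
    rfl

theorem pieceFun_neck (h0 : ∀ x s, 0 ≤ s → s ≤ 4 → h (F₀.collar (x, halfLinePoint s)) = 0)
    (x : M₀) (y : M₁) {t : ℝ} (ht : -4 ≤ t) : G.pieceFun h (G.neck ((x, y), t)) = 0 := by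
  rcases le_total t 0 with ht' | ht'
  · rw [G.neck_of_nonpos x y ht', pieceFun_left, h0 x _ (by linarith) (by linarith)]
  · rw [G.neck_pos x y t ht', G.pieceFun_right h0]

theorem contMDiff_pieceFun (hh : ContMDiff (𝓡∂ (n₀ + 1)) 𝓘(ℝ, ℝ) ∞ h)
    (h0 : ∀ x s, 0 ≤ s → s ≤ 4 → h (F₀.collar (x, halfLinePoint s)) = 0) :
    ContMDiff (𝓡 n) 𝓘(ℝ, ℝ) ∞ (G.pieceFun h) := by
  have hl : ContMDiff ((𝓡∂ (n₀ + 1)).prod (𝓡 n₁)) 𝓘(ℝ, ℝ) ∞ (G.pieceFun h ∘ G.left) := by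
    have h2 : G.pieceFun h ∘ G.left = h ∘ Prod.fst := funext fun p => G.pieceFun_left p.1 p.2
    rw [h2]
    exact hh.comp contMDiff_fst
  refine G.contMDiff_of ?_ hl ?_
  · rintro ⟨⟨x, y⟩, t⟩
    rcases lt_or_ge t 0 with ht | ht
    · have hi := F₀.isInteriorPoint_collar x (neg_pos.mpr ht)
      have h2 : ContMDiffAt (𝓡 n) 𝓘(ℝ, ℝ) ∞ (G.pieceFun h) (G.neck ((x, y), t)) := by
        rw [G.neck_of_nonpos x y ht.le]
        exact (G.isLocalDiffeomorphAt_left _ y hi).contMDiffAt_of_comp (hl _)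
      exact h2.comp _ (G.isLocalDiffeomorph_neck _).contMDiffAt
    · refine ContMDiffAt.congr_of_eventuallyEq (f := fun _ => (0 : ℝ)) contMDiffAt_const ?_
      have h3 : ∀ᶠ p : (M₀ × M₁) × ℝ in 𝓝 ((x, y), t), -4 < p.2 :=
        continuous_snd.continuousAt.eventually (lt_mem_nhds (by linarith))
      filter_upwards [h3] with p hp
      exact G.pieceFun_neck h0 p.1.1 p.1.2 hp.le
  · have h2 : G.pieceFun h ∘ G.right = fun _ => 0 :=
      funext fun p => G.pieceFun_right h0 p.1 p.2
    rw [h2]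
    exact contMDiff_const

/-! #### Functions of the bicollar parameter -/

/-- The function that is `a(t)` on the bicollar, and zero elsewhere. -/
def neckFun (a : ℝ → ℝ) : M → ℝ := extend G.neck (a ∘ Prod.snd) 0

theorem neckFun_neck (x : M₀) (y : M₁) (t : ℝ) : G.neckFun a (G.neck ((x, y), t)) = a t :=
  G.injective_neck.extend_apply _ _ _

theorem neckFun_left (w : W₀) (y : M₁) :
    G.neckFun a (G.left (w, y)) = F₀.collarFun a (fun _ => 1) w := by
  by_cases hw : w ∈ range F₀.collar
  · obtain ⟨x, s, hs, rfl⟩ := F₀.exists_of_mem_range hw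
    rw [← G.neck_neg x y s hs, neckFun_neck, F₀.collarFun_collar x hs, mul_one]
  · rw [F₀.collarFun_of_notMem hw, neckFun, extend_apply']
    · rfl
    · rintro ⟨⟨⟨x, y'⟩, t⟩, ht⟩
      rcases le_total t 0 with h | h
      · rw [G.neck_of_nonpos x y' h] at ht
        exact hw ⟨_, congrArg Prod.fst (G.injective_left ht)⟩
      · rw [G.neck_pos x y' t h, eq_comm, G.eq_iff] at ht
        exact hw ⟨_, ht.1.symm⟩

theorem swap_neckFun : G.swap.neckFun a = G.neckFun fun t => a (-t) := by
  funext p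
  by_cases hp : p ∈ range G.neck
  · obtain ⟨⟨⟨x, y⟩, t⟩, rfl⟩ := hp
    rw [neckFun_neck]
    have h := G.swap_neck x y (-t)
    rw [neg_neg] at h
    rw [← h, neckFun_neck]
  · rw [neckFun, neckFun, extend_apply' _ _ _ hp, extend_apply']
    rintro ⟨⟨⟨y, x⟩, t⟩, rfl⟩
    exact hp ⟨_, (G.swap_neck x y t).symm⟩

theorem contMDiff_neckFun [CompactSpace M₀] [CompactSpace M₁] [T2Space M] (ha : ContDiff ℝ ∞ a)
    {r : ℝ} (h0 : ∀ t, r ≤ |t| → a t = 0) : ContMDiff (𝓡 n) 𝓘(ℝ, ℝ) ∞ (G.neckFun a) := by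
  have h1 : ContMDiff 𝓘(ℝ, ℝ) 𝓘(ℝ, ℝ) ∞ a := ha.contMDiff
  refine contMDiff_extend_zero G.injective_neck G.isLocalDiffeomorph_neck (h1.comp contMDiff_snd)
    (K := univ ×ˢ Icc (-r) r) (isCompact_univ.prod isCompact_Icc) ?_
  rintro ⟨q, t⟩ hp
  refine h0 t ?_
  by_contra! h
  exact hp ⟨mem_univ _, (abs_le.mp h.le)⟩

end CollaredGluing

end Gluing

/-! ### Fields of forms on a glued manifold -/

section Forms

variable {n : ℕ} {M : Type*} [TopologicalSpace M] [ChartedSpace (EuclideanSpace ℝ (Fin n)) M]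
  {E : Type*} [NormedAddCommGroup E] [NormedSpace ℝ E]
  {E' : Type*} [NormedAddCommGroup E'] [NormedSpace ℝ E']

theorem BilForm.ext_apply {B C : BilForm E} (h : ∀ X Y, B X Y = C X Y) : B = C :=
  ContinuousLinearMap.ext fun X => ContinuousLinearMap.ext fun Y => h X Y

/-- The pointwise sum of fields of bilinear forms. -/
def FormField.add (b b' : FormField n M) : FormField n M := fun p =>
  ((b p : BilForm (EuclideanSpace ℝ (Fin n))) + (b' p : BilForm (EuclideanSpace ℝ (Fin n))) :
    BilForm (EuclideanSpace ℝ (Fin n)))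

theorem pullForm_add (b b' : FormField n M) (ψ : E → M) :
    pullForm (b.add b') ψ = fun v => pullForm b ψ v + pullForm b' ψ v := rfl

theorem IsSmoothForm.add {b b' : FormField n M} (hb : IsSmoothForm b) (hb' : IsSmoothForm b') :
    IsSmoothForm (b.add b') := fun x => (hb x).add (hb' x)

theorem fderiv_comp_clm {f : E' → ℝ} {π : E →L[ℝ] E'} {v : E} (hf : DifferentiableAt ℝ f (π v)) :
    fderiv ℝ (fun w => f (π w)) v = (fderiv ℝ f (π v)) ∘L π := by
  have := fderiv_comp v hf π.differentiableAt
  rwa [ContinuousLinearMap.fderiv] at this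

/-- The expression of `∑ₖ Uₖ dVₖ ⊗ dWₖ` in a parametrization in which all functions factor
through a linear map `π`. -/
theorem pullForm_sumForm_of_factor {κ : Type*} [Fintype κ] {U V W : κ → M → ℝ} {ψ : E → M} {v : E}
    (hV : ∀ k, ContMDiff (𝓡 n) 𝓘(ℝ, ℝ) ∞ (V k)) (hW : ∀ k, ContMDiff (𝓡 n) 𝓘(ℝ, ℝ) ∞ (W k))
    (hψ : MDifferentiableAt 𝓘(ℝ, E) (𝓡 n) ψ v) (π : E →L[ℝ] E') {a : ℝ} {U' V' W' : κ → E' → ℝ}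
    (hU' : ∀ k, U k (ψ v) = a * U' k (π v)) (hVV' : ∀ k, ∀ᶠ w in 𝓝 v, V k (ψ w) = V' k (π w))
    (hWW' : ∀ k, ∀ᶠ w in 𝓝 v, W k (ψ w) = W' k (π w))
    (hV' : ∀ k, DifferentiableAt ℝ (V' k) (π v)) (hW' : ∀ k, DifferentiableAt ℝ (W' k) (π v)) :
    pullForm (sumForm (n := n) U V W) ψ v = a • (sumBil U' V' W' (π v)).bilinearComp π π := by
  rw [pullForm_sumForm (fun k => (hV k).contMDiffAt.mdifferentiableAt (by simp))
    (fun k => (hW k).contMDiffAt.mdifferentiableAt (by simp)) hψ]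
  ext X Y
  have e1 : ∀ k, fderiv ℝ (V k ∘ ψ) v = (fderiv ℝ (V' k) (π v)) ∘L π := fun k => by
    rw [← fderiv_comp_clm (hV' k)]
    exact Filter.EventuallyEq.fderiv_eq (hVV' k)
  have e2 : ∀ k, fderiv ℝ (W k ∘ ψ) v = (fderiv ℝ (W' k) (π v)) ∘L π := fun k => by
    rw [← fderiv_comp_clm (hW' k)]
    exact Filter.EventuallyEq.fderiv_eq (hWW' k)
  simp only [sumBil_apply, smul_apply, ContinuousLinearMap.bilinearComp_apply, e1, e2, comp_apply,
    hU', smul_eq_mul, Finset.mul_sum, ContinuousLinearMap.comp_apply, mul_assoc]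

theorem IsParam.eventually_mdifferentiableAt [IsManifold (𝓡 n) ∞ M] {ψ : E → M} {u : E}
    (h : IsParam n ψ u) : ∀ᶠ v in 𝓝 u, MDifferentiableAt 𝓘(ℝ, E) (𝓡 n) ψ v := by
  have : IsManifold (𝓡 n) 1 M := .of_le one_le_infty
  filter_upwards [(contMDiffAt_iff_contMDiffAt_nhds (by simp)).mp
    (h.contMDiffAt.of_le one_le_infty)] with v hv using hv.mdifferentiableAt one_ne_zero

theorem IsLocalParam.comp_equiv {E₁ H₁ : Type*} [NormedAddCommGroup E₁] [NormedSpace ℝ E₁]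
    [TopologicalSpace H₁] {I : ModelWithCorners ℝ E₁ H₁} {X : Type*} [TopologicalSpace X]
    [ChartedSpace H₁ X] {χ : E → X} {φ : X → E} (e : E' ≃L[ℝ] E) {u : E'}
    (h : IsLocalParam I χ φ (e u)) : IsLocalParam I (χ ∘ e) (e.symm ∘ φ) u where
  contMDiffAt := h.contMDiffAt.comp u e.contDiff.contMDiff.contMDiffAt
  contMDiffAt_inv := ContMDiffAt.comp (χ (e u)) e.symm.contDiff.contMDiff.contMDiffAt
    h.contMDiffAt_inv
  left_inv := by
    filter_upwards [e.continuous.continuousAt.eventually h.left_inv] with v hv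
    simp [hv]
  right_inv := by
    filter_upwards [h.right_inv] with x hx
    simp [hx]

/-- A metric in the preferred chart, expressed through a decomposition into gradients. -/
theorem pullForm_extChartAt_eq_sumBil [IsManifold (𝓡 n) ∞ M] {g : SmoothMetric n M}
    {κ : Type*} [Fintype κ] {U V W : κ → M → ℝ} (hg : g.inner = sumForm U V W)
    (hV : ∀ k, ContMDiff (𝓡 n) 𝓘(ℝ, ℝ) ∞ (V k)) (hW : ∀ k, ContMDiff (𝓡 n) 𝓘(ℝ, ℝ) ∞ (W k))
    {x : M} {v : EuclideanSpace ℝ (Fin n)} (hv : v ∈ (extChartAt (𝓡 n) x).target) :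
    pullForm g.inner (extChartAt (𝓡 n) x).symm v =
      sumBil (fun k => U k ∘ (extChartAt (𝓡 n) x).symm) (fun k => V k ∘ (extChartAt (𝓡 n) x).symm)
        (fun k => W k ∘ (extChartAt (𝓡 n) x).symm) v := by
  rw [hg]
  exact pullForm_sumForm (fun k => (hV k).contMDiffAt.mdifferentiableAt (by simp))
    (fun k => (hW k).contMDiffAt.mdifferentiableAt (by simp))
    ((isParam_extChartAt_symm x hv).contMDiffAt.mdifferentiableAt (by simp))

end Forms

/-! ### The metric on the glued manifold -/

section GluedForm

theorem DifferentiableAt.comp_extChartAt_symm {n : ℕ} {M : Type*} [TopologicalSpace M]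
    [ChartedSpace (EuclideanSpace ℝ (Fin n)) M] [IsManifold (𝓡 n) ∞ M] {f : M → ℝ}
    (hf : ContMDiff (𝓡 n) 𝓘(ℝ, ℝ) ∞ f) {x : M} {v : EuclideanSpace ℝ (Fin n)}
    (hv : v ∈ (extChartAt (𝓡 n) x).target) :
    DifferentiableAt ℝ (f ∘ (extChartAt (𝓡 n) x).symm) v :=
  (hf.contMDiffAt.comp v (isParam_extChartAt_symm x hv).contMDiffAt).contDiffAt.differentiableAt
    (by simp)

/-- The reordering of coordinates `((ξ, t), η) ↦ ((ξ, η), t)`. -/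
def prodReorder (E F : Type*) [NormedAddCommGroup E] [NormedSpace ℝ E] [NormedAddCommGroup F]
    [NormedSpace ℝ F] : ((E × ℝ) × F) ≃L[ℝ] ((E × F) × ℝ) :=
  ContinuousLinearEquiv.equivOfInverse
    ((((ContinuousLinearMap.fst ℝ E ℝ).comp (.fst ℝ (E × ℝ) F)).prod (.snd ℝ (E × ℝ) F)).prod
      ((ContinuousLinearMap.snd ℝ E ℝ).comp (.fst ℝ (E × ℝ) F)))
    ((((ContinuousLinearMap.fst ℝ E F).comp (.fst ℝ (E × F) ℝ)).prod (.snd ℝ (E × F) ℝ)).prod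
      ((ContinuousLinearMap.snd ℝ E F).comp (.fst ℝ (E × F) ℝ)))
    (fun _ => rfl) (fun _ => rfl)

variable {n₀ n₁ n : ℕ} {M₀ W₀ M₁ W₁ M : Type*}
  [TopologicalSpace M₀] [ChartedSpace (EuclideanSpace ℝ (Fin n₀)) M₀] [IsManifold (𝓡 n₀) ∞ M₀]
  [TopologicalSpace M₁] [ChartedSpace (EuclideanSpace ℝ (Fin n₁)) M₁] [IsManifold (𝓡 n₁) ∞ M₁]
  [TopologicalSpace W₀] [ChartedSpace (EuclideanHalfSpace (n₀ + 1)) W₀]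
  [TopologicalSpace W₁] [ChartedSpace (EuclideanHalfSpace (n₁ + 1)) W₁]
  {g₀ : SmoothMetric n₀ M₀} {g₁ : SmoothMetric n₁ M₁}
  {F₀ : CollaredFilling g₀ W₀} {F₁ : CollaredFilling g₁ W₁}
  [TopologicalSpace M] [ChartedSpace (EuclideanSpace ℝ (Fin n)) M]

namespace CollaredGluing

variable (G : CollaredGluing F₀ F₁ n M)

/-- The contribution of the metric of `M₀`: it is `A(t) g₀` on the bicollar, with the factor `A`
given by `scaleProfile l`, and `g₀` on the right piece. -/
def baseForm (l : ℝ) : FormField n M :=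
  sumForm (fun k => G.baseFun (scaleProfile l) (F₀.coef k))
    (fun k => G.baseFun cutProfile (F₀.pot k)) (fun k => G.baseFun cutProfile (F₀.pot' k))

/-- The contribution `l ∑ₖ dfₖ²` of the auxiliary functions `fₖ` on `W₀`, which keeps the metric
positive definite beyond the collar. -/
def auxForm (l : ℝ) : FormField n M :=
  sumForm (fun _ _ => l) (fun k => G.pieceFun (F₀.aux k)) (fun k => G.pieceFun (F₀.aux k))

/-- The form `a(t) dt²` on the bicollar, if `a` is cut off for large `|t|`. -/
def neckForm (a : ℝ → ℝ) : FormField n M :=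
  sumForm (fun _ : Unit => G.neckFun a) (fun _ => G.neckFun neckCoord)
    (fun _ => G.neckFun neckCoord)

/-- The metric on the glued manifold, with its parameters: the scales `l` and `m` of the metric in
the left and the right piece and the factor `N` of `dt²` in the middle of the neck. -/
def totalForm (l N m : ℝ) : FormField n M :=
  ((G.baseForm l).add (G.swap.baseForm m)).add
    ((G.neckForm (neckProfile l N m)).add ((G.auxForm l).add (G.swap.auxForm m)))

theorem contMDiff_baseFun_scaleProfile [CompactSpace M₀] [T2Space W₀] (l : ℝ)
    {f : M₀ → ℝ} (hf : ContMDiff (𝓡 n₀) 𝓘(ℝ, ℝ) ∞ f) :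
    ContMDiff (𝓡 n) 𝓘(ℝ, ℝ) ∞ (G.baseFun (scaleProfile l) f) :=
  G.contMDiff_baseFun (contDiff_scaleProfile l) (fun _ ht => scaleProfile_eq_zero l ht)
    (fun _ ht => scaleProfile_eq_one l (by linarith)) hf

theorem contMDiff_baseFun_cutProfile [CompactSpace M₀] [T2Space W₀]
    {f : M₀ → ℝ} (hf : ContMDiff (𝓡 n₀) 𝓘(ℝ, ℝ) ∞ f) :
    ContMDiff (𝓡 n) 𝓘(ℝ, ℝ) ∞ (G.baseFun cutProfile f) :=
  G.contMDiff_baseFun contDiff_cutProfile (fun _ ht => cutProfile_eq_zero ht)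
    (fun _ ht => cutProfile_eq_one (by linarith)) hf

theorem isSmoothForm_totalForm [IsManifold (𝓡 n) ∞ M] [CompactSpace M₀] [CompactSpace M₁]
    [T2Space W₀] [T2Space W₁] [T2Space M] (l N m : ℝ) : IsSmoothForm (G.totalForm l N m) := by
  have h1 : IsSmoothForm (G.baseForm l) :=
    isSmoothForm_sumForm (fun k => G.contMDiff_baseFun_scaleProfile l (F₀.contMDiff_coef k))
      (fun k => G.contMDiff_baseFun_cutProfile (F₀.contMDiff_pot k))
      (fun k => G.contMDiff_baseFun_cutProfile (F₀.contMDiff_pot' k))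
  have h2 : IsSmoothForm (G.swap.baseForm m) :=
    isSmoothForm_sumForm (fun k => G.swap.contMDiff_baseFun_scaleProfile m (F₁.contMDiff_coef k))
      (fun k => G.swap.contMDiff_baseFun_cutProfile (F₁.contMDiff_pot k))
      (fun k => G.swap.contMDiff_baseFun_cutProfile (F₁.contMDiff_pot' k))
  have h3 : IsSmoothForm (G.auxForm l) :=
    isSmoothForm_sumForm (fun _ => contMDiff_const)
      (fun k => G.contMDiff_pieceFun (F₀.contMDiff_aux k) (F₀.aux_eq_zero k))
      (fun k => G.contMDiff_pieceFun (F₀.contMDiff_aux k) (F₀.aux_eq_zero k))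
  have h4 : IsSmoothForm (G.swap.auxForm m) :=
    isSmoothForm_sumForm (fun _ => contMDiff_const)
      (fun k => G.swap.contMDiff_pieceFun (F₁.contMDiff_aux k) (F₁.aux_eq_zero k))
      (fun k => G.swap.contMDiff_pieceFun (F₁.contMDiff_aux k) (F₁.aux_eq_zero k))
  have h5 : IsSmoothForm (G.neckForm (neckProfile l N m)) :=
    isSmoothForm_sumForm (fun _ => G.contMDiff_neckFun (contDiff_neckProfile l N m)
        fun _ ht => neckProfile_eq_zero l N m ht)
      (fun _ => G.contMDiff_neckFun contDiff_neckCoord fun _ ht => neckCoord_eq_zero ht)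
      (fun _ => G.contMDiff_neckFun contDiff_neckCoord fun _ ht => neckCoord_eq_zero ht)
  exact (h1.add h2).add (h5.add (h3.add h4))

theorem swap_neckForm {a a' : ℝ → ℝ} (h : ∀ t, a (-t) = a' t) :
    G.swap.neckForm a = G.neckForm a' := by
  have h1 : G.swap.neckFun a = G.neckFun a' := by
    rw [swap_neckFun]
    exact congrArg _ (funext h)
  have h2 : G.swap.neckFun neckCoord = -G.neckFun neckCoord := by
    rw [swap_neckFun]
    funext p
    by_cases hp : p ∈ range G.neck
    · obtain ⟨⟨⟨x, y⟩, t⟩, rfl⟩ := hp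
      rw [Pi.neg_apply, neckFun_neck, neckFun_neck, neckCoord_neg]
    · rw [Pi.neg_apply, neckFun, neckFun, extend_apply' _ _ _ hp, extend_apply' _ _ _ hp]
      simp
  have h3 : ∀ V : M → ℝ, gradForm n (-V) (-V) = gradForm n V V := by
    intro V
    funext p
    have h4 : differential n (-V) p = -differential n V p := mfderiv_neg
    rw [gradForm, h4]
    ext X Y
    simp [gradForm, ContinuousLinearMap.smulRight_apply]
  unfold neckForm sumForm
  simp only [h1, h2, h3]
  rfl

/-- The construction of the metric is symmetric in the two pieces. -/
theorem swap_totalForm (l N m : ℝ) : G.swap.totalForm m N l = G.totalForm l N m := by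
  have h1 : G.swap.neckForm (neckProfile m N l) = G.neckForm (neckProfile l N m) :=
    G.swap_neckForm fun t => neckProfile_neg m N l t
  have h2 : G.swap.swap.baseForm l = G.baseForm l := rfl
  have h3 : G.swap.swap.auxForm l = G.auxForm l := rfl
  rw [totalForm, totalForm, h1, h2, h3]
  have h4 : ∀ b b' : FormField n M, b.add b' = b'.add b := fun b b' => funext fun p =>
    add_comm (G := BilForm (EuclideanSpace ℝ (Fin n))) _ _
  rw [h4 (G.baseForm l), h4 (G.auxForm l)]

end CollaredGluing

end GluedForm

/-! ### The metric in coordinates: the neck -/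

section NeckPart

/-- The model space `(ℝⁿ⁰ × ℝ) × ℝⁿ¹` of the neck. -/
abbrev NeckModel (n₀ n₁ : ℕ) : Type :=
  (EuclideanSpace ℝ (Fin n₀) × ℝ) × EuclideanSpace ℝ (Fin n₁)

variable {n₀ n₁ n : ℕ} {M₀ W₀ M₁ W₁ M : Type*}
  [TopologicalSpace M₀] [ChartedSpace (EuclideanSpace ℝ (Fin n₀)) M₀] [IsManifold (𝓡 n₀) ∞ M₀]
  [TopologicalSpace M₁] [ChartedSpace (EuclideanSpace ℝ (Fin n₁)) M₁] [IsManifold (𝓡 n₁) ∞ M₁]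
  [TopologicalSpace W₀] [ChartedSpace (EuclideanHalfSpace (n₀ + 1)) W₀]
  [TopologicalSpace W₁] [ChartedSpace (EuclideanHalfSpace (n₁ + 1)) W₁]
  {g₀ : SmoothMetric n₀ M₀} {g₁ : SmoothMetric n₁ M₁}
  {F₀ : CollaredFilling g₀ W₀} {F₁ : CollaredFilling g₁ W₁}
  [TopologicalSpace M] [ChartedSpace (EuclideanSpace ℝ (Fin n)) M]

namespace CollaredGluing

variable (G : CollaredGluing F₀ F₁ n M)

theorem neck_eq_swap_neck (x : M₀) (y : M₁) (t : ℝ) :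
    G.neck ((x, y), t) = G.swap.neck ((y, x), -t) := by
  rw [swap_neck, neg_neg]

/-- Coordinates `((ξ, t), η)` on the neck, from the preferred charts at `x₀ ∈ M₀`, `y₀ ∈ M₁`. -/
def neckMap (x₀ : M₀) (y₀ : M₁)
    (v : NeckModel n₀ n₁) : M :=
  G.neck (((extChartAt (𝓡 n₀) x₀).symm v.1.1, (extChartAt (𝓡 n₁) y₀).symm v.2), v.1.2)

/-- The coordinates of the point `((x₀, y₀), t)` of the neck. -/
def neckPoint (n₀ n₁ : ℕ) {M₀ M₁ : Type*}
    [TopologicalSpace M₀] [ChartedSpace (EuclideanSpace ℝ (Fin n₀)) M₀]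
    [TopologicalSpace M₁] [ChartedSpace (EuclideanSpace ℝ (Fin n₁)) M₁] (x₀ : M₀) (y₀ : M₁)
    (t : ℝ) : NeckModel n₀ n₁ :=
  ((extChartAt (𝓡 n₀) x₀ x₀, t), extChartAt (𝓡 n₁) y₀ y₀)

theorem neckMap_neckPoint (x₀ : M₀) (y₀ : M₁) (t : ℝ) :
    G.neckMap x₀ y₀ (neckPoint n₀ n₁ x₀ y₀ t) = G.neck ((x₀, y₀), t) := by
  simp [neckMap, neckPoint]

theorem isParam_neckMap (x₀ : M₀) (y₀ : M₁) (t : ℝ) :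
    IsParam n (G.neckMap x₀ y₀) (neckPoint n₀ n₁ x₀ y₀ t) := by
  have h0 := isLocalParam_extChartAt_symm (I := 𝓡 n₀) (mem_chart_source _ x₀)
    BoundarylessManifold.isInteriorPoint
  have h1 := isLocalParam_extChartAt_symm (I := 𝓡 n₁) (mem_chart_source _ y₀)
    BoundarylessManifold.isInteriorPoint
  have h2 := (h0.prod h1).prod (isLocalParam_id t)
  exact (IsLocalParam.comp_equiv (prodReorder _ _)
    (u := neckPoint n₀ n₁ x₀ y₀ t) (h2.comp_localDiffeomorph
      (G.isLocalDiffeomorph_neck _))).isParam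

theorem pullForm_baseForm_neckMap [CompactSpace M₀] [T2Space W₀] {x₀ : M₀} {y₀ : M₁} (l : ℝ)
    {v : NeckModel n₀ n₁}
    (hv : MDifferentiableAt 𝓘(ℝ, NeckModel n₀ n₁) (𝓡 n) (G.neckMap x₀ y₀) v)
    (h0 : v.1.1 ∈ (extChartAt (𝓡 n₀) x₀).target) (ht : -7 < v.1.2) :
    pullForm (G.baseForm l) (G.neckMap x₀ y₀) v = scaleProfile l v.1.2 •
      (pullForm g₀.inner (extChartAt (𝓡 n₀) x₀).symm v.1.1).bilinearComp
        (.comp (.fst ℝ _ ℝ) (.fst ℝ _ _)) (.comp (.fst ℝ _ ℝ) (.fst ℝ _ _)) := by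
  rw [pullForm_extChartAt_eq_sumBil F₀.inner_eq F₀.contMDiff_pot F₀.contMDiff_pot' h0]
  have hcut : ∀ f : M₀ → ℝ, ∀ᶠ w in 𝓝 v, G.baseFun cutProfile f (G.neckMap x₀ y₀ w)
      = f ((extChartAt (𝓡 n₀) x₀).symm w.1.1) := by
    intro f
    have h1 : ∀ᶠ w : NeckModel n₀ n₁ in 𝓝 v, -7 < w.1.2 :=
      (by fun_prop : Continuous fun w : NeckModel n₀ n₁ => w.1.2).continuousAt.eventually
        (lt_mem_nhds ht)
    filter_upwards [h1] with w hw
    rw [neckMap, G.baseFun_neck (fun t ht => cutProfile_eq_one (by linarith)),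
      cutProfile_eq_one hw.le, one_mul]
  exact pullForm_sumForm_of_factor (fun k => G.contMDiff_baseFun_cutProfile (F₀.contMDiff_pot k))
    (fun k => G.contMDiff_baseFun_cutProfile (F₀.contMDiff_pot' k)) hv
    (.comp (.fst ℝ _ ℝ) (.fst ℝ _ _))
    (fun k => G.baseFun_neck (fun t ht => scaleProfile_eq_one l (by linarith)) _ _ _)
    (fun k => hcut _) (fun k => hcut _)
    (fun k => .comp_extChartAt_symm (F₀.contMDiff_pot k) h0)
    (fun k => .comp_extChartAt_symm (F₀.contMDiff_pot' k) h0)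

theorem pullForm_swap_baseForm_neckMap [CompactSpace M₁] [T2Space W₁] {x₀ : M₀} {y₀ : M₁} (m : ℝ)
    {v : NeckModel n₀ n₁}
    (hv : MDifferentiableAt 𝓘(ℝ, NeckModel n₀ n₁) (𝓡 n) (G.neckMap x₀ y₀) v)
    (h1 : v.2 ∈ (extChartAt (𝓡 n₁) y₀).target) (ht : v.1.2 < 7) :
    pullForm (G.swap.baseForm m) (G.neckMap x₀ y₀) v = scaleProfile m (-v.1.2) •
      (pullForm g₁.inner (extChartAt (𝓡 n₁) y₀).symm v.2).bilinearComp
        (.snd ℝ _ _) (.snd ℝ _ _) := by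
  rw [pullForm_extChartAt_eq_sumBil F₁.inner_eq F₁.contMDiff_pot F₁.contMDiff_pot' h1]
  have hcut : ∀ f : M₁ → ℝ, ∀ᶠ w in 𝓝 v, G.swap.baseFun cutProfile f (G.neckMap x₀ y₀ w)
      = f ((extChartAt (𝓡 n₁) y₀).symm w.2) := by
    intro f
    have h1 : ∀ᶠ w : NeckModel n₀ n₁ in 𝓝 v, w.1.2 < 7 :=
      (by fun_prop : Continuous fun w : NeckModel n₀ n₁ => w.1.2).continuousAt.eventually
        (gt_mem_nhds ht)
    filter_upwards [h1] with w hw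
    rw [neckMap, neck_eq_swap_neck,
      G.swap.baseFun_neck (fun t ht => cutProfile_eq_one (by linarith)),
      cutProfile_eq_one (by linarith), one_mul]
  refine pullForm_sumForm_of_factor
    (fun k => G.swap.contMDiff_baseFun_cutProfile (F₁.contMDiff_pot k))
    (fun k => G.swap.contMDiff_baseFun_cutProfile (F₁.contMDiff_pot' k)) hv
    (.snd ℝ _ _) (fun k => ?_) (fun k => hcut _) (fun k => hcut _)
    (fun k => .comp_extChartAt_symm (F₁.contMDiff_pot k) h1)
    (fun k => .comp_extChartAt_symm (F₁.contMDiff_pot' k) h1)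
  rw [neckMap, neck_eq_swap_neck,
    G.swap.baseFun_neck (fun t ht => scaleProfile_eq_one m (by linarith))]
  rfl

theorem pullForm_neckForm_neckMap [CompactSpace M₀] [CompactSpace M₁] [T2Space M] {x₀ : M₀}
    {y₀ : M₁} (a : ℝ → ℝ) {v : NeckModel n₀ n₁}
    (hv : MDifferentiableAt 𝓘(ℝ, NeckModel n₀ n₁) (𝓡 n) (G.neckMap x₀ y₀) v) (ht : |v.1.2| < 7) :
    pullForm (G.neckForm a) (G.neckMap x₀ y₀) v = a v.1.2 •
      (ContinuousLinearMap.mul ℝ ℝ).bilinearComp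
        (.comp (.snd ℝ _ ℝ) (.fst ℝ _ _)) (.comp (.snd ℝ _ ℝ) (.fst ℝ _ _)) := by
  have h0 : ∀ᶠ w in 𝓝 v, G.neckFun neckCoord (G.neckMap x₀ y₀ w) = w.1.2 := by
    have h1 : ∀ᶠ w : NeckModel n₀ n₁ in 𝓝 v, |w.1.2| < 7 :=
      (by fun_prop : Continuous fun w : NeckModel n₀ n₁ => |w.1.2|).continuousAt.eventually
        (gt_mem_nhds ht)
    filter_upwards [h1] with w hw
    rw [neckMap, neckFun_neck, neckCoord_eq hw.le]
  have hs : ∀ k : Unit, ContMDiff (𝓡 n) 𝓘(ℝ, ℝ) ∞ ((fun _ => G.neckFun neckCoord) k) := fun _ =>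
    G.contMDiff_neckFun contDiff_neckCoord fun _ ht => neckCoord_eq_zero ht
  have h1 := pullForm_sumForm_of_factor (U := fun _ : Unit => G.neckFun a)
    (V := fun _ => G.neckFun neckCoord) (W := fun _ => G.neckFun neckCoord)
    (U' := fun _ _ => 1) (V' := fun _ t => t) (W' := fun _ t => t) (a := a v.1.2) hs hs hv
    (.comp (.snd ℝ _ ℝ) (.fst ℝ _ _)) (fun _ => by rw [neckMap, neckFun_neck, mul_one])
    (fun _ => h0) (fun _ => h0) (fun _ => differentiableAt_id) (fun _ => differentiableAt_id)
  refine h1.trans ?_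
  refine BilForm.ext_apply fun X Y => ?_
  simp [sumBil_apply]

theorem pullForm_auxForm_neckMap {x₀ : M₀} {y₀ : M₁} (l : ℝ)
    {v : NeckModel n₀ n₁}
    (hv : MDifferentiableAt 𝓘(ℝ, NeckModel n₀ n₁) (𝓡 n) (G.neckMap x₀ y₀) v) (ht : -4 < v.1.2) :
    pullForm (G.auxForm l) (G.neckMap x₀ y₀) v = 0 := by
  have h0 : ∀ k, ∀ᶠ w in 𝓝 v, G.pieceFun (F₀.aux k) (G.neckMap x₀ y₀ w) = 0 := by
    intro k
    have h1 : ∀ᶠ w : NeckModel n₀ n₁ in 𝓝 v, -4 < w.1.2 :=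
      (by fun_prop : Continuous fun w : NeckModel n₀ n₁ => w.1.2).continuousAt.eventually
        (lt_mem_nhds ht)
    filter_upwards [h1] with w hw using G.pieceFun_neck (F₀.aux_eq_zero k) _ _ hw.le
  have hs := fun k => G.contMDiff_pieceFun (F₀.contMDiff_aux k) (F₀.aux_eq_zero k)
  refine (pullForm_sumForm_of_factor (a := l) (U' := fun _ _ => 1) (V' := fun _ _ => 0)
    (W' := fun _ _ => 0) hs hs hv (.id ℝ _) (fun _ => (mul_one l).symm) h0 h0
    (fun _ => differentiableAt_const _) (fun _ => differentiableAt_const _)).trans ?_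
  refine BilForm.ext_apply fun X Y => ?_
  simp [sumBil_apply]

theorem pullForm_swap_auxForm_neckMap {x₀ : M₀} {y₀ : M₁} (m : ℝ)
    {v : NeckModel n₀ n₁}
    (hv : MDifferentiableAt 𝓘(ℝ, NeckModel n₀ n₁) (𝓡 n) (G.neckMap x₀ y₀) v) (ht : v.1.2 < 4) :
    pullForm (G.swap.auxForm m) (G.neckMap x₀ y₀) v = 0 := by
  have h0 : ∀ k, ∀ᶠ w in 𝓝 v, G.swap.pieceFun (F₁.aux k) (G.neckMap x₀ y₀ w) = 0 := by
    intro k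
    have h1 : ∀ᶠ w : NeckModel n₀ n₁ in 𝓝 v, w.1.2 < 4 :=
      (by fun_prop : Continuous fun w : NeckModel n₀ n₁ => w.1.2).continuousAt.eventually
        (gt_mem_nhds ht)
    filter_upwards [h1] with w hw
    rw [neckMap, neck_eq_swap_neck, G.swap.pieceFun_neck (F₁.aux_eq_zero k) _ _ (by linarith)]
  have hs := fun k => G.swap.contMDiff_pieceFun (F₁.contMDiff_aux k) (F₁.aux_eq_zero k)
  refine (pullForm_sumForm_of_factor (a := m) (U' := fun _ _ => 1) (V' := fun _ _ => 0)
    (W' := fun _ _ => 0) hs hs hv (.id ℝ _) (fun _ => (mul_one m).symm) h0 h0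
    (fun _ => differentiableAt_const _) (fun _ => differentiableAt_const _)).trans ?_
  refine BilForm.ext_apply fun X Y => ?_
  simp [sumBil_apply]

/-- Up to the contributions of the auxiliary functions, the metric on the neck is
`A(t) g₀ + γ(t) dt² + B(t) g₁`, where `B` mirrors `A`. -/
theorem pullForm_totalForm_neckMap [CompactSpace M₀] [CompactSpace M₁] [T2Space W₀] [T2Space W₁]
    [T2Space M] {x₀ : M₀} {y₀ : M₁} (l N m : ℝ)
    {v : NeckModel n₀ n₁}
    (hv : MDifferentiableAt 𝓘(ℝ, NeckModel n₀ n₁) (𝓡 n) (G.neckMap x₀ y₀) v)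
    (h0 : v.1.1 ∈ (extChartAt (𝓡 n₀) x₀).target) (h1 : v.2 ∈ (extChartAt (𝓡 n₁) y₀).target)
    (ht : |v.1.2| < 7) :
    pullForm (G.totalForm l N m) (G.neckMap x₀ y₀) v =
      prodForm (warpForm (pullForm g₀.inner (extChartAt (𝓡 n₀) x₀).symm v.1.1)
          (scaleProfile l v.1.2) (neckProfile l N m v.1.2))
        (scaleProfile m (-v.1.2) • pullForm g₁.inner (extChartAt (𝓡 n₁) y₀).symm v.2)
      + (pullForm (G.auxForm l) (G.neckMap x₀ y₀) v
        + pullForm (G.swap.auxForm m) (G.neckMap x₀ y₀) v) := by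
  rw [totalForm, pullForm_add, pullForm_add, pullForm_add, pullForm_add]
  beta_reduce
  have ht' := abs_lt.mp ht
  rw [G.pullForm_baseForm_neckMap l hv h0 ht'.1, G.pullForm_swap_baseForm_neckMap m hv h1 ht'.2,
    G.pullForm_neckForm_neckMap _ hv ht]
  refine BilForm.ext_apply fun X Y => ?_
  simp
  ring

/-- In the left half of the neck, up to depth `4`, the metric is the product of a warped product
with `M₁`. -/
theorem eventually_pullForm_totalForm_neckMap [CompactSpace M₀] [CompactSpace M₁] [T2Space W₀]
    [T2Space W₁] [T2Space M] [IsManifold (𝓡 n) ∞ M] {x₀ : M₀} {y₀ : M₁} (l N m : ℝ) {t : ℝ}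
    (ht : -4 < t) (ht' : t ≤ 0) :
    pullForm (G.totalForm l N m) (G.neckMap x₀ y₀) =ᶠ[𝓝 (neckPoint n₀ n₁ x₀ y₀ t)] fun v =>
      prodForm (warpForm (pullForm g₀.inner (extChartAt (𝓡 n₀) x₀).symm v.1.1)
          (scaleProfile l v.1.2) (neckProfile l N m v.1.2))
        (pullForm g₁.inner (extChartAt (𝓡 n₁) y₀).symm v.2) := by
  have h0 : ∀ᶠ v in 𝓝 (neckPoint n₀ n₁ x₀ y₀ t), v.1.1 ∈ (extChartAt (𝓡 n₀) x₀).target :=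
    (continuous_fst.comp continuous_fst).continuousAt.eventually
      (show _ ∈ 𝓝 (extChartAt (𝓡 n₀) x₀ x₀) from extChartAt_target_mem_nhds (I := 𝓡 n₀) x₀)
  have h1 : ∀ᶠ v in 𝓝 (neckPoint n₀ n₁ x₀ y₀ t), v.2 ∈ (extChartAt (𝓡 n₁) y₀).target :=
    continuous_snd.continuousAt.eventually
      (show _ ∈ 𝓝 (extChartAt (𝓡 n₁) y₀ y₀) from extChartAt_target_mem_nhds (I := 𝓡 n₁) y₀)
  have h2 : ∀ᶠ v in 𝓝 (neckPoint n₀ n₁ x₀ y₀ t), v.1.2 ∈ Ioo (-4) 1 :=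
    (continuous_snd.comp continuous_fst).continuousAt.eventually
      (Ioo_mem_nhds ht (by linarith : t < 1))
  filter_upwards [h0, h1, h2, (G.isParam_neckMap x₀ y₀ t).eventually_mdifferentiableAt]
    with v h0 h1 h2 hv
  rw [G.pullForm_totalForm_neckMap l N m hv h0 h1 (abs_lt.mpr ⟨by linarith [h2.1],
    by linarith [h2.2]⟩), G.pullForm_auxForm_neckMap l hv h2.1,
    G.pullForm_swap_auxForm_neckMap m hv (by linarith [h2.2]),
    scaleProfile_eq_one m (by linarith [h2.2]), one_smul, add_zero, add_zero]

end CollaredGluing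

end NeckPart

/-! ### The metric in coordinates: the interior of the pieces -/

section LeftPart

namespace CollaredFilling

variable {n : ℕ} {M W : Type*} [TopologicalSpace M] [ChartedSpace (EuclideanSpace ℝ (Fin n)) M]
  [IsManifold (𝓡 n) ∞ M] [TopologicalSpace W] [ChartedSpace (EuclideanHalfSpace (n + 1)) W]
  {g : SmoothMetric n M} (F : CollaredFilling g W)

theorem collarFun_eq_mul {a b : ℝ → ℝ} {f : M → ℝ} {l r : ℝ} (h : ∀ t ≤ -r, a t = l * b t) {w : W}
    (hw : w ∉ F.collar '' {p | halfLineCoord p.2 ≤ r}) :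
    F.collarFun a f w = l * F.collarFun b f w := by
  by_cases hr : w ∈ range F.collar
  · obtain ⟨x, s, hs, rfl⟩ := F.exists_of_mem_range hr
    have h1 : r < s := by
      by_contra! h1
      exact hw ⟨_, by rwa [mem_ofPred_eq, halfLineCoord_halfLinePoint hs], rfl⟩
    rw [F.collarFun_collar x hs, F.collarFun_collar x hs, h _ (by linarith), mul_assoc]
  · rw [F.collarFun_of_notMem hr, F.collarFun_of_notMem hr, mul_zero]

theorem contMDiff_collarFun_deepProfile [CompactSpace M] [T2Space W] {f : M → ℝ}
    (hf : ContMDiff (𝓡 n) 𝓘(ℝ, ℝ) ∞ f) :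
    ContMDiff (𝓡∂ (n + 1)) 𝓘(ℝ, ℝ) ∞ (F.collarFun deepProfile f) :=
  F.contMDiff_collarFun contDiff_deepProfile (fun _ => deepProfile_eq_zero) hf

theorem contMDiff_collarFun_cutProfile [CompactSpace M] [T2Space W] {f : M → ℝ}
    (hf : ContMDiff (𝓡 n) 𝓘(ℝ, ℝ) ∞ f) :
    ContMDiff (𝓡∂ (n + 1)) 𝓘(ℝ, ℝ) ∞ (F.collarFun cutProfile f) :=
  F.contMDiff_collarFun contDiff_cutProfile (fun _ => cutProfile_eq_zero) hf

theorem contMDiff_collarFun_neckCoord [CompactSpace M] [T2Space W] :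
    ContMDiff (𝓡∂ (n + 1)) 𝓘(ℝ, ℝ) ∞ (F.collarFun neckCoord fun _ => 1) :=
  F.contMDiff_collarFun contDiff_neckCoord (r := 8)
    (fun t ht => neckCoord_eq_zero (le_abs.mpr (Or.inr (by linarith)))) contMDiff_const

/-- The metric on the part of `W` of depth at least `4`, in a parametrization `χ`. It does not
involve the parameters of the metric on the glued manifold, which restricts to `l` times this
metric. -/
def deepForm (χ : EuclideanSpace ℝ (Fin (n + 1)) → W) (ξ : EuclideanSpace ℝ (Fin (n + 1))) :
    BilForm (EuclideanSpace ℝ (Fin (n + 1))) :=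
  sumBil (fun k => F.collarFun deepProfile (F.coef k) ∘ χ)
      (fun k => F.collarFun cutProfile (F.pot k) ∘ χ)
      (fun k => F.collarFun cutProfile (F.pot' k) ∘ χ) ξ
    + (sumBil (fun _ : Unit => F.collarFun deepProfile (fun _ => 1) ∘ χ)
        (fun _ => F.collarFun neckCoord (fun _ => 1) ∘ χ)
        (fun _ => F.collarFun neckCoord (fun _ => 1) ∘ χ) ξ
      + sumBil (fun _ _ => 1) (fun k => F.aux k ∘ χ) (fun k => F.aux k ∘ χ) ξ)

theorem contDiffAt_deepForm [CompactSpace M] [T2Space W]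
    {χ : EuclideanSpace ℝ (Fin (n + 1)) → W} {ξ : EuclideanSpace ℝ (Fin (n + 1))}
    (hχ : ContMDiffAt 𝓘(ℝ, EuclideanSpace ℝ (Fin (n + 1))) (𝓡∂ (n + 1)) ∞ χ ξ) :
    ContDiffAt ℝ ∞ (F.deepForm χ) ξ := by
  have h : ∀ {f : W → ℝ}, ContMDiff (𝓡∂ (n + 1)) 𝓘(ℝ, ℝ) ∞ f → ContDiffAt ℝ ∞ (f ∘ χ) ξ :=
    fun hf => (hf.contMDiffAt.comp ξ hχ).contDiffAt
  exact (contDiffAt_sumBil (fun k => h (F.contMDiff_collarFun_deepProfile (F.contMDiff_coef k)))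
      (fun k => h (F.contMDiff_collarFun_cutProfile (F.contMDiff_pot k)))
      (fun k => h (F.contMDiff_collarFun_cutProfile (F.contMDiff_pot' k)))).add
    ((contDiffAt_sumBil (fun _ => h (F.contMDiff_collarFun_deepProfile contMDiff_const))
      (fun _ => h F.contMDiff_collarFun_neckCoord) (fun _ => h F.contMDiff_collarFun_neckCoord)).add
    (contDiffAt_sumBil (fun _ => contDiffAt_const) (fun k => h (F.contMDiff_aux k))
      (fun k => h (F.contMDiff_aux k))))

/-- At depth at least `6`, only the auxiliary functions contribute to the metric. -/
theorem deepForm_apply_of_mem {χ : EuclideanSpace ℝ (Fin (n + 1)) → W}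
    {ξ : EuclideanSpace ℝ (Fin (n + 1))} (h : χ ξ ∈ collarCore F.collar 6)
    (X Y : EuclideanSpace ℝ (Fin (n + 1))) :
    F.deepForm χ ξ X Y = ∑ k, fderiv ℝ (F.aux k ∘ χ) ξ X * fderiv ℝ (F.aux k ∘ χ) ξ Y := by
  have h1 : ∀ f : M → ℝ, F.collarFun deepProfile f (χ ξ) = 0 := fun f =>
    F.collarFun_eq_zero (fun _ => deepProfile_eq_zero) h
  simp [deepForm, sumBil_apply, h1]

end CollaredFilling

variable {n₀ n₁ n : ℕ} {M₀ W₀ M₁ W₁ M : Type*}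
  [TopologicalSpace M₀] [ChartedSpace (EuclideanSpace ℝ (Fin n₀)) M₀] [IsManifold (𝓡 n₀) ∞ M₀]
  [TopologicalSpace M₁] [ChartedSpace (EuclideanSpace ℝ (Fin n₁)) M₁] [IsManifold (𝓡 n₁) ∞ M₁]
  [TopologicalSpace W₀] [ChartedSpace (EuclideanHalfSpace (n₀ + 1)) W₀]
  [TopologicalSpace W₁] [ChartedSpace (EuclideanHalfSpace (n₁ + 1)) W₁]
  {g₀ : SmoothMetric n₀ M₀} {g₁ : SmoothMetric n₁ M₁}
  {F₀ : CollaredFilling g₀ W₀} {F₁ : CollaredFilling g₁ W₁}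
  [TopologicalSpace M] [ChartedSpace (EuclideanSpace ℝ (Fin n)) M]

/-- The model space of the interior of `W₀ × M₁`. -/
abbrev LeftModel (n₀ n₁ : ℕ) : Type :=
  EuclideanSpace ℝ (Fin (n₀ + 1)) × EuclideanSpace ℝ (Fin n₁)

namespace CollaredGluing

variable (G : CollaredGluing F₀ F₁ n M)

/-- Coordinates on the interior of the left piece, from the preferred charts at `w₀ ∈ W₀` and
`y₀ ∈ M₁`. -/
def leftMap (w₀ : W₀) (y₀ : M₁) (v : LeftModel n₀ n₁) : M :=
  G.left ((extChartAt (𝓡∂ (n₀ + 1)) w₀).symm v.1, (extChartAt (𝓡 n₁) y₀).symm v.2)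

/-- The coordinates of the point `(w, y₀)` of the left piece. -/
def leftPoint (n₀ n₁ : ℕ) {W₀ M₁ : Type*}
    [TopologicalSpace W₀] [ChartedSpace (EuclideanHalfSpace (n₀ + 1)) W₀]
    [TopologicalSpace M₁] [ChartedSpace (EuclideanSpace ℝ (Fin n₁)) M₁] (w₀ w : W₀) (y₀ : M₁) :
    LeftModel n₀ n₁ :=
  (extChartAt (𝓡∂ (n₀ + 1)) w₀ w, extChartAt (𝓡 n₁) y₀ y₀)

variable {w₀ w : W₀} {y₀ : M₁}

theorem leftMap_leftPoint (hw : w ∈ (chartAt (EuclideanHalfSpace (n₀ + 1)) w₀).source) (y₀ : M₁) :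
    G.leftMap w₀ y₀ (leftPoint n₀ n₁ w₀ w y₀) = G.left (w, y₀) := by
  rw [leftMap, leftPoint, (extChartAt (𝓡∂ (n₀ + 1)) w₀).left_inv (by rwa [extChartAt_source]),
    extChartAt_to_inv]

theorem isParam_leftMap [IsManifold (𝓡∂ (n₀ + 1)) ∞ W₀]
    (hw : w ∈ (chartAt (EuclideanHalfSpace (n₀ + 1)) w₀).source)
    (hi : (𝓡∂ (n₀ + 1)).IsInteriorPoint w) (y₀ : M₁) :
    IsParam n (G.leftMap w₀ y₀) (leftPoint n₀ n₁ w₀ w y₀) := by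
  have h0 := isLocalParam_extChartAt_symm hw hi
  have h1 := isLocalParam_extChartAt_symm (I := 𝓡 n₁) (mem_chart_source _ y₀)
    BoundarylessManifold.isInteriorPoint
  refine ((h0.prod h1).comp_localDiffeomorph
    (G.isLocalDiffeomorphAt_left _ _ ?_)).isParam
  rwa [(extChartAt (𝓡∂ (n₀ + 1)) w₀).left_inv (by rwa [extChartAt_source])]

/-- At depth more than `7/2`, the metric on the left piece is a product. -/
theorem pullForm_totalForm_leftMap [CompactSpace M₀] [CompactSpace M₁] [T2Space W₀] [T2Space W₁]
    [T2Space M] (l N m : ℝ) {v : LeftModel n₀ n₁}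
    (hv : MDifferentiableAt 𝓘(ℝ, LeftModel n₀ n₁) (𝓡 n) (G.leftMap w₀ y₀) v)
    (hχ : MDifferentiableAt 𝓘(ℝ, EuclideanSpace ℝ (Fin (n₀ + 1))) (𝓡∂ (n₀ + 1))
      (extChartAt (𝓡∂ (n₀ + 1)) w₀).symm v.1)
    (h1 : v.2 ∈ (extChartAt (𝓡 n₁) y₀).target)
    (h : (extChartAt (𝓡∂ (n₀ + 1)) w₀).symm v.1
      ∉ F₀.collar '' {p | halfLineCoord p.2 ≤ 7 / 2}) :
    pullForm (G.totalForm l N m) (G.leftMap w₀ y₀) v =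
      prodForm (l • F₀.deepForm (extChartAt (𝓡∂ (n₀ + 1)) w₀).symm v.1)
        (pullForm g₁.inner (extChartAt (𝓡 n₁) y₀).symm v.2) := by
  have hd : ∀ {f : W₀ → ℝ}, ContMDiff (𝓡∂ (n₀ + 1)) 𝓘(ℝ, ℝ) ∞ f →
      DifferentiableAt ℝ (f ∘ (extChartAt (𝓡∂ (n₀ + 1)) w₀).symm) v.1 := fun hf =>
    mdifferentiableAt_iff_differentiableAt.mp
      ((hf.contMDiffAt.mdifferentiableAt (by simp)).comp _ hχ)
  have hb : pullForm (G.baseForm l) (G.leftMap w₀ y₀) v = l • (sumBil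
      (fun k => F₀.collarFun deepProfile (F₀.coef k) ∘ (extChartAt (𝓡∂ (n₀ + 1)) w₀).symm)
      (fun k => F₀.collarFun cutProfile (F₀.pot k) ∘ (extChartAt (𝓡∂ (n₀ + 1)) w₀).symm)
      (fun k => F₀.collarFun cutProfile (F₀.pot' k) ∘ (extChartAt (𝓡∂ (n₀ + 1)) w₀).symm)
      v.1).bilinearComp (.fst ℝ _ _) (.fst ℝ _ _) := by
    refine pullForm_sumForm_of_factor
      (fun k => G.contMDiff_baseFun_cutProfile (F₀.contMDiff_pot k))
      (fun k => G.contMDiff_baseFun_cutProfile (F₀.contMDiff_pot' k)) hv (.fst ℝ _ _) (fun k => ?_)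
      (fun k => .of_forall fun w => G.baseFun_left _ _)
      (fun k => .of_forall fun w => G.baseFun_left _ _)
      (fun k => hd (F₀.contMDiff_collarFun_cutProfile (F₀.contMDiff_pot k)))
      (fun k => hd (F₀.contMDiff_collarFun_cutProfile (F₀.contMDiff_pot' k)))
    rw [leftMap, baseFun_left]
    exact F₀.collarFun_eq_mul (fun t ht => scaleProfile_eq_mul l (by linarith)) h
  have hb' : pullForm (G.swap.baseForm m) (G.leftMap w₀ y₀) v =
      (1 : ℝ) • (pullForm g₁.inner (extChartAt (𝓡 n₁) y₀).symm v.2).bilinearComp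
        (.snd ℝ _ _) (.snd ℝ _ _) := by
    rw [pullForm_extChartAt_eq_sumBil F₁.inner_eq F₁.contMDiff_pot F₁.contMDiff_pot' h1]
    exact pullForm_sumForm_of_factor
      (fun k => G.swap.contMDiff_baseFun_cutProfile (F₁.contMDiff_pot k))
      (fun k => G.swap.contMDiff_baseFun_cutProfile (F₁.contMDiff_pot' k)) hv (.snd ℝ _ _)
      (fun k => (G.swap.baseFun_right (scaleProfile_eq_one m (by norm_num)) _ _).trans
        (one_mul _).symm)
      (fun k => .of_forall fun w => G.swap.baseFun_right (cutProfile_eq_one (by norm_num)) _ _)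
      (fun k => .of_forall fun w => G.swap.baseFun_right (cutProfile_eq_one (by norm_num)) _ _)
      (fun k => .comp_extChartAt_symm (F₁.contMDiff_pot k) h1)
      (fun k => .comp_extChartAt_symm (F₁.contMDiff_pot' k) h1)
  have hn : pullForm (G.neckForm (neckProfile l N m)) (G.leftMap w₀ y₀) v = l • (sumBil
      (fun _ : Unit => F₀.collarFun deepProfile (fun _ => 1) ∘ (extChartAt (𝓡∂ (n₀ + 1)) w₀).symm)
      (fun _ => F₀.collarFun neckCoord (fun _ => 1) ∘ (extChartAt (𝓡∂ (n₀ + 1)) w₀).symm)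
      (fun _ => F₀.collarFun neckCoord (fun _ => 1) ∘ (extChartAt (𝓡∂ (n₀ + 1)) w₀).symm)
      v.1).bilinearComp (.fst ℝ _ _) (.fst ℝ _ _) := by
    have hs := G.contMDiff_neckFun contDiff_neckCoord fun _ ht => neckCoord_eq_zero ht
    refine pullForm_sumForm_of_factor (fun _ => hs) (fun _ => hs) hv (.fst ℝ _ _) (fun k => ?_)
      (fun k => .of_forall fun w => G.neckFun_left _ _)
      (fun k => .of_forall fun w => G.neckFun_left _ _)
      (fun k => hd F₀.contMDiff_collarFun_neckCoord) (fun k => hd F₀.contMDiff_collarFun_neckCoord)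
    rw [leftMap, neckFun_left]
    exact F₀.collarFun_eq_mul (fun t ht => neckProfile_eq_mul l N m (by linarith)) h
  have ha : pullForm (G.auxForm l) (G.leftMap w₀ y₀) v = l • (sumBil (fun _ _ => 1)
      (fun k => F₀.aux k ∘ (extChartAt (𝓡∂ (n₀ + 1)) w₀).symm)
      (fun k => F₀.aux k ∘ (extChartAt (𝓡∂ (n₀ + 1)) w₀).symm) v.1).bilinearComp
        (.fst ℝ _ _) (.fst ℝ _ _) := by
    have hs := fun k => G.contMDiff_pieceFun (F₀.contMDiff_aux k) (F₀.aux_eq_zero k)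
    exact pullForm_sumForm_of_factor hs hs hv (.fst ℝ _ _) (fun _ => (mul_one l).symm)
      (fun k => .of_forall fun w => G.pieceFun_left _ _)
      (fun k => .of_forall fun w => G.pieceFun_left _ _)
      (fun k => hd (F₀.contMDiff_aux k)) (fun k => hd (F₀.contMDiff_aux k))
  have ha' : pullForm (G.swap.auxForm m) (G.leftMap w₀ y₀) v = 0 := by
    have hs := fun k => G.swap.contMDiff_pieceFun (F₁.contMDiff_aux k) (F₁.aux_eq_zero k)
    refine (pullForm_sumForm_of_factor (a := m) (U' := fun _ _ => 1) (V' := fun _ _ => 0)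
      (W' := fun _ _ => 0) hs hs hv (.id ℝ _) (fun _ => (mul_one m).symm)
      (fun k => .of_forall fun w => G.swap.pieceFun_right (F₁.aux_eq_zero k) _ _)
      (fun k => .of_forall fun w => G.swap.pieceFun_right (F₁.aux_eq_zero k) _ _)
      (fun _ => differentiableAt_const _) (fun _ => differentiableAt_const _)).trans ?_
    refine BilForm.ext_apply fun X Y => ?_
    simp [sumBil_apply]
  rw [totalForm, pullForm_add, pullForm_add, pullForm_add, pullForm_add]
  beta_reduce
  rw [hb, hb', hn, ha, ha']
  refine BilForm.ext_apply fun X Y => ?_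
  simp [CollaredFilling.deepForm]
  ring

theorem eventually_pullForm_totalForm_leftMap [CompactSpace M₀] [CompactSpace M₁] [T2Space W₀]
    [T2Space W₁] [T2Space M] [IsManifold (𝓡 n) ∞ M] [IsManifold (𝓡∂ (n₀ + 1)) ∞ W₀]
    (l N m : ℝ) (hw : w ∈ (chartAt (EuclideanHalfSpace (n₀ + 1)) w₀).source)
    (hc : w ∈ collarCore F₀.collar 4) (y₀ : M₁) :
    pullForm (G.totalForm l N m) (G.leftMap w₀ y₀) =ᶠ[𝓝 (leftPoint n₀ n₁ w₀ w y₀)] fun v =>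
      prodForm (l • F₀.deepForm (extChartAt (𝓡∂ (n₀ + 1)) w₀).symm v.1)
        (pullForm g₁.inner (extChartAt (𝓡 n₁) y₀).symm v.2) := by
  have hi := F₀.isInteriorPoint_of_mem_collarCore (by norm_num) hc
  have hp := isLocalParam_extChartAt_symm hw hi
  have h1 : ∀ᶠ v in 𝓝 (leftPoint n₀ n₁ w₀ w y₀), v.2 ∈ (extChartAt (𝓡 n₁) y₀).target :=
    continuous_snd.continuousAt.eventually
      (show _ ∈ 𝓝 (extChartAt (𝓡 n₁) y₀ y₀) from extChartAt_target_mem_nhds (I := 𝓡 n₁) y₀)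
  have h2 : ∀ᶠ ξ in 𝓝 (extChartAt (𝓡∂ (n₀ + 1)) w₀ w),
      ContMDiffAt 𝓘(ℝ, EuclideanSpace ℝ (Fin (n₀ + 1))) (𝓡∂ (n₀ + 1)) 1
        (extChartAt (𝓡∂ (n₀ + 1)) w₀).symm ξ := by
    have : IsManifold (𝓡∂ (n₀ + 1)) 1 W₀ := .of_le one_le_infty
    exact (contMDiffAt_iff_contMDiffAt_nhds (by simp)).mp (hp.contMDiffAt.of_le one_le_infty)
  have h3 : ∀ᶠ ξ in 𝓝 (extChartAt (𝓡∂ (n₀ + 1)) w₀ w), (extChartAt (𝓡∂ (n₀ + 1)) w₀).symm ξ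
      ∉ F₀.collar '' {p | halfLineCoord p.2 ≤ 7 / 2} := by
    have h4 := hp.contMDiffAt.continuousAt
    rw [ContinuousAt, (extChartAt (𝓡∂ (n₀ + 1)) w₀).left_inv (by rwa [extChartAt_source])] at h4
    exact h4.eventually (collarCore_mem_nhds F₀.isLocalDiffeomorph (by norm_num) hc)
  have hf : Tendsto Prod.fst (𝓝 (leftPoint n₀ n₁ w₀ w y₀)) (𝓝 (extChartAt (𝓡∂ (n₀ + 1)) w₀ w)) :=
    continuous_fst.continuousAt
  filter_upwards [h1, hf.eventually h2, hf.eventually h3,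
    (G.isParam_leftMap hw hi y₀).eventually_mdifferentiableAt] with v h1 h2 h3 hv
  exact G.pullForm_totalForm_leftMap l N m hv (h2.mdifferentiableAt one_ne_zero) h1 h3

end CollaredGluing

end LeftPart

/-! ### Positive definiteness -/

section Inner

variable {E : Type*} [NormedAddCommGroup E] [NormedSpace ℝ E]
  {F : Type*} [NormedAddCommGroup F] [NormedSpace ℝ F]

theorem IsInnerForm.add_of_nonneg {B C : BilForm E} (hB : IsInnerForm B)
    (hs : ∀ X Y, C X Y = C Y X) (hC : ∀ X, 0 ≤ C X X) : IsInnerForm (B + C) where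
  symm X Y := by simp [hB.symm X Y, hs X Y]
  pos X hX := add_pos_of_pos_of_nonneg (hB.pos X hX) (hC X)

theorem IsInnerForm.of_prod {B : BilForm E} {C : BilForm F} (h : IsInnerForm (prodForm B C)) :
    IsInnerForm B where
  symm X Y := by simpa using h.symm (X, 0) (Y, 0)
  pos X hX := by simpa using h.pos (X, 0) (by simpa using hX)

/-- Positive definiteness can be checked in a parametrization. -/
theorem IsParam.isInnerForm {n : ℕ} {M : Type*} [TopologicalSpace M]
    [ChartedSpace (EuclideanSpace ℝ (Fin n)) M] {b : FormField n M} {ψ : E → M} {u : E}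
    (hψ : IsParam n ψ u) (h : IsInnerForm (pullForm b ψ u)) :
    IsInnerForm (E := EuclideanSpace ℝ (Fin n)) (b (ψ u)) := by
  obtain ⟨e, he⟩ := hψ.invertible
  have key : ∀ X Y : EuclideanSpace ℝ (Fin n),
      (b (ψ u) : BilForm (EuclideanSpace ℝ (Fin n))) X Y
        = pullForm b ψ u (e.symm X) (e.symm Y) := by
    intro X Y
    have h1 : ∀ Z : EuclideanSpace ℝ (Fin n), Z = paramDeriv n ψ u (e.symm Z) := fun Z => by
      rw [← he]
      exact (e.apply_symm_apply Z).symm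
    have h2 : ∀ Z Z' : EuclideanSpace ℝ (Fin n), Z = X → Z' = Y →
        (b (ψ u) : BilForm (EuclideanSpace ℝ (Fin n))) X Y
          = (b (ψ u) : BilForm (EuclideanSpace ℝ (Fin n))) Z Z' := by
      rintro _ _ rfl rfl; rfl
    exact h2 _ _ (h1 X).symm (h1 Y).symm
  constructor
  · exact fun X Y => (key X Y).trans ((h.symm _ _).trans (key Y X).symm)
  · exact fun X hX => (h.pos _ fun h0 => hX (e.symm.map_eq_zero_iff.mp h0)).trans_eq (key X X).symm

end Inner

section Positivity

variable {n₀ n₁ n : ℕ} {M₀ W₀ M₁ W₁ M : Type*}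
  [TopologicalSpace M₀] [ChartedSpace (EuclideanSpace ℝ (Fin n₀)) M₀] [IsManifold (𝓡 n₀) ∞ M₀]
  [TopologicalSpace M₁] [ChartedSpace (EuclideanSpace ℝ (Fin n₁)) M₁] [IsManifold (𝓡 n₁) ∞ M₁]
  [TopologicalSpace W₀] [ChartedSpace (EuclideanHalfSpace (n₀ + 1)) W₀]
  [TopologicalSpace W₁] [ChartedSpace (EuclideanHalfSpace (n₁ + 1)) W₁]
  {g₀ : SmoothMetric n₀ M₀} {g₁ : SmoothMetric n₁ M₁}
  {F₀ : CollaredFilling g₀ W₀} {F₁ : CollaredFilling g₁ W₁}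
  [TopologicalSpace M] [ChartedSpace (EuclideanSpace ℝ (Fin n)) M]

/-- Beyond depth `6`, the auxiliary functions alone make the metric positive definite. -/
theorem CollaredFilling.exists_isInnerForm_deepForm {w : W₀} (hw : w ∈ collarCore F₀.collar 6) :
    ∃ w₀, w ∈ (chartAt (EuclideanHalfSpace (n₀ + 1)) w₀).source ∧
      IsInnerForm (F₀.deepForm (extChartAt (𝓡∂ (n₀ + 1)) w₀).symm
        (extChartAt (𝓡∂ (n₀ + 1)) w₀ w)) := by
  have h5 : w ∈ collarCore F₀.collar 5 := by
    by_contra h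
    obtain ⟨x, s, hs, hs5, rfl⟩ := notMem_collarCore.mp h
    linarith [(apply_mem_collarCore F₀.injective hs).mp hw]
  obtain ⟨w₀, hw₀, hi⟩ := F₀.immersive w h5
  have h6 : (extChartAt (𝓡∂ (n₀ + 1)) w₀).symm (extChartAt (𝓡∂ (n₀ + 1)) w₀ w)
      ∈ collarCore F₀.collar 6 := by
    rwa [(extChartAt (𝓡∂ (n₀ + 1)) w₀).left_inv (by rwa [extChartAt_source])]
  refine ⟨w₀, hw₀, fun X Y => ?_, fun X hX => ?_⟩
  · rw [F₀.deepForm_apply_of_mem h6, F₀.deepForm_apply_of_mem h6]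
    exact Finset.sum_congr rfl fun k _ => mul_comm _ _
  · rw [F₀.deepForm_apply_of_mem h6]
    have h0 : ∃ k, fderiv ℝ (F₀.aux k ∘ (extChartAt (𝓡∂ (n₀ + 1)) w₀).symm)
        (extChartAt (𝓡∂ (n₀ + 1)) w₀ w) X ≠ 0 := by
      by_contra! h
      exact hX (hi X h)
    obtain ⟨k, hk⟩ := h0
    exact Finset.sum_pos' (fun k _ => mul_self_nonneg _) ⟨k, Finset.mem_univ _,
      mul_self_pos.mpr hk⟩

namespace CollaredGluing

variable (G : CollaredGluing F₀ F₁ n M) {l N m : ℝ}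

theorem pullForm_auxForm_apply {E : Type*} [NormedAddCommGroup E] [NormedSpace ℝ E] {ψ : E → M}
    {v : E} (hψ : MDifferentiableAt 𝓘(ℝ, E) (𝓡 n) ψ v) (X Y : E) :
    pullForm (G.auxForm l) ψ v X Y = ∑ k, l *
      (fderiv ℝ (G.pieceFun (F₀.aux k) ∘ ψ) v X * fderiv ℝ (G.pieceFun (F₀.aux k) ∘ ψ) v Y) := by
  have hs : ∀ k, MDifferentiableAt (𝓡 n) 𝓘(ℝ, ℝ) (G.pieceFun (F₀.aux k)) (ψ v) := fun k =>
    (G.contMDiff_pieceFun (F₀.contMDiff_aux k) (F₀.aux_eq_zero k)).contMDiffAt.mdifferentiableAt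
      (by simp)
  rw [auxForm, pullForm_sumForm hs hs hψ, sumBil_apply]
  rfl

variable [CompactSpace M₀] [CompactSpace M₁] [T2Space W₀] [T2Space W₁] [T2Space M]
  [IsManifold (𝓡 n) ∞ M]

/-- The metric is positive definite on the left piece. Beyond depth `6` it is so since it is a
product and the differentials of the auxiliary functions span; up to depth `6` the neck metric is
positive definite already, and the auxiliary functions contribute a nonnegative form. -/
theorem isInnerForm_totalForm_left [IsManifold (𝓡∂ (n₀ + 1)) ∞ W₀] (hl : 0 < l) (hN : 0 < N)
    (hm : 0 < m) (w : W₀) (y : M₁) :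
    IsInnerForm (E := EuclideanSpace ℝ (Fin n)) (G.totalForm l N m (G.left (w, y))) := by
  have hg₁ := g₁.isInnerForm_pullForm
    (isParam_extChartAt_symm (n := n₁) y (mem_extChartAt_target y))
  by_cases hw : w ∈ collarCore F₀.collar 6
  · obtain ⟨w₀, hw₀, hi⟩ := CollaredFilling.exists_isInnerForm_deepForm hw
    have h4 : w ∈ collarCore F₀.collar 4 := by
      by_contra h
      obtain ⟨x, s, hs, hs5, rfl⟩ := notMem_collarCore.mp h
      linarith [(apply_mem_collarCore F₀.injective hs).mp hw]
    have hp := G.isParam_leftMap hw₀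
      (F₀.isInteriorPoint_of_mem_collarCore (by norm_num) h4) y
    rw [← G.leftMap_leftPoint hw₀ y]
    refine hp.isInnerForm ?_
    rw [(G.eventually_pullForm_totalForm_leftMap l N m hw₀ h4 y).eq_of_nhds]
    exact (hi.smul hl).prod hg₁
  · obtain ⟨x, s, hs, hs6, rfl⟩ := notMem_collarCore.mp hw
    have hg₀ := g₀.isInnerForm_pullForm
      (isParam_extChartAt_symm (n := n₀) x (mem_extChartAt_target x))
    have hp := G.isParam_neckMap x y (-s)
    have hd := hp.contMDiffAt.mdifferentiableAt (by simp)
    have ht : |(neckPoint n₀ n₁ x y (-s)).1.2| < 6 := by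
      rw [neckPoint, abs_neg, abs_of_nonneg hs]
      exact hs6
    rw [← G.neck_neg x y s hs, ← neckMap_neckPoint]
    refine hp.isInnerForm ?_
    rw [G.pullForm_totalForm_neckMap l N m hd (mem_extChartAt_target x) (mem_extChartAt_target y)
      (by linarith)]
    refine ((hg₀.warp (scaleProfile_pos hl (by linarith [(abs_lt.mp ht).1]))
      (neckProfile_pos hl hN hm ht)).prod (hg₁.smul (scaleProfile_pos hm
        (by linarith [(abs_lt.mp ht).2])))).add_of_nonneg (fun X Y => ?_) (fun X => ?_)
    · rw [add_apply, add_apply, add_apply, add_apply, G.pullForm_auxForm_apply hd,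
        G.pullForm_auxForm_apply hd, G.swap.pullForm_auxForm_apply hd,
        G.swap.pullForm_auxForm_apply hd]
      simp only [mul_comm]
    · rw [add_apply, add_apply, G.pullForm_auxForm_apply hd, G.swap.pullForm_auxForm_apply hd]
      exact add_nonneg (Finset.sum_nonneg fun k _ => mul_nonneg hl.le (mul_self_nonneg _))
        (Finset.sum_nonneg fun k _ => mul_nonneg hm.le (mul_self_nonneg _))

theorem isInnerForm_totalForm [IsManifold (𝓡∂ (n₀ + 1)) ∞ W₀] [IsManifold (𝓡∂ (n₁ + 1)) ∞ W₁]
    (hl : 0 < l) (hN : 0 < N) (hm : 0 < m) (p : M) :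
    IsInnerForm (E := EuclideanSpace ℝ (Fin n)) (G.totalForm l N m p) := by
  rcases G.cover p with ⟨⟨w, y⟩, rfl⟩ | ⟨⟨v, x⟩, rfl⟩
  · exact G.isInnerForm_totalForm_left hl hN hm w y
  · rw [← swap_totalForm]
    exact G.swap.isInnerForm_totalForm_left hm hN hl v x

end CollaredGluing

end Positivity

/-! ### Positivity of the scalar curvature -/

section ScalarCurvature

variable {n₀ n₁ n : ℕ} {M₀ W₀ M₁ W₁ M : Type*}
  [TopologicalSpace M₀] [ChartedSpace (EuclideanSpace ℝ (Fin n₀)) M₀] [IsManifold (𝓡 n₀) ∞ M₀]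
  [TopologicalSpace M₁] [ChartedSpace (EuclideanSpace ℝ (Fin n₁)) M₁] [IsManifold (𝓡 n₁) ∞ M₁]
  [TopologicalSpace W₀] [ChartedSpace (EuclideanHalfSpace (n₀ + 1)) W₀]
  [TopologicalSpace W₁] [ChartedSpace (EuclideanHalfSpace (n₁ + 1)) W₁]
  {g₀ : SmoothMetric n₀ M₀} {g₁ : SmoothMetric n₁ M₁}
  {F₀ : CollaredFilling g₀ W₀} {F₁ : CollaredFilling g₁ W₁}
  [TopologicalSpace M] [ChartedSpace (EuclideanSpace ℝ (Fin n)) M]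

namespace CollaredGluing

variable (G : CollaredGluing F₀ F₁ n M) {l N m : ℝ}
  [CompactSpace M₀] [CompactSpace M₁] [T2Space W₀] [T2Space W₁] [T2Space M]
  [IsManifold (𝓡 n) ∞ M]

/-- The scalar curvature in the left half of the neck, up to depth `4`. -/
theorem scalarCurvature_neck (g : SmoothMetric n M) (hg : g.inner = G.totalForm l N m) (hl : 0 < l)
    (hN : 0 < N) (hm : 0 < m) (x : M₀) (y : M₁) {t : ℝ} (ht : -4 < t) (ht' : t ≤ 0) :
    scalarCurvature g (G.neck ((x, y), t)) = (scaleProfile l t)⁻¹ * scalarCurvature g₀ x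
      + warpTerm n₀ (scaleProfile l) (neckProfile l N m) t + scalarCurvature g₁ y := by
  have p0 := isParam_extChartAt_symm (n := n₀) x (mem_extChartAt_target x)
  have p1 := isParam_extChartAt_symm (n := n₁) y (mem_extChartAt_target y)
  have hA := scaleProfile_pos hl (by linarith : -6 < t)
  have hc := neckProfile_pos hl hN hm (abs_lt.mpr ⟨by linarith, by linarith⟩ : |t| < 6)
  have hwarp : ContDiffAt ℝ ∞ (fun q : EuclideanSpace ℝ (Fin n₀) × ℝ =>
      warpForm (pullForm g₀.inner (extChartAt (𝓡 n₀) x).symm q.1) (scaleProfile l q.2)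
        (neckProfile l N m q.2)) (extChartAt (𝓡 n₀) x x, t) :=
    ContDiffAt.warpForm (g₀.isSmoothForm.contDiffAt_pullForm p0)
      (contDiff_scaleProfile l).contDiffAt (contDiff_neckProfile l N m).contDiffAt
  have hwi : ∀ᶠ q in 𝓝 (extChartAt (𝓡 n₀) x x, t), IsInnerForm
      (warpForm (pullForm g₀.inner (extChartAt (𝓡 n₀) x).symm q.1) (scaleProfile l q.2)
        (neckProfile l N m q.2)) := by
    have e1 := (continuous_fst.tendsto (extChartAt (𝓡 n₀) x x, t)).eventually
      (g₀.eventually_isInnerForm p0)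
    have e2 := ((contDiff_scaleProfile l).continuous.comp continuous_snd).tendsto
      (extChartAt (𝓡 n₀) x x, t) |>.eventually (lt_mem_nhds hA)
    have e3 := ((contDiff_neckProfile l N m).continuous.comp continuous_snd).tendsto
      (extChartAt (𝓡 n₀) x x, t) |>.eventually (lt_mem_nhds hc)
    filter_upwards [e1, e2, e3] with q h1 h2 h3 using h1.warp h2 h3
  rw [← neckMap_neckPoint, scalarCurvature_eq_scalAt g (G.isParam_neckMap x y t), hg,
    scalAt_congr (G.eventually_pullForm_totalForm_neckMap l N m ht ht')]
  have h1 := scalAt_prodForm (p := neckPoint n₀ n₁ x y t) hwarp hwi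
    (g₁.isSmoothForm.contDiffAt_pullForm p1) (g₁.eventually_isInnerForm p1)
  have h2 := scalAt_warpForm (p := (extChartAt (𝓡 n₀) x x, t))
    (g₀.isSmoothForm.contDiffAt_pullForm p0) (g₀.eventually_isInnerForm p0)
    (contDiff_scaleProfile l).contDiffAt hA (contDiff_neckProfile l N m).contDiffAt hc
  refine h1.trans ?_
  rw [scalarCurvature_eq_scalAt_chart g₀ x, scalarCurvature_eq_scalAt_chart g₁ y]
  rw [finrank_euclideanSpace_fin] at h2
  exact congrArg (· + _) h2

variable [IsManifold (𝓡∂ (n₀ + 1)) ∞ W₀]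

/-- Positive definiteness of the metric of depth at least `4` on `W₀`, deduced from that of the
metric on the glued manifold, of which it is a factor. -/
theorem isInnerForm_deepForm (G : CollaredGluing F₀ F₁ n M) [IsManifold (𝓡∂ (n₁ + 1)) ∞ W₁]
    {w₀ w : W₀}
    (hw : w ∈ (chartAt (EuclideanHalfSpace (n₀ + 1)) w₀).source) (hc : w ∈ collarCore F₀.collar 4)
    (y : M₁) : ∀ᶠ ξ in 𝓝 (extChartAt (𝓡∂ (n₀ + 1)) w₀ w),
      IsInnerForm (F₀.deepForm (extChartAt (𝓡∂ (n₀ + 1)) w₀).symm ξ) := by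
  have hp := G.isParam_leftMap hw (F₀.isInteriorPoint_of_mem_collarCore (by norm_num) hc) y
  let g : SmoothMetric n M := .ofForm _ (G.isSmoothForm_totalForm 1 1 1)
    (G.isInnerForm_totalForm one_pos one_pos one_pos)
  have h1 := g.eventually_isInnerForm hp
  have h2 := G.eventually_pullForm_totalForm_leftMap 1 1 1 hw hc y
  have h3 : Tendsto (fun ξ => (ξ, extChartAt (𝓡 n₁) y y)) (𝓝 (extChartAt (𝓡∂ (n₀ + 1)) w₀ w))
      (𝓝 (leftPoint n₀ n₁ w₀ w y)) :=
    (by fun_prop : Continuous fun ξ : EuclideanSpace ℝ (Fin (n₀ + 1)) =>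
      (ξ, extChartAt (𝓡 n₁) y y)).continuousAt
  filter_upwards [h3.eventually (h1.and h2)] with ξ hξ
  have h4 : IsInnerForm (pullForm (G.totalForm 1 1 1) (G.leftMap w₀ y)
    (ξ, extChartAt (𝓡 n₁) y y)) := hξ.1
  rw [hξ.2] at h4
  simpa using h4.of_prod

/-- The scalar curvature of the left piece beyond depth `4`, where the metric is a product. -/
theorem scalarCurvature_left [IsManifold (𝓡∂ (n₁ + 1)) ∞ W₁] (g : SmoothMetric n M)
    (hg : g.inner = G.totalForm l N m) (hl : 0 < l) {w₀ w : W₀}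
    (hw : w ∈ (chartAt (EuclideanHalfSpace (n₀ + 1)) w₀).source) (hc : w ∈ collarCore F₀.collar 4)
    (y : M₁) : scalarCurvature g (G.left (w, y)) =
      l⁻¹ * scalAt (F₀.deepForm (extChartAt (𝓡∂ (n₀ + 1)) w₀).symm) (extChartAt (𝓡∂ (n₀ + 1)) w₀ w)
        + scalarCurvature g₁ y := by
  have hint := F₀.isInteriorPoint_of_mem_collarCore (by norm_num) hc
  have p1 := isParam_extChartAt_symm (n := n₁) y (mem_extChartAt_target y)
  have hd := F₀.contDiffAt_deepForm (isLocalParam_extChartAt_symm hw hint).contMDiffAt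
  have hi := G.isInnerForm_deepForm hw hc y
  rw [← G.leftMap_leftPoint hw y, scalarCurvature_eq_scalAt g (G.isParam_leftMap hw hint y), hg,
    scalAt_congr (G.eventually_pullForm_totalForm_leftMap l N m hw hc y)]
  have h1 := scalAt_prodForm (p := leftPoint n₀ n₁ w₀ w y)
    (H := fun ξ => l • F₀.deepForm (extChartAt (𝓡∂ (n₀ + 1)) w₀).symm ξ) (hd.const_smul l)
    (hi.mono fun _ h => h.smul hl) (g₁.isSmoothForm.contDiffAt_pullForm p1)
    (g₁.eventually_isInnerForm p1)
  refine h1.trans ?_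
  rw [scalarCurvature_eq_scalAt_chart g₁ y]
  exact congrArg (· + _) (scalAt_smul hl hi)

/-- The scalar curvature of the part of `W₀` of depth at least `4` is bounded below; the bound does
not depend on the parameters of the metric. -/
theorem exists_scalAt_deepForm_bound (G : CollaredGluing F₀ F₁ n M) [CompactSpace W₀]
    [IsManifold (𝓡∂ (n₁ + 1)) ∞ W₁] :
    ∃ C : ℝ, ∀ w ∈ collarCore F₀.collar 4, ∀ _ : M₁,
      ∃ w₀, w ∈ (chartAt (EuclideanHalfSpace (n₀ + 1)) w₀).source ∧
        -C ≤ scalAt (F₀.deepForm (extChartAt (𝓡∂ (n₀ + 1)) w₀).symm)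
          (extChartAt (𝓡∂ (n₀ + 1)) w₀ w) := by
  rcases isEmpty_or_nonempty M₁ with hM | ⟨⟨y⟩⟩
  · exact ⟨0, fun _ _ y => hM.elim y⟩
  have hcomp := (isClosed_collarCore F₀.isLocalDiffeomorph 4).isCompact
  suffices h : ∃ C : ℝ, ∀ w ∈ collarCore F₀.collar 4,
      ∃ w₀, w ∈ (chartAt (EuclideanHalfSpace (n₀ + 1)) w₀).source ∧
        -C ≤ scalAt (F₀.deepForm (extChartAt (𝓡∂ (n₀ + 1)) w₀).symm)
          (extChartAt (𝓡∂ (n₀ + 1)) w₀ w) from h.imp fun _ hC w hw _ => hC w hw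
  refine hcomp.induction_on (p := fun s => ∃ C : ℝ, ∀ w ∈ s,
      ∃ w₀, w ∈ (chartAt (EuclideanHalfSpace (n₀ + 1)) w₀).source ∧
        -C ≤ scalAt (F₀.deepForm (extChartAt (𝓡∂ (n₀ + 1)) w₀).symm)
          (extChartAt (𝓡∂ (n₀ + 1)) w₀ w)) ⟨0, fun _ h => h.elim⟩ ?_ ?_ ?_
  · rintro s t hst ⟨C, hC⟩
    exact ⟨C, fun w hw => hC w (hst hw)⟩
  · rintro s t ⟨C, hC⟩ ⟨C', hC'⟩
    refine ⟨max C C', fun w hw => ?_⟩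
    rcases hw with hw | hw
    · obtain ⟨w₀, h1, h2⟩ := hC w hw
      exact ⟨w₀, h1, (neg_le_neg (le_max_left _ _)).trans h2⟩
    · obtain ⟨w₀, h1, h2⟩ := hC' w hw
      exact ⟨w₀, h1, (neg_le_neg (le_max_right _ _)).trans h2⟩
  · intro w₀ hw₀
    have hs := mem_chart_source (EuclideanHalfSpace (n₀ + 1)) w₀
    have hint := F₀.isInteriorPoint_of_mem_collarCore (by norm_num) hw₀
    have hd := F₀.contDiffAt_deepForm (isLocalParam_extChartAt_symm hs hint).contMDiffAt
    have hc : ContinuousAt (fun w => scalAt (F₀.deepForm (extChartAt (𝓡∂ (n₀ + 1)) w₀).symm)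
        (extChartAt (𝓡∂ (n₀ + 1)) w₀ w)) w₀ :=
      ContinuousAt.comp (f := extChartAt (𝓡∂ (n₀ + 1)) w₀)
        (continuousAt_scalAt hd (G.isInnerForm_deepForm hs hw₀ y).self_of_nhds)
        (continuousAt_extChartAt w₀)
    set a := scalAt (F₀.deepForm (extChartAt (𝓡∂ (n₀ + 1)) w₀).symm)
      (extChartAt (𝓡∂ (n₀ + 1)) w₀ w₀)
    have h1 := hc.eventually (lt_mem_nhds (sub_one_lt a))
    have h2 := (chartAt (EuclideanHalfSpace (n₀ + 1)) w₀).open_source.mem_nhds hs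
    refine ⟨_, mem_nhdsWithin_of_mem_nhds (inter_mem h1 h2), 1 - a, fun w hw => ⟨w₀, hw.2, ?_⟩⟩
    rw [neg_sub]
    exact le_of_lt hw.1

/-- On the left piece, the scalar curvature is positive if `l` is large and `N` is large in terms
of `l`. -/
theorem scalarCurvature_left_pos [IsManifold (𝓡∂ (n₁ + 1)) ∞ W₁] (g : SmoothMetric n M)
    (hg : g.inner = G.totalForm l N m) (hl : 0 < l) (hN : 0 < N) (hm : 0 < m)
    (h₀ : ∀ x, 0 < scalarCurvature g₀ x) {σ : ℝ} (h₁ : ∀ y, σ ≤ scalarCurvature g₁ y) {C : ℝ}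
    (hC : ∀ w ∈ collarCore F₀.collar 4, ∀ _ : M₁,
      ∃ w₀, w ∈ (chartAt (EuclideanHalfSpace (n₀ + 1)) w₀).source ∧
        -C ≤ scalAt (F₀.deepForm (extChartAt (𝓡∂ (n₀ + 1)) w₀).symm)
          (extChartAt (𝓡∂ (n₀ + 1)) w₀ w)) (hCl : C < l * σ) {Q : ℝ}
    (hQ : ∀ t, -4 ≤ t → t ≤ 0 → -(N⁻¹ * Q) ≤ warpTerm n₀ (scaleProfile l) (neckProfile l N m) t)
    (hQN : Q < N * σ) (w : W₀) (y : M₁) : 0 < scalarCurvature g (G.left (w, y)) := by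
  have hy := h₁ y
  by_cases hw : w ∈ collarCore F₀.collar 4
  -- beyond depth `4` the metric is a product, and the factor on `W₀` is scaled by `l`
  · obtain ⟨w₀, hs, hb⟩ := hC w hw y
    rw [G.scalarCurvature_left g hg hl hs hw y]
    have h2 : l⁻¹ * C < σ := by
      rw [inv_mul_lt_iff₀ hl]
      exact hCl
    have h3 := mul_le_mul_of_nonneg_left hb (inv_nonneg.mpr hl.le)
    linarith
  -- up to depth `4` the metric is the one on the neck
  · obtain ⟨x, s, hs, hs4, rfl⟩ := notMem_collarCore.mp hw
    rw [← G.neck_neg x y s hs, G.scalarCurvature_neck g hg hl hN hm x y (by linarith) (by linarith)]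
    have h2 : N⁻¹ * Q < σ := by
      rw [inv_mul_lt_iff₀ hN]
      exact hQN
    have h3 := hQ (-s) (by linarith) (by linarith)
    have h4 := mul_pos (inv_pos.mpr (scaleProfile_pos hl (by linarith : -6 < -s))) (h₀ x)
    linarith

/-- The scales `l` and `m` are chosen by `scalarCurvature_left_pos`, applied to the gluing and to
its mirror image; `N` is chosen last, as its lower bound depends on `l` and `m`. -/
theorem admitsPSC (G : CollaredGluing F₀ F₁ n M) [IsManifold (𝓡∂ (n₁ + 1)) ∞ W₁]
    [CompactSpace W₀] [CompactSpace W₁]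
    (h₀ : ∀ x, 0 < scalarCurvature g₀ x) (h₁ : ∀ y, 0 < scalarCurvature g₁ y) :
    AdmitsPSC n M := by
  obtain ⟨σ₀, hσ₀, hb₀⟩ := exists_pos_le_scalarCurvature g₀ h₀
  obtain ⟨σ₁, hσ₁, hb₁⟩ := exists_pos_le_scalarCurvature g₁ h₁
  obtain ⟨C₀, hC₀⟩ := G.exists_scalAt_deepForm_bound
  obtain ⟨C₁, hC₁⟩ := G.swap.exists_scalAt_deepForm_bound
  have key : ∀ σ > 0, ∀ a : ℝ, ∃ r₀, ∀ r ≥ r₀, 0 < r ∧ a < r * σ := by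
    intro σ hσ a
    refine ⟨|a| / σ + 1, fun r hr => ?_⟩
    have h1 : 0 ≤ |a| / σ := by positivity
    refine ⟨by linarith, ?_⟩
    rw [← div_lt_iff₀ hσ]
    have h2 : a / σ ≤ |a| / σ := by gcongr; exact le_abs_self a
    linarith
  obtain ⟨l, hl⟩ := key σ₁ hσ₁ C₀
  obtain ⟨hl, hlC⟩ := hl l le_rfl
  obtain ⟨m, hm⟩ := key σ₀ hσ₀ C₁
  obtain ⟨hm, hmC⟩ := hm m le_rfl
  obtain ⟨Q₀, hQ₀⟩ := exists_warpTerm_bound n₀ hl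
  obtain ⟨Q₁, hQ₁⟩ := exists_warpTerm_bound n₁ hm
  obtain ⟨N₀, hN₀⟩ := key σ₁ hσ₁ Q₀
  obtain ⟨N₁, hN₁⟩ := key σ₀ hσ₀ Q₁
  obtain ⟨hN, hNQ₀⟩ := hN₀ (max N₀ N₁) (le_max_left _ _)
  obtain ⟨-, hNQ₁⟩ := hN₁ (max N₀ N₁) (le_max_right _ _)
  set N := max N₀ N₁
  let g : SmoothMetric n M := .ofForm _ (G.isSmoothForm_totalForm l N m)
    (G.isInnerForm_totalForm hl hN hm)
  refine ⟨g, fun p => ?_⟩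
  rcases G.cover p with ⟨⟨w, y⟩, rfl⟩ | ⟨⟨v, x⟩, rfl⟩
  · exact G.scalarCurvature_left_pos g rfl hl hN hm h₀ hb₁ hC₀ hlC (hQ₀ N hN m) hNQ₀ w y
  · exact G.swap.scalarCurvature_left_pos g (G.swap_totalForm l N m).symm hm hN hl h₁ hb₀ hC₁ hmC
      (hQ₁ N hN l) hNQ₁ v x

end CollaredGluing

end ScalarCurvature

theorem bicollar_neg {M₀ W₀ M₁ W₁ M : Type*} (c₀ : M₀ × EuclideanHalfSpace 1 → W₀)
    (c₁ : M₁ × EuclideanHalfSpace 1 → W₁) (j₀ : W₀ × M₁ → M) (j₁ : M₀ × W₁ → M) (x : M₀) (y : M₁)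
    {s : ℝ} (hs : 0 ≤ s) :
    bicollar c₀ c₁ j₀ j₁ ((x, y), -s) = j₀ (c₀ (x, halfLinePoint s), y) := by
  rw [bicollar, if_pos (neg_nonpos.mpr hs), neg_neg]

theorem theorem3p4 (n₀ n₁ : ℕ)
    (M₀ : Type*) [TopologicalSpace M₀] [T2Space M₀] [CompactSpace M₀]
    [ChartedSpace (EuclideanSpace ℝ (Fin n₀)) M₀] [IsManifold (𝓡 n₀) ∞ M₀]
    (M₁ : Type*) [TopologicalSpace M₁] [T2Space M₁] [CompactSpace M₁]
    [ChartedSpace (EuclideanSpace ℝ (Fin n₁)) M₁] [IsManifold (𝓡 n₁) ∞ M₁]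
    (W₀ : Type*) [TopologicalSpace W₀] [T2Space W₀] [CompactSpace W₀]
    [ChartedSpace (EuclideanHalfSpace (n₀ + 1)) W₀] [IsManifold (𝓡∂ (n₀ + 1)) ∞ W₀]
    (W₁ : Type*) [TopologicalSpace W₁] [T2Space W₁] [CompactSpace W₁]
    [ChartedSpace (EuclideanHalfSpace (n₁ + 1)) W₁] [IsManifold (𝓡∂ (n₁ + 1)) ∞ W₁]
    (ι₀ : M₀ → W₀) (hι₀ : IsBoundaryInclusion n₀ ι₀)
    (ι₁ : M₁ → W₁) (hι₁ : IsBoundaryInclusion n₁ ι₁)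
    (M : Type*) [TopologicalSpace M] [T2Space M] [CompactSpace M]
    [ChartedSpace (EuclideanSpace ℝ (Fin (n₀ + n₁ + 1))) M] [IsManifold (𝓡 (n₀ + n₁ + 1)) ∞ M]
    (j₀ : W₀ × M₁ → M) (j₁ : M₀ × W₁ → M) (hM : IsSmoothGluing n₀ n₁ ι₀ ι₁ j₀ j₁)
    (h₀ : AdmitsPSC n₀ M₀) (h₁ : AdmitsPSC n₁ M₁) :
    AdmitsPSC (n₀ + n₁ + 1) M := by
  obtain ⟨g₀, hg₀⟩ := h₀
  obtain ⟨g₁, hg₁⟩ := h₁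
  obtain ⟨c₀, c₁, hc₀, hc₁, hb⟩ := hM.smooth_bicollar
  obtain ⟨F₀, rfl⟩ := exists_collaredFilling g₀ hι₀ hc₀
  obtain ⟨F₁, rfl⟩ := exists_collaredFilling g₁ hι₁ hc₁
  have heq : ∀ w y v x, j₀ (w, y) = (j₁ ∘ Prod.swap) (v, x) ↔
      w = F₀.collar (x, halfLinePoint 0) ∧ v = F₁.collar (y, halfLinePoint 0) := by
    intro w y v x
    rw [hc₀.apply_zero, hc₁.apply_zero]
    exact hM.eq_iff w y x v
  -- a symmetric description of the gluing requires the factors of the right piece to be exchanged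
  let G : CollaredGluing F₀ F₁ (n₀ + n₁ + 1) M :=
    { left := j₀
      right := j₁ ∘ Prod.swap
      neck := bicollar F₀.collar F₁.collar j₀ j₁
      injective_left := hM.injective_left
      injective_right := hM.injective_right.comp Prod.swap_injective
      cover := fun p => by
        rw [Prod.swap_surjective.range_comp, ← mem_union, hM.cover]
        exact mem_univ p
      eq_iff := heq
      isLocalDiffeomorphAt_left := hM.smooth_left
      isLocalDiffeomorphAt_right := fun v x hv =>
        ((Diffeomorph.prodComm (𝓡∂ (n₁ + 1)) (𝓡 n₀) W₁ M₀ ∞).isLocalDiffeomorph (v, x)).comp _ _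
          (hM.smooth_right x v hv)
      isLocalDiffeomorph_neck := hb
      neck_neg := fun x y s hs => bicollar_neg _ _ _ _ x y hs
      neck_pos := fun x y s hs => by
        rcases hs.eq_or_lt with rfl | hs
        -- at `t = 0`, `bicollar` is defined by the left piece
        · rw [← neg_zero, bicollar_neg _ _ _ _ x y le_rfl, neg_zero]
          exact (heq _ _ _ _).mpr ⟨rfl, rfl⟩
        · exact if_neg (not_le.mpr hs) }
  exact G.admitsPSC hg₀ hg₁

end
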